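/- Let $\Omega\subset\mathbb{R}^2$ be a bounded domain with Lipschitz boundary, $\mathbf V=(H^1_0(\Omega))^2$, $Q=L^2_0(\Omega)$ (the functions of $L^2(\Omega)$ with mean value zero), and $$a(\mathbf u,\mathbf v)=\int_\Omega\nabla\mathbf u:\nabla\mathbf v,\qquad b(\mathbf v,q)=\int_\Omega(\nabla\cdot\mathbf v)\,q,\qquad r(\mathbf u,\mathbf v)=\int_\Omega\mathbf u\cdot\mathbf v .$$ Write $\|\mathbf v\|_1=(r(\mathbf v,\mathbf v)+a(\mathbf v,\mathbf v))^{1/2}$, let $\|\cdot\|_0$ be the $L^2(\Omega)$ norm, and $\|\mathbf w\|_{-1}=\sup\{r(\mathbf w,\mathbf g):\mathbf g\in\mathbf V,\ \|\mathbf g\|_1\le 1\}$. *Exact eigenpair.* $(\mathbf u,p,\lambda)\in\mathbf V\times Q\times\mathbb R$ with $r(\mathbf u,\mathbf u)=1$, $a(\mathbf u,\mathbf v)-b(\mathbf v,p)=\lambda r(\mathbf u,\mathbf v)$ for all $\mathbf v\in\mathbf V$, and $b(\mathbf u,q)=0$ for all $q\in Q$. *Local projection stabilized (LPS) discretization.*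 A mesh $\mathcal T_h$ of $\Omega$ (finitely many pairwise disjoint open cells $K\subset\Omega$ covering $\Omega$ up to a null set); a finite-dimensional space $V_h$ of functions that are continuous on $\overline\Omega$ and polynomial on each cell; for each $K$ a finite-dimensional space $D_h(K)\subset L^2(K)$ and a parameter $\alpha_K\ge 0$. Put $\mathbf V_h=V_h^2\cap\mathbf V$, $Q_h=V_h\cap Q$ and $S_h(p,q)=\sum_{K}\alpha_K(\kappa_K\nabla p,\kappa_K\nabla q)_{L^2(K)}$, where $\kappa_K=\mathrm{id}-\pi_K$ acts componentwise and $\pi_K$ is the $L^2(K)$-orthogonal projection onto $D_h(K)$. A discrete eigenpair is $(\mathbf u_h,p_h,\lambda_h)\in\mathbf V_h\times Q_h\times\mathbb R$ with $r(\mathbf u_h,\mathbf u_h)=1$, $a(\mathbf u_h,\mathbf v)-b(\mathbf v,p_h)=\lambda_h r(\mathbf u_h,\mathbf v)$ for all $\mathbf v\in\mathbf V_h$, and $b(\mathbf u_h,q)+S_h(p_h,q)=0$ for all $q\in Q_h$. *Source problem.* Given a discrete eigenpair, $(\tilde{\mathbf u},\tilde p)\in\mathbf V\times Q$ satisfies $a(\tilde{\mathbf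 u},\mathbf v)-b(\mathbf v,\tilde p)=\lambda_h r(\mathbf u_h,\mathbf v)$ for all $\mathbf v\in\mathbf V$ and $b(\tilde{\mathbf u},q)=0$ for all $q\in Q$; if $\tilde{\mathbf u}\neq0$, put $\tilde\lambda=a(\tilde{\mathbf u},\tilde{\mathbf u})/r(\tilde{\mathbf u},\tilde{\mathbf u})$. **Theorem.** (a) For every $\lambda$ there are constants $C,\delta>0$, depending only on $\Omega$ and $\lambda$, such that for every exact eigenpair $(\mathbf u,p,\lambda)$, every LPS discretization, every discrete eigenpair $(\mathbf u_h,p_h,\lambda_h)$ and every corresponding $(\tilde{\mathbf u},\tilde p)$, $$\|\mathbf u-\tilde{\mathbf u}\|_1+\|p-\tilde p\|_0\le C\big(\|\mathbf u-\mathbf u_h\|_{-1}+|\lambda-\lambda_h|\big),\tag{1}$$ and, if $\|\mathbf u-\mathbf u_h\|_{-1}+|\lambda-\lambda_h|\le\delta$, then $\tilde{\mathbf u}\ne0$ and $$|\tilde\lambda-\lambda|\le C\big(\|\mathbf u-\mathbf u_h\|_{-1}^2+|\lambda-\lambda_h|^2\big).\tag{2}$$ (b) Consequently, if $(\mathbf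 u,p,\lambda)$ is an exact eigenpair and $(\mathbf u_{h_n},p_{h_n},\lambda_{h_n})$ is a sequence of discrete eigenpairs of LPS discretizations that approximates it, in the sense that $\|\mathbf u-\mathbf u_{h_n}\|_{-1}\to0$ and $\lambda_{h_n}\to\lambda$, then there is a constant $C>0$ independent of $n$ such that for all $n$ (1) holds, and (2) holds whenever $\tilde{\mathbf u}_n\neq0$. -/

import Mathlib

open MeasureTheory Set Filter Topology
open scoped ContDiff NNReal

noncomputable section

namespace StokesLPS

/-- The Euclidean plane. -/
abbrev Plane := EuclideanSpace ℝ (Fin 2)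

/-- The classical partial derivative `∂f/∂x_j` at `x`. -/
def partialDeriv (j : Fin 2) (f : Plane → ℝ) (x : Plane) : ℝ :=
  fderiv ℝ f x (EuclideanSpace.single j 1)

/-- A bounded domain with Lipschitz boundary: open, connected, bounded, and near every boundary
point, in suitable Cartesian coordinates, the set of points above the graph of a Lipschitz
function. -/
structure IsBoundedLipschitzDomain (Ω : Set Plane) : Prop where
  isOpen : IsOpen Ω
  isConnected : IsConnected Ω
  isBounded : Bornology.IsBounded Ω
  lipschitz_boundary : ∀ x ∈ frontier Ω,
    ∃ (e : Plane ≃ᵃⁱ[ℝ] Plane) (γ : ℝ → ℝ) (L : ℝ≥0), LipschitzWith L γ ∧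
      ∃ U ∈ 𝓝 x, ∀ y ∈ U, (y ∈ Ω ↔ γ (e y 0) < e y 1)

/-- `L²(Ω)`. -/
abbrev L2 (Ω : Set Plane) := Lp ℝ 2 (volume.restrict Ω)

/-- Membership in `Q = L²₀(Ω)`, the functions of `L²(Ω)` with mean value
zero. It is used for bounded `Ω`, where functions of `L²(Ω)` are integrable. -/
def IsMeanZero {Ω : Set Plane} (p : L2 Ω) : Prop := ∫ x in Ω, p x = 0

/-- The pairs `(φ, ∇φ)` in `L²(Ω) × L²(Ω)²` where `φ` is a smooth function with compact support in
`Ω`. -/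
def testJets (Ω : Set Plane) : Submodule ℝ (L2 Ω × (Fin 2 → L2 Ω)) where
  carrier := {J | ∃ φ : Plane → ℝ, ContDiff ℝ ∞ φ ∧ HasCompactSupport φ ∧ tsupport φ ⊆ Ω ∧
    J.1 =ᵐ[volume.restrict Ω] φ ∧ ∀ j, J.2 j =ᵐ[volume.restrict Ω] partialDeriv j φ}
  zero_mem' := by
    refine ⟨0, contDiff_const, HasCompactSupport.zero, by simp [tsupport], ?_, fun j => ?_⟩
    · exact Lp.coeFn_zero _ _ _
    · refine (Lp.coeFn_zero _ _ _).trans (Eventually.of_forall fun x => ?_)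
      simp [partialDeriv]
  add_mem' := by
    rintro J K ⟨φ, hφ, hφc, hφs, h1, h2⟩ ⟨ψ, hψ, hψc, hψs, k1, k2⟩
    refine ⟨φ + ψ, hφ.add hψ, hφc.add hψc,
      (tsupport_add φ ψ).trans (union_subset hφs hψs), ?_, fun j => ?_⟩
    · exact (Lp.coeFn_add _ _).trans (h1.add k1)
    · refine (Lp.coeFn_add _ _).trans (((h2 j).add (k2 j)).trans (Eventually.of_forall fun x => ?_))
      simp [partialDeriv, fderiv_add (hφ.differentiable (by simp) x)
        (hψ.differentiable (by simp) x)]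
  smul_mem' := by
    rintro c J ⟨φ, hφ, hφc, hφs, h1, h2⟩
    refine ⟨c • φ, hφ.const_smul c, hφc.smul_left (f := fun _ => c),
      (tsupport_smul_subset_right (fun _ => c) φ).trans hφs, ?_, fun j => ?_⟩
    · exact (Lp.coeFn_smul _ _).trans (h1.const_smul c)
    · refine (Lp.coeFn_smul _ _).trans
        (((h2 j).const_smul c).trans (Eventually.of_forall fun x => ?_))
      simp [partialDeriv, fderiv_const_smul (hφ.differentiable (by simp) x)]

/-- `H¹₀(Ω)`, the closure of the test functions in the `H¹` norm. An element is stored together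
with its weak gradient, as the pair `(w, ∇w)` in `L²(Ω) × L²(Ω)²`; the weak gradient is determined
by `w`. -/
def H10 (Ω : Set Plane) : Submodule ℝ (L2 Ω × (Fin 2 → L2 Ω)) :=
  (testJets Ω).topologicalClosure

/-- The velocity space `𝐕 = (H¹₀(Ω))²`. -/
abbrev Velocity (Ω : Set Plane) := Fin 2 → H10 Ω

/-- The component `u_i`. -/
def Velocity.comp {Ω : Set Plane} (u : Velocity Ω) (i : Fin 2) : L2 Ω := (u i).1.1

/-- The weak derivative `∂u_i/∂x_j`. -/
def Velocity.grad {Ω : Set Plane} (u : Velocity Ω) (i j : Fin 2) : L2 Ω := (u i).1.2 j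

/-- `a(u, v) = ∫_Ω ∇u : ∇v`. -/
def aForm {Ω : Set Plane} (u v : Velocity Ω) : ℝ :=
  ∫ x in Ω, ∑ i, ∑ j, u.grad i j x * v.grad i j x

/-- `b(v, q) = ∫_Ω (div v) q`. -/
def bForm {Ω : Set Plane} (v : Velocity Ω) (q : Plane → ℝ) : ℝ :=
  ∫ x in Ω, (∑ i, v.grad i i x) * q x

/-- `r(u, v) = ∫_Ω u · v`. -/
def rForm {Ω : Set Plane} (u v : Velocity Ω) : ℝ :=
  ∫ x in Ω, ∑ i, u.comp i x * v.comp i x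

/-- The norm `‖u‖₁` of `(H¹(Ω))²`. -/
def norm1 {Ω : Set Plane} (u : Velocity Ω) : ℝ := √(rForm u u + aForm u u)

/-- The dual norm `‖w‖₋₁ = sup { r(w, g) : g ∈ (H¹₀(Ω))², ‖g‖₁ ≤ 1 }`. -/
def normNeg1 {Ω : Set Plane} (w : Velocity Ω) : ℝ :=
  sSup {t : ℝ | ∃ g : Velocity Ω, norm1 g ≤ 1 ∧ t = rForm w g}

/-- The Rayleigh quotient `a(w, w) / r(w, w)`. -/
def rayleigh {Ω : Set Plane} (w : Velocity Ω) : ℝ := aForm w w / rForm w w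

/-- `(u, p, lam)` is a solution of the weak Stokes eigenvalue problem, normalized in `L²`. -/
structure IsStokesEigen {Ω : Set Plane} (u : Velocity Ω) (p : L2 Ω) (lam : ℝ) : Prop where
  mean_zero : IsMeanZero p
  normalized : rForm u u = 1
  momentum : ∀ v : Velocity Ω, aForm u v - bForm v p = lam * rForm u v
  divergence : ∀ q : L2 Ω, IsMeanZero q → bForm u q = 0

/-- `(w, p)` is a solution of the weak Stokes source problem with load `c • f`. -/
structure IsStokesSource {Ω : Set Plane} (c : ℝ) (f : Velocity Ω) (w : Velocity Ω) (p : L2 Ω) :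
    Prop where
  mean_zero : IsMeanZero p
  momentum : ∀ v : Velocity Ω, aForm w v - bForm v p = c * rForm f v
  divergence : ∀ q : L2 Ω, IsMeanZero q → bForm w q = 0

/-- The data of a one-level local projection stabilization: a mesh of `Ω` into finitely many open
cells of any shape, a scalar finite element space `Vh` of continuous piecewise polynomials over the
mesh, on each cell `K` a finite-dimensional projection space `Dh K ⊆ L²(K)` (which may be zero),
and the stabilization parameters `α K`. -/
structure Discretization (Ω : Set Plane) where
  numCells : ℕ
  cell : Fin numCells → Set Plane
  isOpen_cell : ∀ K, IsOpen (cell K)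
  isBounded_cell : ∀ K, Bornology.IsBounded (cell K)
  cell_subset : ∀ K, cell K ⊆ Ω
  cell_disjoint : Pairwise fun K K' => Disjoint (cell K) (cell K')
  cell_cover : volume (Ω \ ⋃ K, cell K) = 0
  Vh : Submodule ℝ (Plane → ℝ)
  finite_Vh : Module.Finite ℝ Vh
  continuous_Vh : ∀ v ∈ Vh, ContinuousOn v (closure Ω)
  polynomial_Vh : ∀ v ∈ Vh, ∀ K, ∃ P : MvPolynomial (Fin 2) ℝ,
    ∀ x ∈ cell K, v x = MvPolynomial.eval (fun i => x i) P
  Dh : ∀ K, Submodule ℝ (L2 (cell K))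
  finite_Dh : ∀ K, Module.Finite ℝ (Dh K)
  α : Fin numCells → ℝ
  α_nonneg : ∀ K, 0 ≤ α K

theorem contDiff_eval (P : MvPolynomial (Fin 2) ℝ) :
    ContDiff ℝ ∞ (fun x : Plane => MvPolynomial.eval (fun i => x i) P) := by
  induction P using MvPolynomial.induction_on with
  | C a => simpa using contDiff_const
  | add p q hp hq => simpa using hp.add hq
  | mul_X p i hp =>
    simp only [map_mul, MvPolynomial.eval_X]
    exact hp.mul (by fun_prop)

namespace Discretization

variable {Ω : Set Plane} (D : Discretization Ω)

theorem memLp_partialDeriv (K : Fin D.numCells) (j : Fin 2) (v : D.Vh) :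
    MemLp (partialDeriv j (v : Plane → ℝ)) 2 (volume.restrict (D.cell K)) := by
  obtain ⟨P, hP⟩ := D.polynomial_Vh v v.2 K
  have hc : Continuous (partialDeriv j fun x : Plane => MvPolynomial.eval (fun i => x i) P) :=
    ((contDiff_eval P).continuous_fderiv (by simp)).clm_apply continuous_const
  have hcpt : IsCompact (closure (D.cell K)) := (D.isBounded_cell K).isCompact_closure
  have hfin : volume (D.cell K) ≠ ⊤ := (D.isBounded_cell K).measure_lt_top.ne
  have : IsFiniteMeasure (volume.restrict (D.cell K)) :=
    ⟨by simpa using (D.isBounded_cell K).measure_lt_top⟩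
  obtain ⟨M, hM⟩ := hcpt.exists_bound_of_continuousOn hc.continuousOn
  have h : MemLp (partialDeriv j fun x : Plane => MvPolynomial.eval (fun i => x i) P) 2
      (volume.restrict (D.cell K)) := by
    refine MemLp.of_bound hc.aestronglyMeasurable M ?_
    filter_upwards [ae_restrict_mem (D.isOpen_cell K).measurableSet] with x hx
    exact hM x (subset_closure hx)
  refine h.ae_eq ?_
  filter_upwards [ae_restrict_mem (D.isOpen_cell K).measurableSet] with x hx
  have : (v : Plane → ℝ) =ᶠ[𝓝 x] fun x : Plane => MvPolynomial.eval (fun i => x i) P := by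
    filter_upwards [(D.isOpen_cell K).mem_nhds hx] with y hy using hP y hy
  simp [partialDeriv, this.fderiv_eq]

/-- The restriction of `∂v/∂x_j` to the cell `K`, as an element of `L²(K)`. -/
def cellDeriv (K : Fin D.numCells) (j : Fin 2) (v : D.Vh) : L2 (D.cell K) :=
  (D.memLp_partialDeriv K j v).toLp _

/-- The fluctuation operator `id - π_K` on `L²(K)`, with `π_K` the `L²(K)`-orthogonal projection
onto `Dh K`. -/
def fluctuation (K : Fin D.numCells) (w : L2 (D.cell K)) : L2 (D.cell K) :=
  haveI := D.finite_Dh K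
  w - (D.Dh K).starProjection w

/-- The stabilization term `S_h(p, q) = ∑_K α_K (κ_h ∇p, κ_h ∇q)_K`. -/
def stab (p q : D.Vh) : ℝ :=
  ∑ K, D.α K * ∑ j,
    inner ℝ (D.fluctuation K (D.cellDeriv K j p)) (D.fluctuation K (D.cellDeriv K j q))

/-- Membership in the discrete velocity space `𝐕_h = V_h² ∩ 𝐕`. -/
def MemVelocity (v : Velocity Ω) : Prop :=
  ∀ i, ∃ w ∈ D.Vh, v.comp i =ᵐ[volume.restrict Ω] w

/-- Membership in the discrete pressure space `Q_h = V_h ∩ Q`. -/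
def MemPressure (q : D.Vh) : Prop := ∫ x in Ω, (q : Plane → ℝ) x = 0

/-- `(uh, ph, lamh)` is a solution of the discrete (stabilized) Stokes eigenvalue problem,
normalized in `L²`. -/
structure IsEigen (uh : Velocity Ω) (ph : D.Vh) (lamh : ℝ) : Prop where
  mem_velocity : D.MemVelocity uh
  mem_pressure : D.MemPressure ph
  normalized : rForm uh uh = 1
  momentum : ∀ v : Velocity Ω, D.MemVelocity v →
    aForm uh v - bForm v (ph : Plane → ℝ) = lamh * rForm uh v
  divergence : ∀ q : D.Vh, D.MemPressure q → bForm uh (q : Plane → ℝ) + D.stab ph q = 0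

end Discretization

end StokesLPS

end

noncomputable section

namespace StokesLPS

/-! ### The forms as inner products of `L²(Ω)` -/

/-! Write e = u - ũ. Subtracting the momentum equations shows that e and p - p̃ solve a Stokes
problem with load λ r(u,·) - λ_h r(u_h,·) = λ r(u - u_h,·) + (λ - λ_h) r(u_h,·). As r(u_h,u_h) = 1,
this functional is bounded on 𝐕 by (|λ| + 1)(‖u - u_h‖₋₁ + |λ - λ_h|). Testing with the
divergence-free e and using Poincaré's inequality bounds e; the inf-sup condition then bounds the
pressure (`velocity_pressure_error`). An eigenpair is a stationary point of the Rayleigh quotient,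
so a(ũ,ũ) - λ r(ũ,ũ) is quadratic in e (`aForm_sub_eigenvalue_mul_rForm`), while r(ũ,ũ) stays away
from zero when e is small (`rayleigh_error`). Along a convergent sequence only finitely many terms
lie outside this regime, and they enlarge the constant (`exists_uniform_bound`).

The long part is the inf-sup condition on a Lipschitz domain (`exists_infSupBound`). Near a point of
the closure, Ω is stable under translation along a cone. For a test function F there, averaging the
integrals of F over the rays of the cone gives a field with divergence F, because integrating a
directional derivative along a ray returns F. A cutoff keeps the field supported in Ω at the cost of
a remainder R whose gradient is bounded by F in L² (`exists_local_solver`). The L² bound for the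
derivatives of the field is a singular integral estimate. After a Fourier transform in one variable
it becomes Young's inequality with a kernel whose L¹ norm does not depend on the frequency
(`lintegral_rayAverage_deriv_sq_le`).

Pairing p with F then costs ‖∇p‖₋₁ plus the pairing of p with R. Since R is bounded in H¹, replacing
it by its averages over a fine grid reduces that pairing to a small multiple of ‖p‖ and finitely
many integrals of p (`exists_finite_control`). Absorbing the small multiple gives ‖p‖ ≤ K(‖∇p‖₋₁ +
finitely many integrals of p) (`exists_necas`). A compactness argument removes the integrals: a
normalized sequence violating inf-sup has a convergent subsequence, whose limit has zero gradient
and zero mean, hence vanishes, yet has norm one. -/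

theorem inner_eq_integral {Ω : Set Plane} (f g : L2 Ω) : inner ℝ f g = ∫ x in Ω, f x * g x := by
  rw [L2.inner_def]
  exact integral_congr_ae (Eventually.of_forall fun x => by simp [mul_comm])

theorem integrable_mul {Ω : Set Plane} (f g : L2 Ω) :
    Integrable (fun x => f x * g x) (volume.restrict Ω) :=
  (Lp.memLp f).integrable_mul (Lp.memLp g)

theorem rForm_eq {Ω : Set Plane} (u v : Velocity Ω) :
    rForm u v = ∑ i, inner ℝ (u.comp i) (v.comp i) := by
  simp_rw [rForm, inner_eq_integral]
  exact integral_finsetSum _ fun i _ => integrable_mul _ _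

theorem aForm_eq {Ω : Set Plane} (u v : Velocity Ω) :
    aForm u v = ∑ i, ∑ j, inner ℝ (u.grad i j) (v.grad i j) := by
  simp_rw [aForm, inner_eq_integral]
  rw [integral_finsetSum _ fun i _ => integrable_finsetSum _ fun j _ => integrable_mul _ _]
  exact Finset.sum_congr rfl fun i _ => integral_finsetSum _ fun j _ => integrable_mul _ _

theorem bForm_eq {Ω : Set Plane} (v : Velocity Ω) (q : L2 Ω) :
    bForm v q = ∑ i, inner ℝ (v.grad i i) q := by
  simp_rw [bForm, inner_eq_integral, Finset.sum_mul]
  exact integral_finsetSum _ fun i _ => integrable_mul _ _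

@[simp] theorem comp_sub {Ω : Set Plane} (u v : Velocity Ω) (i : Fin 2) :
    (u - v).comp i = u.comp i - v.comp i := rfl

@[simp] theorem grad_sub {Ω : Set Plane} (u v : Velocity Ω) (i j : Fin 2) :
    (u - v).grad i j = u.grad i j - v.grad i j := rfl

@[simp] theorem comp_smul {Ω : Set Plane} (c : ℝ) (u : Velocity Ω) (i : Fin 2) :
    (c • u).comp i = c • u.comp i := rfl

@[simp] theorem grad_smul {Ω : Set Plane} (c : ℝ) (u : Velocity Ω) (i j : Fin 2) :
    (c • u).grad i j = c • u.grad i j := rfl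

theorem rForm_sub_left {Ω : Set Plane} (u v w : Velocity Ω) :
    rForm (u - v) w = rForm u w - rForm v w := by
  simp [rForm_eq, inner_sub_left, Finset.sum_sub_distrib]

theorem aForm_sub_left {Ω : Set Plane} (u v w : Velocity Ω) :
    aForm (u - v) w = aForm u w - aForm v w := by
  simp [aForm_eq, inner_sub_left, Finset.sum_sub_distrib]

theorem bForm_sub_left {Ω : Set Plane} (u v : Velocity Ω) (q : L2 Ω) :
    bForm (u - v) q = bForm u q - bForm v q := by
  simp [bForm_eq, inner_sub_left, Finset.sum_sub_distrib]

theorem bForm_sub_right {Ω : Set Plane} (u : Velocity Ω) (p q : L2 Ω) :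
    bForm u (p - q : L2 Ω) = bForm u p - bForm u q := by
  rw [bForm_eq, bForm_eq, bForm_eq, ← Finset.sum_sub_distrib]
  exact Finset.sum_congr rfl fun i _ => inner_sub_right _ _ _

theorem rForm_comm {Ω : Set Plane} (u v : Velocity Ω) : rForm u v = rForm v u := by
  simp [rForm_eq, real_inner_comm]

theorem aForm_comm {Ω : Set Plane} (u v : Velocity Ω) : aForm u v = aForm v u := by
  simp [aForm_eq, real_inner_comm]

theorem rForm_smul_right {Ω : Set Plane} (c : ℝ) (u v : Velocity Ω) :
    rForm u (c • v) = c * rForm u v := by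
  simp only [rForm_eq, comp_smul, inner_smul_right, Finset.mul_sum]

theorem aForm_smul_right {Ω : Set Plane} (c : ℝ) (u v : Velocity Ω) :
    aForm u (c • v) = c * aForm u v := by
  simp only [aForm_eq, grad_smul, inner_smul_right, Finset.mul_sum]

theorem bForm_smul_left {Ω : Set Plane} (c : ℝ) (u : Velocity Ω) (q : L2 Ω) :
    bForm (c • u) q = c * bForm u q := by
  simp only [bForm_eq, grad_smul, real_inner_smul_left, Finset.mul_sum]

theorem rForm_self_eq {Ω : Set Plane} (u : Velocity Ω) :
    rForm u u = ∑ i, ‖u.comp i‖ ^ 2 := by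
  simp [rForm_eq]

theorem aForm_self_eq {Ω : Set Plane} (u : Velocity Ω) :
    aForm u u = ∑ i, ∑ j, ‖u.grad i j‖ ^ 2 := by
  simp [aForm_eq]

theorem rForm_self_nonneg {Ω : Set Plane} (u : Velocity Ω) : 0 ≤ rForm u u := by
  rw [rForm_self_eq]; positivity

theorem aForm_self_nonneg {Ω : Set Plane} (u : Velocity Ω) : 0 ≤ aForm u u := by
  rw [aForm_self_eq]; positivity

theorem norm1_nonneg {Ω : Set Plane} (u : Velocity Ω) : 0 ≤ norm1 u := Real.sqrt_nonneg _

theorem norm1_sq {Ω : Set Plane} (u : Velocity Ω) : norm1 u ^ 2 = rForm u u + aForm u u :=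
  Real.sq_sqrt (add_nonneg (rForm_self_nonneg u) (aForm_self_nonneg u))

/-- Cauchy–Schwarz for a sum of inner products. -/
theorem sum_inner_sq_le {ι H : Type*} [Fintype ι] [NormedAddCommGroup H] [InnerProductSpace ℝ H]
    (f g : ι → H) :
    (∑ i, inner ℝ (f i) (g i)) ^ 2 ≤ (∑ i, ‖f i‖ ^ 2) * ∑ i, ‖g i‖ ^ 2 := by
  have h : |∑ i, inner ℝ (f i) (g i)| ≤ ∑ i, ‖f i‖ * ‖g i‖ :=
    (Finset.abs_sum_le_sum_abs _ _).trans
      (Finset.sum_le_sum fun i _ => abs_real_inner_le_norm _ _)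
  calc (∑ i, inner ℝ (f i) (g i)) ^ 2 = |∑ i, inner ℝ (f i) (g i)| ^ 2 := (sq_abs _).symm
    _ ≤ (∑ i, ‖f i‖ * ‖g i‖) ^ 2 := by gcongr
    _ ≤ _ := Finset.sum_mul_sq_le_sq_mul_sq _ _ _

theorem rForm_sq_le {Ω : Set Plane} (u v : Velocity Ω) :
    rForm u v ^ 2 ≤ rForm u u * rForm v v := by
  rw [rForm_self_eq, rForm_self_eq, rForm_eq]
  exact sum_inner_sq_le _ _

theorem aForm_sq_le {Ω : Set Plane} (u v : Velocity Ω) :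
    aForm u v ^ 2 ≤ aForm u u * aForm v v := by
  have := sum_inner_sq_le (fun k : Fin 2 × Fin 2 => u.grad k.1 k.2)
    (fun k : Fin 2 × Fin 2 => v.grad k.1 k.2)
  simpa only [aForm_self_eq, aForm_eq u v, Fintype.sum_prod_type] using this

theorem abs_rForm_le {Ω : Set Plane} (u v : Velocity Ω) :
    |rForm u v| ≤ √(rForm u u) * norm1 v := by
  refine abs_le_of_sq_le_sq (?_) (mul_nonneg (Real.sqrt_nonneg _) (norm1_nonneg v))
  rw [mul_pow, Real.sq_sqrt (rForm_self_nonneg u), norm1_sq]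
  exact (rForm_sq_le u v).trans
    (mul_le_mul_of_nonneg_left (by linarith [aForm_self_nonneg v]) (rForm_self_nonneg u))

theorem abs_aForm_le {Ω : Set Plane} (u v : Velocity Ω) :
    |aForm u v| ≤ norm1 u * norm1 v := by
  refine abs_le_of_sq_le_sq (?_) (mul_nonneg (norm1_nonneg u) (norm1_nonneg v))
  rw [mul_pow, norm1_sq, norm1_sq]
  exact (aForm_sq_le u v).trans (mul_le_mul (by linarith [rForm_self_nonneg u])
    (by linarith [rForm_self_nonneg v]) (aForm_self_nonneg v)
    (add_nonneg (rForm_self_nonneg u) (aForm_self_nonneg u)))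

/-! ### The dual norm -/

theorem norm1_smul {Ω : Set Plane} (c : ℝ) (u : Velocity Ω) : norm1 (c • u) = |c| * norm1 u := by
  have h : rForm (c • u) (c • u) + aForm (c • u) (c • u) = c ^ 2 * (rForm u u + aForm u u) := by
    rw [rForm_smul_right, rForm_comm, rForm_smul_right, aForm_smul_right, aForm_comm,
      aForm_smul_right]
    ring
  rw [norm1, h, Real.sqrt_mul (sq_nonneg c), Real.sqrt_sq_eq_abs, norm1]

/-- A real `sSup` of an unbounded set is 0 by default, so the dual norm dominates its members only
once the set is known to be bounded; Cauchy–Schwarz in L² provides this. -/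
theorem bddAbove_normNeg1 {Ω : Set Plane} (w : Velocity Ω) :
    BddAbove {t : ℝ | ∃ g : Velocity Ω, norm1 g ≤ 1 ∧ t = rForm w g} := by
  refine ⟨√(rForm w w), ?_⟩
  rintro _ ⟨g, hg, rfl⟩
  refine (le_abs_self _).trans ((abs_rForm_le w g).trans ?_)
  exact mul_le_of_le_one_right (Real.sqrt_nonneg _) hg

theorem normNeg1_nonneg {Ω : Set Plane} (w : Velocity Ω) : 0 ≤ normNeg1 w := by
  refine le_csSup (bddAbove_normNeg1 w) ⟨(0 : ℝ) • (0 : Velocity Ω), ?_, ?_⟩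
  · rw [norm1_smul]; simp
  · rw [rForm_smul_right]; simp

theorem rForm_le_normNeg1_mul {Ω : Set Plane} (w g : Velocity Ω) :
    rForm w g ≤ normNeg1 w * norm1 g := by
  rcases eq_or_ne (norm1 g) 0 with h | h
  · have := abs_rForm_le w g
    rw [h, mul_zero] at this ⊢
    exact (le_abs_self _).trans this
  · have hpos : 0 < norm1 g := lt_of_le_of_ne (norm1_nonneg g) h.symm
    have h1 : rForm w ((norm1 g)⁻¹ • g) ≤ normNeg1 w := by
      refine le_csSup (bddAbove_normNeg1 w) ⟨_, ?_, rfl⟩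
      rw [norm1_smul, abs_of_pos (inv_pos.2 hpos), inv_mul_cancel₀ h]
    rw [rForm_smul_right, inv_mul_le_iff₀ hpos] at h1
    linarith

theorem abs_rForm_le_normNeg1_mul {Ω : Set Plane} (w g : Velocity Ω) :
    |rForm w g| ≤ normNeg1 w * norm1 g := by
  refine abs_le'.2 ⟨rForm_le_normNeg1_mul w g, ?_⟩
  have := rForm_le_normNeg1_mul w ((-1 : ℝ) • g)
  rw [rForm_smul_right, norm1_smul] at this
  simpa using this

/-! ### The error estimates, given the Poincaré inequality and the inf-sup condition -/

/-- The Poincaré inequality on the velocity space. -/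
def PoincareBound (Ω : Set Plane) (P : ℝ) : Prop :=
  ∀ v : Velocity Ω, norm1 v ^ 2 ≤ P * aForm v v

/-- The inf-sup condition for the pair `(𝐕, Q)`. -/
def InfSupBound (Ω : Set Plane) (β : ℝ) : Prop :=
  ∀ (p : L2 Ω) (M : ℝ), IsMeanZero p → 0 ≤ M → (∀ v : Velocity Ω, bForm v p ≤ M * norm1 v) →
    ‖p‖ ≤ β * M

theorem IsMeanZero.sub {Ω : Set Plane} (hΩ : Bornology.IsBounded Ω) {p q : L2 Ω}
    (hp : IsMeanZero p) (hq : IsMeanZero q) : IsMeanZero (p - q) := by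
  have : IsFiniteMeasure (volume.restrict Ω) := ⟨by simpa using hΩ.measure_lt_top⟩
  have hi (f : L2 Ω) : Integrable f (volume.restrict Ω) := (Lp.memLp f).integrable (by norm_num)
  rw [IsMeanZero, integral_congr_ae (Lp.coeFn_sub p q)]
  simp only [Pi.sub_apply]
  rw [integral_sub (hi p) (hi q), hp, hq, sub_zero]

section Estimates

variable {Ω : Set Plane} {P β lam lamh : ℝ} {u uh ut : Velocity Ω} {p pt : L2 Ω}

/-- The energy argument for a saddle point problem. Poincaré makes `aForm` coercive, giving P η for
the velocity error; inf-sup with M = (P + 1) η handles the pressure, where P η comes from the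
velocity error and η from the load. -/
theorem velocity_pressure_error (hΩ : Bornology.IsBounded Ω) (hP0 : 0 ≤ P)
    (hP : PoincareBound Ω P) (hβ : InfSupBound Ω β) (h : IsStokesEigen u p lam)
    (huh : rForm uh uh = 1) (ht : IsStokesSource lamh uh ut pt) :
    norm1 (u - ut) + ‖p - pt‖ ≤
      (P + β * (P + 1)) * (|lam| + 1) * (normNeg1 (u - uh) + |lam - lamh|) := by
  set X := normNeg1 (u - uh) with hX
  set Y := |lam - lamh| with hY
  have hX0 : 0 ≤ X := normNeg1_nonneg _
  have hY0 : 0 ≤ Y := abs_nonneg _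
  set η := (|lam| + 1) * (X + Y) with hη
  have hη0 : 0 ≤ η := by positivity
  have hF (v : Velocity Ω) : |lam * rForm u v - lamh * rForm uh v| ≤ η * norm1 v := by
    have e : lam * rForm u v - lamh * rForm uh v
        = lam * rForm (u - uh) v + (lam - lamh) * rForm uh v := by
      rw [rForm_sub_left]; ring
    have h2 : |rForm uh v| ≤ norm1 v := by
      simpa [huh] using abs_rForm_le uh v
    rw [e]
    calc _ ≤ |lam| * |rForm (u - uh) v| + Y * |rForm uh v| := by
            rw [hY, ← abs_mul, ← abs_mul]; exact abs_add_le _ _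
      _ ≤ |lam| * (X * norm1 v) + Y * norm1 v := by
            gcongr; exact abs_rForm_le_normNeg1_mul _ _
      _ = (|lam| * X + Y) * norm1 v := by ring
      _ ≤ _ := by
            refine mul_le_mul_of_nonneg_right ?_ (norm1_nonneg v)
            rw [hη]
            nlinarith [mul_nonneg (abs_nonneg lam) hY0]
  have hmom (v : Velocity Ω) :
      aForm (u - ut) v - bForm v (p - pt : L2 Ω) = lam * rForm u v - lamh * rForm uh v := by
    rw [aForm_sub_left, bForm_sub_right, ← h.momentum, ← ht.momentum]; ring
  have hmz : IsMeanZero (p - pt) := h.mean_zero.sub hΩ ht.mean_zero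
  -- Both velocities are divergence free, so the pressure drops out when the error equation is
  -- tested with the velocity error itself.
  have hb : bForm (u - ut) (p - pt : L2 Ω) = 0 := by
    rw [bForm_sub_left, h.divergence _ hmz, ht.divergence _ hmz, sub_zero]
  have he : norm1 (u - ut) ≤ P * η := by
    have h1 : aForm (u - ut) (u - ut) ≤ η * norm1 (u - ut) := by
      have := hmom (u - ut)
      rw [hb, sub_zero] at this
      rw [this]
      exact (le_abs_self _).trans (hF _)
    have h2 := hP (u - ut)
    rcases eq_or_lt_of_le (norm1_nonneg (u - ut)) with h0 | h0
    · rw [← h0]; positivity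
    · refine le_of_mul_le_mul_right ?_ h0
      calc _ = norm1 (u - ut) ^ 2 := by ring
        _ ≤ P * (η * norm1 (u - ut)) := h2.trans (by gcongr)
        _ = _ := by ring
  have hp : ‖p - pt‖ ≤ β * ((P + 1) * η) := by
    refine hβ _ _ hmz (by positivity) fun v => ?_
    have e : bForm v (p - pt : L2 Ω) =
        aForm (u - ut) v - (lam * rForm u v - lamh * rForm uh v) := by
      rw [← hmom v]; ring
    rw [e]
    calc _ ≤ |aForm (u - ut) v| + |lam * rForm u v - lamh * rForm uh v| := by
            linarith [le_abs_self (aForm (u - ut) v),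
              neg_abs_le (lam * rForm u v - lamh * rForm uh v)]
      _ ≤ norm1 (u - ut) * norm1 v + η * norm1 v := add_le_add (abs_aForm_le _ _) (hF v)
      _ ≤ P * η * norm1 v + η * norm1 v := by
            gcongr; exact norm1_nonneg v
      _ = _ := by ring
  calc _ ≤ P * η + β * ((P + 1) * η) := add_le_add he hp
    _ = _ := by rw [hη]; ring

/-- The Rayleigh quotient is stationary at an eigenpair. -/
theorem aForm_sub_eigenvalue_mul_rForm (h : IsStokesEigen u p lam)
    (ht : IsStokesSource lamh uh ut pt) :
    aForm ut ut - lam * rForm ut ut =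
      aForm (u - ut) (u - ut) - lam * rForm (u - ut) (u - ut) := by
  -- Testing the eigenvalue equation with u and with ũ, both divergence free, gives a(u,u) = λ
  -- r(u,u) and a(u,ũ) = λ r(u,ũ). After expanding the squares, exactly these terms cancel.
  have h1 := h.momentum u
  have h2 := h.momentum ut
  rw [h.divergence p h.mean_zero] at h1
  rw [ht.divergence p h.mean_zero] at h2
  have e1 : aForm (u - ut) (u - ut) = aForm u u - 2 * aForm u ut + aForm ut ut := by
    rw [aForm_sub_left, aForm_comm u, aForm_comm ut, aForm_sub_left, aForm_sub_left,
      aForm_comm ut u]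
    ring
  have e2 : rForm (u - ut) (u - ut) = rForm u u - 2 * rForm u ut + rForm ut ut := by
    rw [rForm_sub_left, rForm_comm u, rForm_comm ut, rForm_sub_left, rForm_sub_left,
      rForm_comm ut u]
    ring
  rw [e1, e2]
  linarith

/-- The reverse triangle inequality in L², written with squares: ‖ũ‖₀ ≥ ‖u‖₀ - ‖u - ũ‖₀ ≥ 1 - 1/2.
-/
theorem rForm_ge_of_norm1_le (h : rForm u u = 1) (he : norm1 (u - ut) ≤ 1 / 2) :
    1 / 4 ≤ rForm ut ut := by
  have e2 : rForm (u - ut) (u - ut) = rForm u u - 2 * rForm u ut + rForm ut ut := by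
    rw [rForm_sub_left, rForm_comm u, rForm_comm ut, rForm_sub_left, rForm_sub_left,
      rForm_comm ut u]
    ring
  have h1 : rForm (u - ut) (u - ut) ≤ 1 / 4 := by
    have h2 := norm1_sq (u - ut)
    nlinarith [aForm_self_nonneg (u - ut), norm1_nonneg (u - ut)]
  have h3 := rForm_sq_le u ut
  rw [h, one_mul] at h3
  rw [h] at e2
  have h4 := rForm_self_nonneg ut
  by_contra! hc
  have h5 : rForm u ut < 1 / 2 := by nlinarith
  nlinarith

/-- The numerator of the Rayleigh error is at most (|λ| + 1)‖u - ũ‖₁². The factor 8 is 4 from the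
lower bound 1/4 on the denominator times 2 from (X + Y)² ≤ 2(X² + Y²). -/
theorem rayleigh_error {K X Y : ℝ}
    (h : IsStokesEigen u p lam) (ht : IsStokesSource lamh uh ut pt)
    (hK : norm1 (u - ut) ≤ K * (X + Y))
    (hs : K * (X + Y) ≤ 1 / 2) :
    ut ≠ 0 ∧ |rayleigh ut - lam| ≤ 8 * (|lam| + 1) * K ^ 2 * (X ^ 2 + Y ^ 2) := by
  have hr := rForm_ge_of_norm1_le h.normalized (hK.trans hs)
  have hr0 : 0 < rForm ut ut := by linarith
  constructor
  · rintro rfl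
    have : rForm (0 : Velocity Ω) 0 = 0 := by
      have := rForm_smul_right 0 (0 : Velocity Ω) 0
      simpa using this
    linarith
  · have e : rayleigh ut - lam = (aForm ut ut - lam * rForm ut ut) / rForm ut ut := by
      rw [rayleigh]; field_simp
    have hb : |aForm ut ut - lam * rForm ut ut| ≤ (|lam| + 1) * norm1 (u - ut) ^ 2 := by
      rw [aForm_sub_eigenvalue_mul_rForm h ht, norm1_sq]
      have h1 := rForm_self_nonneg (u - ut)
      have h2 := aForm_self_nonneg (u - ut)
      calc _ ≤ |aForm (u - ut) (u - ut)| + |lam * rForm (u - ut) (u - ut)| := abs_sub _ _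
        _ = aForm (u - ut) (u - ut) + |lam| * rForm (u - ut) (u - ut) := by
            rw [abs_of_nonneg h2, abs_mul, abs_of_nonneg h1]
        _ ≤ _ := by nlinarith [abs_nonneg lam, mul_nonneg (abs_nonneg lam) h2]
    rw [e, abs_div, abs_of_pos hr0, div_le_iff₀ hr0]
    have hsq : norm1 (u - ut) ^ 2 ≤ K ^ 2 * (2 * (X ^ 2 + Y ^ 2)) := by
      calc _ ≤ (K * (X + Y)) ^ 2 := by gcongr; exact norm1_nonneg _
        _ = K ^ 2 * (X + Y) ^ 2 := by ring
        _ ≤ _ := by gcongr; nlinarith [sq_nonneg (X - Y)]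
    calc _ ≤ (|lam| + 1) * (K ^ 2 * (2 * (X ^ 2 + Y ^ 2))) := hb.trans (by gcongr)
      _ = 8 * (|lam| + 1) * K ^ 2 * (X ^ 2 + Y ^ 2) * (1 / 4) := by ring
      _ ≤ _ := by gcongr

/-- An estimate that holds where `x n` is small holds for all `n`, with a larger constant, if
`x n` tends to zero. -/
theorem exists_uniform_bound {x y z : ℕ → ℝ} {C δ : ℝ} (hC : 0 < C) (hδ : 0 < δ)
    (hx : Tendsto x atTop (𝓝 0)) (hz : ∀ n, x n ^ 2 ≤ 2 * z n)
    (h : ∀ n, x n ≤ δ → y n ≤ C * z n) : ∃ C', C ≤ C' ∧ ∀ n, y n ≤ C' * z n := by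
  obtain ⟨N, hN⟩ := eventually_atTop.1 (hx.eventually (ge_mem_nhds hδ))
  have hz0 (n : ℕ) : 0 ≤ z n := by nlinarith [hz n, sq_nonneg (x n)]
  -- The finitely many indices that may exceed δ are paid for by adding their ratios y/z to C. For
  -- them x > δ > 0 and x² ≤ 2z force z > 0, so the ratio is not the default value of division by
  -- zero.
  refine ⟨C + ∑ n ∈ Finset.range N, |y n / z n|, le_add_of_nonneg_right (by positivity),
    fun n => ?_⟩
  by_cases hn : x n ≤ δ
  · refine (h n hn).trans (mul_le_mul_of_nonneg_right ?_ (hz0 n))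
    exact le_add_of_nonneg_right (by positivity)
  · have hnN : n < N := by
      by_contra! hc
      exact hn (hN n hc)
    push Not at hn
    have hzn : 0 < z n := by nlinarith [hz n]
    have h1 : y n / z n ≤ C + ∑ n ∈ Finset.range N, |y n / z n| :=
      (le_abs_self _).trans ((Finset.single_le_sum (f := fun n => |y n / z n|)
        (fun i _ => abs_nonneg _) (Finset.mem_range.2 hnN)).trans (by linarith))
    exact (div_le_iff₀ hzn).1 h1

end Estimates

/-- The error estimates, from the Poincaré inequality and the inf-sup condition. -/
theorem error_estimates {Ω : Set Plane} (hΩ : Bornology.IsBounded Ω) {P β : ℝ} (hP0 : 0 < P)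
    (hβ0 : 0 < β) (hP : PoincareBound Ω P) (hβ : InfSupBound Ω β) (lam : ℝ) :
    (∃ C δ : ℝ, 0 < C ∧ 0 < δ ∧
      ∀ (u : Velocity Ω) (p : L2 Ω), IsStokesEigen u p lam →
      ∀ (D : Discretization Ω) (uh : Velocity Ω) (ph : D.Vh) (lamh : ℝ), D.IsEigen uh ph lamh →
      ∀ (ut : Velocity Ω) (pt : L2 Ω), IsStokesSource lamh uh ut pt →
        norm1 (u - ut) + ‖p - pt‖ ≤ C * (normNeg1 (u - uh) + |lam - lamh|) ∧
        (normNeg1 (u - uh) + |lam - lamh| ≤ δ →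
          ut ≠ 0 ∧
          |rayleigh ut - lam| ≤ C * (normNeg1 (u - uh) ^ 2 + |lam - lamh| ^ 2))) ∧
    (∀ (u : Velocity Ω) (p : L2 Ω), IsStokesEigen u p lam →
      ∀ (D : ℕ → Discretization Ω) (uh : ℕ → Velocity Ω) (ph : ∀ n, (D n).Vh) (lamh : ℕ → ℝ),
        (∀ n, (D n).IsEigen (uh n) (ph n) (lamh n)) →
        Tendsto (fun n => normNeg1 (u - uh n)) atTop (𝓝 0) →
        Tendsto lamh atTop (𝓝 lam) →
      ∀ (ut : ℕ → Velocity Ω) (pt : ℕ → L2 Ω),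
        (∀ n, IsStokesSource (lamh n) (uh n) (ut n) (pt n)) →
        ∃ C : ℝ, 0 < C ∧ ∀ n,
          norm1 (u - ut n) + ‖p - pt n‖ ≤ C * (normNeg1 (u - uh n) + |lam - lamh n|) ∧
          (ut n ≠ 0 →
            |rayleigh (ut n) - lam| ≤
              C * (normNeg1 (u - uh n) ^ 2 + |lam - lamh n| ^ 2))) := by
  set K := (P + β * (P + 1)) * (|lam| + 1) with hK
  have hK0 : 0 < K := by positivity
  -- The sum of the constants of the two estimates serves both. The threshold 1/(2K) used below
  -- turns the bound on ‖u - ũ‖₁ into 1/2.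
  have hC0 : 0 < K + 8 * (|lam| + 1) * K ^ 2 := by positivity
  have key : ∀ (u : Velocity Ω) (p : L2 Ω), IsStokesEigen u p lam →
      ∀ (D : Discretization Ω) (uh : Velocity Ω) (ph : D.Vh) (lamh : ℝ), D.IsEigen uh ph lamh →
      ∀ (ut : Velocity Ω) (pt : L2 Ω), IsStokesSource lamh uh ut pt →
        norm1 (u - ut) + ‖p - pt‖ ≤
          (K + 8 * (|lam| + 1) * K ^ 2) * (normNeg1 (u - uh) + |lam - lamh|) ∧
        (normNeg1 (u - uh) + |lam - lamh| ≤ 1 / (2 * K) →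
          ut ≠ 0 ∧ |rayleigh ut - lam| ≤
            (K + 8 * (|lam| + 1) * K ^ 2) * (normNeg1 (u - uh) ^ 2 + |lam - lamh| ^ 2)) := by
    intro u p h D uh ph lamh hh ut pt ht
    have hX0 := normNeg1_nonneg (u - uh)
    have hm := velocity_pressure_error hΩ hP0.le hP hβ h hh.normalized ht
    refine ⟨hm.trans ?_, fun hs => ?_⟩
    · refine mul_le_mul_of_nonneg_right ?_ (by positivity)
      exact le_add_of_nonneg_right (by positivity)
    · have h1 : K * (normNeg1 (u - uh) + |lam - lamh|) ≤ 1 / 2 := by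
        calc _ ≤ K * (1 / (2 * K)) := by gcongr
          _ = 1 / 2 := by field_simp
      obtain ⟨h2, h3⟩ := rayleigh_error h ht
        ((le_add_of_nonneg_right (norm_nonneg _)).trans hm) h1
      refine ⟨h2, h3.trans (mul_le_mul_of_nonneg_right ?_ (by positivity))⟩
      exact le_add_of_nonneg_left hK0.le
  refine ⟨⟨_, 1 / (2 * K), hC0, by positivity, key⟩, ?_⟩
  intro u p h D uh ph lamh hh hX hY ut pt ht
  have hx : Tendsto (fun n => normNeg1 (u - uh n) + |lam - lamh n|) atTop (𝓝 0) := by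
    have : Tendsto (fun n => |lam - lamh n|) atTop (𝓝 0) := by
      simpa using (tendsto_const_nhds (x := lam).sub hY).abs
    simpa using hX.add this
  obtain ⟨C', hCC', hC'⟩ := exists_uniform_bound
    (y := fun n => |rayleigh (ut n) - lam|)
    (z := fun n => normNeg1 (u - uh n) ^ 2 + |lam - lamh n| ^ 2) hC0
    (by positivity : 0 < 1 / (2 * K)) hx
    (fun n => by nlinarith [sq_nonneg (normNeg1 (u - uh n) - |lam - lamh n|)])
    (fun n hn => ((key u p h (D n) (uh n) (ph n) (lamh n) (hh n) (ut n) (pt n) (ht n)).2 hn).2)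
  refine ⟨C', hC0.trans_le hCC', fun n => ⟨?_, fun _ => hC' n⟩⟩
  refine (key u p h (D n) (uh n) (ph n) (lamh n) (hh n) (ut n) (pt n) (ht n)).1.trans ?_
  exact mul_le_mul_of_nonneg_right hCC'
    (add_nonneg (normNeg1_nonneg _) (abs_nonneg _))

/-! ### Averages over rays in the plane `ℝ × ℝ` -/

section RayAverage

open FourierTransform
open scoped ENNReal

/-- Plancherel's theorem for a real-valued test function on the line. -/
theorem lintegral_fourier_sq {g : ℝ → ℝ} (hg : ContDiff ℝ ∞ g) (hc : HasCompactSupport g) :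
    ∫⁻ ξ, ‖𝓕 (fun x => (g x : ℂ)) ξ‖ₑ ^ 2 = ∫⁻ x, ‖g x‖ₑ ^ 2 := by
  have hG : ContDiff ℝ ∞ (fun x => (g x : ℂ)) := Complex.ofRealCLM.contDiff.comp hg
  have hGc : HasCompactSupport (fun x => (g x : ℂ)) := hc.comp_left (g := fun a : ℝ => (a : ℂ)) rfl
  let S : SchwartzMap ℝ ℂ := hGc.toSchwartzMap hG
  have key (T : SchwartzMap ℝ ℂ) :
      ENNReal.ofReal (∫ x, ‖T x‖ ^ 2) = ∫⁻ x, ‖T x‖ₑ ^ 2 := by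
    rw [ofReal_integral_eq_lintegral_ofReal
      ((memLp_two_iff_integrable_sq_norm (T.memLp 2 volume).1).1 (T.memLp 2 volume))
      (Eventually.of_forall fun x => by positivity)]
    refine lintegral_congr fun x => ?_
    rw [ENNReal.ofReal_pow (norm_nonneg _), ofReal_norm]
  have h := congrArg ENNReal.ofReal (SchwartzMap.integral_norm_sq_fourier S)
  rw [key, key, SchwartzMap.fourier_coe] at h
  have e : (S : ℝ → ℂ) = fun x => (g x : ℂ) := rfl
  rw [e] at h
  rw [h]
  refine lintegral_congr fun x => ?_
  rw [← ofReal_norm, ← ofReal_norm, Complex.norm_real]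

/-- The Fourier transform of a test function is integrable. -/
theorem lintegral_fourier_lt_top {g : ℝ → ℝ} (hg : ContDiff ℝ ∞ g) (hc : HasCompactSupport g) :
    ∫⁻ ξ, ‖𝓕 (fun x => (g x : ℂ)) ξ‖ₑ < ⊤ := by
  have hG : ContDiff ℝ ∞ (fun x => (g x : ℂ)) := Complex.ofRealCLM.contDiff.comp hg
  have hGc : HasCompactSupport (fun x => (g x : ℂ)) := hc.comp_left (g := fun a : ℝ => (a : ℂ)) rfl
  let S : SchwartzMap ℝ ℂ := hGc.toSchwartzMap hG
  have h := (SchwartzMap.integrable (μ := volume) (𝓕 S)).2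
  rw [SchwartzMap.fourier_coe] at h
  exact h

/-- Cauchy–Schwarz with a weight. -/
theorem lintegral_mul_sq_le {α : Type*} [MeasurableSpace α] (μ : Measure α) {k a : α → ℝ≥0∞}
    (hk : Measurable k) (ha : Measurable a) :
    (∫⁻ s, k s * a s ∂μ) ^ 2 ≤ (∫⁻ s, k s ∂μ) * ∫⁻ s, k s * a s ^ 2 ∂μ := by
  -- Hölder with exponents 2, 2 applied to the splitting k a = k^{1/2} · (k^{1/2} a).
  have h := ENNReal.lintegral_mul_le_Lp_mul_Lq μ Real.HolderConjugate.two_two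
    (f := fun s => k s ^ (1 / 2 : ℝ)) (g := fun s => k s ^ (1 / 2 : ℝ) * a s)
    (hk.pow_const _).aemeasurable ((hk.pow_const _).mul ha).aemeasurable
  have h2 (c : ℝ≥0∞) : c ^ (1 / 2 : ℝ) * c ^ (1 / 2 : ℝ) = c := by
    rw [← ENNReal.rpow_add_of_nonneg _ _ (by norm_num) (by norm_num)]; norm_num
  have e1 (s : α) : ((fun s => k s ^ (1 / 2 : ℝ)) * fun s => k s ^ (1 / 2 : ℝ) * a s) s
      = k s * a s := by
    simp only [Pi.mul_apply]
    rw [← mul_assoc, h2]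
  have e2 (s : α) : (k s ^ (1 / 2 : ℝ)) ^ (2 : ℝ) = k s := by
    rw [← ENNReal.rpow_mul]; norm_num
  have e3 (s : α) : (k s ^ (1 / 2 : ℝ) * a s) ^ (2 : ℝ) = k s * a s ^ 2 := by
    rw [ENNReal.mul_rpow_of_nonneg _ _ (by norm_num), e2, ENNReal.rpow_two]
  simp_rw [e1, e2, e3] at h
  calc _ ≤ _ := pow_le_pow_left' h 2
    _ = _ := by
      rw [mul_pow, ← ENNReal.rpow_two, ← ENNReal.rpow_two, ← ENNReal.rpow_mul,
        ← ENNReal.rpow_mul]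
      norm_num

/-- Young's inequality `‖k * a‖₂ ≤ ‖k‖₁ ‖a‖₂` on the line. -/
theorem lintegral_conv_sq_le {k a : ℝ → ℝ≥0∞} (hk : Measurable k) (ha : Measurable a) :
    ∫⁻ y, (∫⁻ s, k s * a (y - s)) ^ 2 ≤ (∫⁻ s, k s) ^ 2 * ∫⁻ y, a y ^ 2 := by
  calc _ ≤ ∫⁻ y, (∫⁻ s, k s) * ∫⁻ s, k s * a (y - s) ^ 2 :=
        lintegral_mono fun y => lintegral_mul_sq_le volume hk
          (ha.comp (measurable_const.sub measurable_id))
    _ = (∫⁻ s, k s) * ∫⁻ y, ∫⁻ s, k s * a (y - s) ^ 2 := by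
        refine lintegral_const_mul _ (Measurable.lintegral_prod_right'
          (f := fun z : ℝ × ℝ => k z.2 * a (z.1 - z.2) ^ 2) ?_)
        fun_prop
    _ = (∫⁻ s, k s) * ∫⁻ s, ∫⁻ y, k s * a (y - s) ^ 2 := by
        rw [lintegral_lintegral_swap]
        exact (by fun_prop : Measurable fun z : ℝ × ℝ => k z.2 * a (z.1 - z.2) ^ 2).aemeasurable
    _ = _ := by
        have (s : ℝ) : ∫⁻ y, k s * a (y - s) ^ 2 = k s * ∫⁻ y, a y ^ 2 := by
          rw [lintegral_const_mul _ (by fun_prop),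
            lintegral_sub_right_eq_self (fun y => a y ^ 2) s]
        simp_rw [this]
        rw [lintegral_mul_const _ hk]
        ring

/-- The average, with weight `w`, of the integrals of `g` over the rays issuing from `(x, y)` in the
directions `-(t, 1)`. -/
def rayAverage (w : ℝ → ℝ) (g : ℝ × ℝ → ℝ) (x y : ℝ) : ℝ :=
  ∫ z : ℝ × ℝ, w z.2 * g (x - z.1 * z.2, y - z.1) ∂(volume.restrict (Ioi 0)).prod volume

/-- For fixed y, the parameters (x, s, t) are determined continuously by the slope t and the point
(x - st, y - s). Hence the support lies in a continuous image of the product of the two supports.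
This justifies exchanging the integrals below. -/
theorem hasCompactSupport_ray {w : ℝ → ℝ} {g : ℝ × ℝ → ℝ} (hw : HasCompactSupport w)
    (hg : HasCompactSupport g) (ξ y : ℝ) :
    HasCompactSupport (Function.uncurry fun (x : ℝ) (z : ℝ × ℝ) =>
      Real.fourierChar (-(x * ξ)) • ((w z.2 * g (x - z.1 * z.2, y - z.1) : ℝ) : ℂ)) := by
  have hK : IsCompact ((fun q : ℝ × (ℝ × ℝ) =>
      (q.2.1 + (y - q.2.2) * q.1, (y - q.2.2, q.1))) '' (tsupport w ×ˢ tsupport g)) :=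
    (hw.isCompact.prod hg.isCompact).image (by fun_prop)
  refine HasCompactSupport.intro hK ?_
  rintro ⟨x, s, t⟩ hx
  by_contra hne
  refine hx ⟨(t, (x - s * t, y - s)), ⟨subset_tsupport _ ?_, subset_tsupport _ ?_⟩, ?_⟩
  · intro h0
    exact hne (by simp [Function.uncurry, h0])
  · intro h0
    exact hne (by simp [Function.uncurry, h0])
  · ext <;> simp

/-- In the x variable each ray contributes a translation by st, which becomes the phase exp(-2πi t s
ξ). Integrating the phase against w(t) produces the Fourier transform of w at sξ, and only a
convolution in s remains. -/
theorem fourier_rayAverage {w : ℝ → ℝ} {g : ℝ × ℝ → ℝ} (hw : Continuous w)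
    (hwc : HasCompactSupport w) (hg : Continuous g) (hgc : HasCompactSupport g) (ξ y : ℝ) :
    𝓕 (fun x => (rayAverage w g x y : ℂ)) ξ =
      ∫ s in Ioi 0, 𝓕 (fun t => (w t : ℂ)) (s * ξ) * 𝓕 (fun x => (g (x, y - s) : ℂ)) ξ := by
  set H : ℝ → ℝ × ℝ → ℂ := fun x z =>
    Real.fourierChar (-(x * ξ)) • ((w z.2 * g (x - z.1 * z.2, y - z.1) : ℝ) : ℂ) with hH
  have hcont : Continuous (Function.uncurry H) := by
    simp only [hH, Function.uncurry_def, Circle.smul_def]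
    fun_prop
  have hcs : HasCompactSupport (Function.uncurry H) := hasCompactSupport_ray hwc hgc ξ y
  have hin (z : ℝ × ℝ) : ∫ x, H x z =
      Real.fourierChar (-(z.2 * (z.1 * ξ))) • (w z.2 : ℂ) *
        𝓕 (fun x => (g (x, y - z.1) : ℂ)) ξ := by
    rw [Real.fourier_real_eq, ← integral_const_mul]
    rw [← integral_sub_right_eq_self (fun x => Real.fourierChar (-(z.2 * (z.1 * ξ))) • (w z.2 : ℂ) *
      Real.fourierChar (-(x * ξ)) • (g (x, y - z.1) : ℂ)) (z.1 * z.2)]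
    refine integral_congr_ae (Eventually.of_forall fun x => ?_)
    have : Real.fourierChar (-(x * ξ)) =
        Real.fourierChar (-(z.2 * (z.1 * ξ))) * Real.fourierChar (-((x - z.1 * z.2) * ξ)) := by
      rw [← AddChar.map_add_eq_mul]; congr 1; ring
    simp only [hH, this, Circle.smul_def, smul_eq_mul]
    push_cast
    ring
  rw [Real.fourier_real_eq]
  have h1 (x : ℝ) : Real.fourierChar (-(x * ξ)) • (rayAverage w g x y : ℂ) =
      ∫ z, H x z ∂(volume.restrict (Ioi 0)).prod volume := by
    rw [rayAverage, ← integral_complex_ofReal]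
    simp only [Circle.smul_def, smul_eq_mul, hH]
    rw [integral_const_mul]
  simp_rw [h1]
  rw [integral_integral_swap_of_hasCompactSupport hcont hcs]
  have hInt : Integrable (Function.uncurry H)
      (volume.prod ((volume.restrict (Ioi (0 : ℝ))).prod (volume : Measure ℝ))) :=
    hcont.integrable_of_hasCompactSupport hcs
  have hInt2 := hInt.integral_prod_right
  simp only [Function.uncurry_apply_pair] at hInt2
  rw [integral_prod _ hInt2]
  refine integral_congr_ae (Eventually.of_forall fun s => ?_)
  simp only [hin]
  rw [integral_mul_const, Real.fourier_real_eq (fun t => (w t : ℂ))]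

theorem measurable_partialFourier {f : ℝ × ℝ → ℝ} (hf : Continuous f) :
    Measurable fun z : ℝ × ℝ => 𝓕 (fun x => (f (x, z.2) : ℂ)) z.1 := by
  have hc : Continuous fun q : (ℝ × ℝ) × ℝ =>
      Real.fourierChar (-(q.2 * q.1.1)) • (f (q.2, q.1.2) : ℂ) := by
    simp only [Circle.smul_def]
    fun_prop
  have := hc.stronglyMeasurable.integral_prod_right' (ν := (volume : Measure ℝ))
  simp_rw [Real.fourier_real_eq]
  exact this.measurable

/-- The substitution s ↦ sξ. The factor |ξ| produced by the x-derivative is exactly what makes the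
L¹ norm of the kernel independent of ξ; at ξ = 0 the left side is zero. -/
theorem lintegral_mul_comp_mul_le (k : ℝ → ℝ≥0∞) (hk : Measurable k) (ξ : ℝ) :
    ∫⁻ s, ENNReal.ofReal |ξ| * k (s * ξ) ≤ ∫⁻ s, k s := by
  rcases eq_or_ne ξ 0 with rfl | h
  · simp
  · rw [lintegral_const_mul _ (by fun_prop)]
    have h1 : ∫⁻ s, k (s * ξ) = ENNReal.ofReal |ξ⁻¹| * ∫⁻ s, k s := by
      rw [← lintegral_map (f := k) (g := fun s => s * ξ) hk (by fun_prop),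
        Real.map_volume_mul_right h, lintegral_smul_measure, smul_eq_mul]
    rw [h1, ← mul_assoc, ← ENNReal.ofReal_mul (abs_nonneg _), ← abs_mul, mul_inv_cancel₀ h]
    simp

/-- The `x`-derivative of the ray average is bounded on `L²`. -/
theorem lintegral_rayAverage_deriv_sq_le {w : ℝ → ℝ} {f g : ℝ × ℝ → ℝ} (hw : ContDiff ℝ ∞ w)
    (hwc : HasCompactSupport w) (hf : ContDiff ℝ ∞ f) (hfc : HasCompactSupport f)
    (hg : Continuous g) (hgc : HasCompactSupport g)
    (hfg : ∀ x y, HasDerivAt (fun x => f (x, y)) (g (x, y)) x)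
    (hA : ∀ y, ContDiff ℝ ∞ fun x => rayAverage w g x y)
    (hAc : ∀ y, HasCompactSupport fun x => rayAverage w g x y) :
    ∫⁻ y, ∫⁻ x, ‖rayAverage w g x y‖ₑ ^ 2 ≤
      (ENNReal.ofReal (2 * Real.pi) * ∫⁻ ξ, ‖𝓕 (fun t => (w t : ℂ)) ξ‖ₑ) ^ 2 *
        ∫⁻ y, ∫⁻ x, ‖f (x, y)‖ₑ ^ 2 := by
  have hfy (y : ℝ) : ContDiff ℝ ∞ fun x => f (x, y) :=
    hf.comp (contDiff_id.prodMk contDiff_const)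
  have hslice {h : ℝ × ℝ → ℝ} (hh : HasCompactSupport h) (y : ℝ) :
      HasCompactSupport fun x => h (x, y) := by
    refine HasCompactSupport.intro (hh.isCompact.image continuous_fst) fun x hx => ?_
    by_contra hne
    exact hx ⟨(x, y), subset_tsupport _ hne, rfl⟩
  have hder (ξ y : ℝ) : 𝓕 (fun x => (g (x, y) : ℂ)) ξ =
      (2 * Real.pi * Complex.I * ξ) * 𝓕 (fun x => (f (x, y) : ℂ)) ξ := by
    have hd (x : ℝ) : HasDerivAt (fun x => (f (x, y) : ℂ)) (g (x, y) : ℂ) x :=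
      (hfg x y).ofReal_comp
    have e : deriv (fun x => (f (x, y) : ℂ)) = fun x => (g (x, y) : ℂ) :=
      funext fun x => (hd x).deriv
    have i1 : Integrable fun x => (f (x, y) : ℂ) :=
      ((hfy y).continuous.integrable_of_hasCompactSupport (hslice hfc y)).ofReal
    have i2 : Integrable fun x => (g (x, y) : ℂ) :=
      ((hg.comp (by fun_prop : Continuous fun x : ℝ => (x, y))).integrable_of_hasCompactSupport
        (hslice hgc y)).ofReal
    have := Real.fourier_deriv i1 (fun x => (hd x).differentiableAt) (by rwa [e])
    rw [e] at this
    simp only [this, smul_eq_mul]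
  set W : ℝ → ℝ≥0∞ := fun τ => ‖𝓕 (fun t => (w t : ℂ)) τ‖ₑ with hW
  set Fh : ℝ → ℝ → ℝ≥0∞ := fun ξ y => ‖𝓕 (fun x => (f (x, y) : ℂ)) ξ‖ₑ with hFh
  have hWm : Measurable W := by
    have := (measurable_partialFourier (f := fun z => w z.1) (by fun_prop)).comp
      (by fun_prop : Measurable fun τ : ℝ => (τ, (0 : ℝ)))
    exact this.enorm
  have hFm : Measurable fun z : ℝ × ℝ => Fh z.1 z.2 :=
    (measurable_partialFourier hf.continuous).enorm
  set k : ℝ → ℝ → ℝ≥0∞ := fun ξ s =>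
    ENNReal.ofReal (2 * Real.pi) * (ENNReal.ofReal |ξ| * W (s * ξ)) with hk
  -- The derivative g of f turns into the factor 2πiξ, which is moved into the kernel k. Extending
  -- the s-integral from the half line to the line only increases it.
  have hbound (ξ y : ℝ) : ‖𝓕 (fun x => (rayAverage w g x y : ℂ)) ξ‖ₑ ≤
      ∫⁻ s, k ξ s * Fh ξ (y - s) := by
    rw [fourier_rayAverage hw.continuous hwc hg hgc]
    refine (enorm_integral_le_lintegral_enorm _).trans ((setLIntegral_le_lintegral _ _).trans ?_)
    refine lintegral_mono fun s => le_of_eq ?_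
    rw [hder, enorm_mul, enorm_mul]
    have : ‖(2 * Real.pi * Complex.I * ξ : ℂ)‖ₑ =
        ENNReal.ofReal (2 * Real.pi) * ENNReal.ofReal |ξ| := by
      rw [← ENNReal.ofReal_mul (by positivity), ← ofReal_norm]
      congr 1
      simp [abs_of_pos Real.pi_pos]
    rw [this]
    simp only [hk, hW, hFh]
    ring
  have hkint (ξ : ℝ) : ∫⁻ s, k ξ s ≤ ENNReal.ofReal (2 * Real.pi) * ∫⁻ s, W s := by
    simp only [hk]
    rw [lintegral_const_mul _ (by fun_prop)]
    exact mul_le_mul_right (lintegral_mul_comp_mul_le W hWm ξ) _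
  have hm : Measurable fun z : ℝ × ℝ => (∫⁻ s, k z.1 s * Fh z.1 (z.2 - s)) ^ 2 := by
    refine Measurable.pow_const (Measurable.lintegral_prod_right'
      (f := fun q : (ℝ × ℝ) × ℝ => k q.1.1 q.2 * Fh q.1.1 (q.1.2 - q.2)) ?_) 2
    have h1 : Measurable fun q : (ℝ × ℝ) × ℝ => Fh q.1.1 (q.1.2 - q.2) :=
      hFm.comp (by fun_prop : Measurable fun q : (ℝ × ℝ) × ℝ => (q.1.1, q.1.2 - q.2))
    simp only [hk]
    fun_prop
  -- Plancherel in x for each y, Young in y for each ξ with the uniform bound on the kernel, then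
  -- Plancherel back.
  calc _ = ∫⁻ y, ∫⁻ ξ, ‖𝓕 (fun x => (rayAverage w g x y : ℂ)) ξ‖ₑ ^ 2 :=
        lintegral_congr fun y => (lintegral_fourier_sq (hA y) (hAc y)).symm
    _ ≤ ∫⁻ y, ∫⁻ ξ, (∫⁻ s, k ξ s * Fh ξ (y - s)) ^ 2 :=
        lintegral_mono fun y => lintegral_mono fun ξ => pow_le_pow_left' (hbound ξ y) 2
    _ = ∫⁻ ξ, ∫⁻ y, (∫⁻ s, k ξ s * Fh ξ (y - s)) ^ 2 :=
        (lintegral_lintegral_swap hm.aemeasurable).symm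
    _ ≤ ∫⁻ ξ, (ENNReal.ofReal (2 * Real.pi) * ∫⁻ s, W s) ^ 2 * ∫⁻ y, Fh ξ y ^ 2 := by
        refine lintegral_mono fun ξ => (lintegral_conv_sq_le (by fun_prop)
          (hFm.comp (by fun_prop : Measurable fun y : ℝ => (ξ, y)))).trans ?_
        exact mul_le_mul_left (pow_le_pow_left' (hkint ξ) 2) _
    _ = (ENNReal.ofReal (2 * Real.pi) * ∫⁻ s, W s) ^ 2 * ∫⁻ ξ, ∫⁻ y, Fh ξ y ^ 2 :=
        lintegral_const_mul _ (Measurable.lintegral_prod_right'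
          (f := fun z : ℝ × ℝ => Fh z.1 z.2 ^ 2) (hFm.pow_const 2))
    _ = (ENNReal.ofReal (2 * Real.pi) * ∫⁻ s, W s) ^ 2 * ∫⁻ y, ∫⁻ ξ, Fh ξ y ^ 2 := by
        rw [lintegral_lintegral_swap (hFm.pow_const 2).aemeasurable]
    _ = _ := by
        congr 1
        exact lintegral_congr fun y => lintegral_fourier_sq (hfy y) (hslice hfc y)

end RayAverage

/-! ### Averages over rays in rotated coordinates -/

section RayOp

variable (L : Plane ≃ₗᵢ[ℝ] Plane)

/-- The axes of the rotated coordinate system. -/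
def axis (k : Fin 2) : Plane := L (EuclideanSpace.single k 1)

theorem inner_axis (k l : Fin 2) : inner ℝ (axis L k) (axis L l) = if k = l then 1 else 0 := by
  simp [axis, EuclideanSpace.inner_single_left, PiLp.single_apply]

@[simp] theorem norm_axis (k : Fin 2) : ‖axis L k‖ = 1 := by
  simp [axis]

/-- The direction with slope `t` to the second axis. -/
def rayDir (t : ℝ) : Plane := t • axis L 0 + axis L 1

/-- The parameter s is the second rotated coordinate of the point. Hence s is bounded as soon as the
point is, which is the source of the compactness and finiteness statements below. -/
theorem inner_smul_rayDir (s t : ℝ) : inner ℝ (axis L 1) (s • rayDir L t) = s := by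
  simp [rayDir, inner_smul_right, inner_add_right, inner_axis]

theorem continuous_rayDir : Continuous (rayDir L) := by
  unfold rayDir; fun_prop

/-- The measure `ds dt` on the parameters `(s, t)` of the points `s (t, 1)` with `s > 0`. -/
def rayParam : Measure (ℝ × ℝ) := (volume.restrict (Ioi 0)).prod volume

instance : IsFiniteMeasureOnCompacts rayParam := by unfold rayParam; infer_instance

/-- The average, with weight `w`, of the integrals of `F` over the rays issuing from `x` in the
directions `-(t, 1)` of the rotated coordinate system. -/
def rayOp (w : ℝ → ℝ) (F : Plane → ℝ) (x : Plane) : ℝ :=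
  ∫ z, w z.2 * F (x - z.1 • rayDir L z.2) ∂rayParam

variable {L} {w : ℝ → ℝ} {F : Plane → ℝ}

theorem exists_of_rayOp_ne_zero {x : Plane} (h : rayOp L w F x ≠ 0) :
    ∃ s t : ℝ, 0 < s ∧ w t ≠ 0 ∧ F (x - s • rayDir L t) ≠ 0 := by
  by_contra! hc
  refine h (integral_eq_zero_of_ae ?_)
  have : ∀ᵐ z ∂rayParam, z.1 ∈ Ioi (0 : ℝ) := by
    have h1 : rayParam = (volume.prod volume).restrict (Ioi (0 : ℝ) ×ˢ univ) := by
      rw [rayParam, ← Measure.prod_restrict, Measure.restrict_univ]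
    rw [h1]
    filter_upwards [ae_restrict_mem (measurableSet_Ioi.prod MeasurableSet.univ)] with z hz
    exact hz.1
  filter_upwards [this] with z hz
  by_cases hw : w z.2 = 0
  · simp [hw]
  · simp [hc z.1 z.2 hz hw]

theorem hasCompactSupport_ray_slice (hw : HasCompactSupport w) (hF : HasCompactSupport F)
    (x : Plane) : HasCompactSupport fun z : ℝ × ℝ => w z.2 * F (x - z.1 • rayDir L z.2) := by
  have hK : IsCompact ((fun q : ℝ × Plane => (inner ℝ (axis L 1) (x - q.2), q.1)) ''
      (tsupport w ×ˢ tsupport F)) :=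
    (hw.isCompact.prod hF.isCompact).image (by fun_prop)
  refine HasCompactSupport.intro hK ?_
  rintro ⟨s, t⟩ hx
  by_contra hne
  refine hx ⟨(t, x - s • rayDir L t), ⟨subset_tsupport _ (left_ne_zero_of_mul hne),
    subset_tsupport _ (right_ne_zero_of_mul hne)⟩, ?_⟩
  simp only [sub_sub_cancel, inner_smul_rayDir]

theorem integrable_ray_slice (hw : Continuous w) (hwc : HasCompactSupport w) (hF : Continuous F)
    (hFc : HasCompactSupport F) (x : Plane) :
    Integrable (fun z : ℝ × ℝ => w z.2 * F (x - z.1 • rayDir L z.2)) rayParam := by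
  refine Continuous.integrable_of_hasCompactSupport ?_ (hasCompactSupport_ray_slice hwc hFc x)
  have := continuous_rayDir L
  fun_prop

/-! ### The ray average as a convolution: smoothness and derivatives -/

variable (L w) in
/-- The measure on the plane by which `rayOp` is a convolution. -/
def rayMeasure : Measure Plane :=
  (rayParam.withDensity fun z => ENNReal.ofReal (w z.2)).map fun z => z.1 • rayDir L z.2

theorem measurable_rayPoint : Measurable fun z : ℝ × ℝ => z.1 • rayDir L z.2 := by
  have := (continuous_rayDir L).measurable
  fun_prop

/-- On a compact set s is bounded, so the measure of the set is at most the length of an interval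
times the integral of w. -/
theorem isLocallyFiniteMeasure_rayMeasure (hw : Continuous w) (hwc : HasCompactSupport w) :
    IsLocallyFiniteMeasure (rayMeasure L w) := by
  suffices IsFiniteMeasureOnCompacts (rayMeasure L w) from
    isLocallyFiniteMeasure_of_isFiniteMeasureOnCompacts
  refine ⟨fun K hK => ?_⟩
  obtain ⟨M, hM⟩ := (hK.image (f := fun z : Plane => inner ℝ (axis L 1) z)
    (by fun_prop)).isBounded.subset_closedBall 0
  have hpre : MeasurableSet ((fun z : ℝ × ℝ => z.1 • rayDir L z.2) ⁻¹' K) :=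
    measurable_rayPoint hK.measurableSet
  rw [rayMeasure, Measure.map_apply measurable_rayPoint hK.measurableSet,
    withDensity_apply _ hpre, ← lintegral_indicator hpre]
  calc _ ≤ ∫⁻ z : ℝ × ℝ, (Metric.closedBall (0 : ℝ) M).indicator 1 z.1 *
        ENNReal.ofReal (w z.2) ∂rayParam := by
        refine lintegral_mono fun z => ?_
        by_cases hz : z ∈ (fun z : ℝ × ℝ => z.1 • rayDir L z.2) ⁻¹' K
        swap
        · simp [indicator_of_notMem hz]
        have : z.1 ∈ Metric.closedBall (0 : ℝ) M := by
          have := hM (mem_image_of_mem _ (mem_preimage.1 hz))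
          simpa only [inner_smul_rayDir] using this
        simp [indicator_of_mem this, indicator_of_mem hz]
    _ = (∫⁻ s in Ioi 0, (Metric.closedBall (0 : ℝ) M).indicator 1 s) *
        ∫⁻ t, ENNReal.ofReal (w t) :=
        lintegral_prod_mul (f := (Metric.closedBall (0 : ℝ) M).indicator 1)
          (g := fun t => ENNReal.ofReal (w t)) (measurable_one.indicator measurableSet_closedBall).aemeasurable
          hw.measurable.ennreal_ofReal.aemeasurable
    _ < ⊤ := by
        refine ENNReal.mul_lt_top ?_ ?_
        · refine (setLIntegral_le_lintegral _ _).trans_lt ?_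
          rw [lintegral_indicator_one measurableSet_closedBall]
          exact measure_closedBall_lt_top
        · refine lt_of_le_of_lt (lintegral_mono fun t => ?_)
            (hw.integrable_of_hasCompactSupport hwc).2
          exact Real.ofReal_le_enorm _

/-- Convolving the constant 1 with F against a measure is averaging translates of F. Nonnegativity
of w is what lets w serve as a density of that measure; smoothness then follows from that of F. -/
theorem rayOp_eq_convolution (hw0 : ∀ t, 0 ≤ w t) (hw : Continuous w) (hF : Continuous F) :
    rayOp L w F =
      convolution (fun _ => (1 : ℝ)) F (ContinuousLinearMap.lsmul ℝ ℝ) (rayMeasure L w) := by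
  ext x
  rw [convolution_def, rayMeasure, integral_map measurable_rayPoint.aemeasurable
    (Continuous.aestronglyMeasurable (by
      simp only [ContinuousLinearMap.lsmul_apply, one_smul]; fun_prop)),
    integral_withDensity_eq_integral_toReal_smul (by fun_prop)
      (Eventually.of_forall fun _ => ENNReal.ofReal_lt_top)]
  refine integral_congr_ae (Eventually.of_forall fun z => ?_)
  simp [ENNReal.toReal_ofReal (hw0 _)]

theorem contDiff_rayOp (hw0 : ∀ t, 0 ≤ w t) (hw : Continuous w) (hwc : HasCompactSupport w)
    (hF : ContDiff ℝ ∞ F) (hFc : HasCompactSupport F) : ContDiff ℝ ∞ (rayOp L w F) := by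
  have := isLocallyFiniteMeasure_rayMeasure (L := L) hw hwc
  rw [rayOp_eq_convolution hw0 hw hF.continuous]
  exact hFc.contDiff_convolution_right (n := ⊤) _ (locallyIntegrable_const _) hF

theorem contDiff_fderiv_apply (hF : ContDiff ℝ ∞ F) (v : Plane) :
    ContDiff ℝ ∞ fun y => fderiv ℝ F y v :=
  (hF.fderiv_right (m := ∞) (by simp)).clm_apply contDiff_const

theorem hasCompactSupport_fderiv_apply (hFc : HasCompactSupport F) (v : Plane) :
    HasCompactSupport fun y => fderiv ℝ F y v :=
  hFc.fderiv_apply ℝ v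

theorem fderiv_rayOp_apply (hw0 : ∀ t, 0 ≤ w t) (hw : Continuous w) (hwc : HasCompactSupport w)
    (hF : ContDiff ℝ ∞ F) (hFc : HasCompactSupport F) (x v : Plane) :
    fderiv ℝ (rayOp L w F) x v = rayOp L w (fun y => fderiv ℝ F y v) x := by
  have := isLocallyFiniteMeasure_rayMeasure (L := L) hw hwc
  -- The differentiation rule for convolutions depending on a parameter is applied with a dummy real
  -- parameter, frozen at 0, on which F does not depend.
  have hG : ContDiff ℝ ∞ (fun q : ℝ × Plane => F q.2) := hF.comp contDiff_snd
  have hd (y : Plane) : fderiv ℝ (fun q : ℝ × Plane => F q.2) (0, y) =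
      (fderiv ℝ F y).comp (ContinuousLinearMap.snd ℝ ℝ Plane) :=
    (((hF.differentiable (by simp)) y).hasFDerivAt.comp ((0 : ℝ), y) hasFDerivAt_snd).fderiv
  have h1 := hasFDerivAt_convolution_right_with_param (μ := rayMeasure L w)
    (ContinuousLinearMap.lsmul ℝ ℝ) (f := fun _ : Plane => (1 : ℝ)) (g := fun _ : ℝ => F)
    (s := univ) isOpen_univ hFc.isCompact (fun _ y _ hy => image_eq_zero_of_notMem_tsupport hy)
    (locallyIntegrable_const _) ((hG.of_le (by simp)).contDiffOn) (0, x) (mem_univ _)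
  have h2 := h1.comp x ((hasFDerivAt_const (0 : ℝ) x).prodMk (hasFDerivAt_id x))
  have e : (fun q : ℝ × Plane => convolution (fun _ => (1 : ℝ)) F
      (ContinuousLinearMap.lsmul ℝ ℝ) (rayMeasure L w) q.2) ∘ Prod.mk 0 =
      rayOp L w F := by
    rw [rayOp_eq_convolution hw0 hw hF.continuous]; rfl
  rw [e] at h2
  rw [h2.fderiv, ContinuousLinearMap.comp_apply,
    rayOp_eq_convolution hw0 hw (contDiff_fderiv_apply hF v).continuous]
  rw [convolution_precompR_apply _ (locallyIntegrable_const _)]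
  · simp [Function.HasUncurry.uncurry, hd]
  · simp only [Function.HasUncurry.uncurry, id, hd]
    exact (hFc.fderiv ℝ).comp_left (g := fun A : Plane →L[ℝ] ℝ =>
      A.comp (ContinuousLinearMap.snd ℝ ℝ Plane)) (by simp)
  · simp only [Function.HasUncurry.uncurry, id, hd]
    exact (hF.continuous_fderiv (by simp)).clm_comp continuous_const

/-- Integrating the derivative along the rays recovers the function. -/
theorem rayOp_fderiv_add (hw : Continuous w) (hwc : HasCompactSupport w)
    (hF : ContDiff ℝ ∞ F) (hFc : HasCompactSupport F) (x : Plane) :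
    rayOp L (fun t => t * w t) (fun y => fderiv ℝ F y (axis L 0)) x +
      rayOp L w (fun y => fderiv ℝ F y (axis L 1)) x = (∫ t, w t) * F x := by
  have hwt : HasCompactSupport fun t => t * w t := hwc.mul_left
  have i1 := integrable_ray_slice (L := L) (by fun_prop : Continuous fun t => t * w t) hwt
    (contDiff_fderiv_apply hF (axis L 0)).continuous (hasCompactSupport_fderiv_apply hFc _) x
  have i2 := integrable_ray_slice (L := L) hw hwc
    (contDiff_fderiv_apply hF (axis L 1)).continuous (hasCompactSupport_fderiv_apply hFc _) x
  have i3 : Integrable (fun z : ℝ × ℝ =>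
      z.2 * w z.2 * fderiv ℝ F (x - z.1 • rayDir L z.2) (axis L 0) +
        w z.2 * fderiv ℝ F (x - z.1 • rayDir L z.2) (axis L 1)) rayParam := i1.add i2
  rw [rayOp, rayOp, ← integral_add i1 i2]
  unfold rayParam at i3 ⊢
  -- With t fixed and s integrated first, t ∂₀F + ∂₁F is the derivative of F in the direction of the
  -- ray. Its integral over the ray is the value at the starting point, because F has compact
  -- support.
  rw [integral_prod_symm _ i3, ← integral_mul_const]
  refine integral_congr_ae (Eventually.of_forall fun t => ?_)
  have hd (s : ℝ) : HasDerivAt (fun s : ℝ => F (x - s • rayDir L t))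
      (-(fderiv ℝ F (x - s • rayDir L t) (rayDir L t))) s := by
    have h1 : HasDerivAt (fun s : ℝ => x - s • rayDir L t) (-(rayDir L t)) s := by
      simpa using ((hasDerivAt_id s).smul_const (rayDir L t)).const_sub x
    have := ((hF.differentiable (by simp)) (x - s • rayDir L t)).hasFDerivAt.comp_hasDerivAt s h1
    rw [map_neg] at this
    exact this
  have hcs : HasCompactSupport fun s : ℝ => F (x - s • rayDir L t) := by
    refine HasCompactSupport.intro (hFc.isCompact.image
      (f := fun y => inner ℝ (axis L 1) (x - y)) (by fun_prop)) fun s hs => ?_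
    by_contra hne
    exact hs ⟨x - s • rayDir L t, subset_tsupport _ hne, by
      simp only [sub_sub_cancel, inner_smul_rayDir]⟩
  have hcd : ContDiff ℝ 1 fun s : ℝ => F (x - s • rayDir L t) :=
    (hF.of_le (by simp)).comp (by fun_prop)
  have h0 := hcs.integral_Ioi_deriv_eq hcd 0
  rw [show deriv (fun s : ℝ => F (x - s • rayDir L t)) =
    fun s => -(fderiv ℝ F (x - s • rayDir L t) (rayDir L t)) from funext fun s => (hd s).deriv,
    integral_neg, neg_inj, zero_smul, sub_zero] at h0
  simp only
  rw [← h0, ← integral_const_mul]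
  refine integral_congr_ae (Eventually.of_forall fun s => ?_)
  simp only [rayDir, map_add, map_smul, smul_eq_mul]
  ring

/-! ### Transfer to coordinates and the bound for one derivative -/

variable (L) in
/-- The rotated coordinates. -/
def chart (z : ℝ × ℝ) : Plane := z.1 • axis L 0 + z.2 • axis L 1

theorem chart_eq (z : ℝ × ℝ) : chart L z = L (WithLp.toLp 2 ![z.1, z.2]) := by
  rw [chart, axis, axis, ← map_smul, ← map_smul, ← map_add]
  congr 1
  ext i
  fin_cases i <;> simp

/-- The rotated coordinates are a linear isometry composed with the measure preserving
identification of ℝ × ℝ with the Euclidean plane. -/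
theorem lintegral_chart (f : Plane → ENNReal) : ∫⁻ z, f (chart L z) = ∫⁻ x, f x := by
  have h1 : MeasurePreserving (fun z : ℝ × ℝ => L (WithLp.toLp 2
      (MeasurableEquiv.finTwoArrow.symm z))) volume volume :=
    L.measurePreserving.comp ((PiLp.volume_preserving_toLp (Fin 2)).comp
      (volume_preserving_finTwoArrow ℝ).symm)
  have h2 : MeasurableEmbedding (fun z : ℝ × ℝ => L (WithLp.toLp 2
      (MeasurableEquiv.finTwoArrow.symm z))) :=
    L.toHomeomorph.measurableEmbedding.comp
      ((MeasurableEquiv.toLp 2 (Fin 2 → ℝ)).measurableEmbedding.comp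
        MeasurableEquiv.finTwoArrow.symm.measurableEmbedding)
  rw [← h1.lintegral_comp_emb h2]
  refine lintegral_congr fun z => ?_
  rw [chart_eq]
  rfl

theorem rayOp_chart (x y : ℝ) : rayOp L w F (chart L (x, y)) =
    rayAverage w (fun z => F (chart L z)) x y := by
  refine integral_congr_ae (Eventually.of_forall fun z => ?_)
  have : chart L (x, y) - z.1 • rayDir L z.2 = chart L (x - z.1 * z.2, y - z.1) := by
    simp only [chart, rayDir]; module
  simp only [this]

/-- The derivative of `rayOp` along the first axis is bounded on `L²`. -/
theorem exists_lintegral_rayOp_le (L : Plane ≃ₗᵢ[ℝ] Plane) (hw0 : ∀ t, 0 ≤ w t)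
    (hw : ContDiff ℝ ∞ w) (hwc : HasCompactSupport w) :
    ∃ C : ℝ≥0, ∀ F : Plane → ℝ, ContDiff ℝ ∞ F → HasCompactSupport F →
      eLpNorm (fun x => fderiv ℝ (rayOp L w F) x (axis L 0)) 2 volume ≤
        C * eLpNorm F 2 volume := by
  have hfin : ENNReal.ofReal (2 * Real.pi) *
      ∫⁻ ξ, ‖FourierTransform.fourier (fun t => (w t : ℂ)) ξ‖ₑ ≠ ⊤ :=
    (ENNReal.mul_lt_top ENNReal.ofReal_lt_top (lintegral_fourier_lt_top hw hwc)).ne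
  refine ⟨(ENNReal.ofReal (2 * Real.pi) *
      ∫⁻ ξ, ‖FourierTransform.fourier (fun t => (w t : ℂ)) ξ‖ₑ).toNNReal, fun F hF hFc => ?_⟩
  rw [ENNReal.coe_toNNReal hfin]
  set G : Plane → ℝ := fun y => fderiv ℝ F y (axis L 0) with hG
  have hGs : ContDiff ℝ ∞ G := contDiff_fderiv_apply hF _
  have hGc : HasCompactSupport G := hasCompactSupport_fderiv_apply hFc _
  have hcc : ContDiff ℝ ∞ (chart L) := by unfold chart; fun_prop
  have hch {H : Plane → ℝ} (hH : HasCompactSupport H) : HasCompactSupport fun z => H (chart L z) := by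
    refine HasCompactSupport.intro (hH.isCompact.image
      (f := fun y => (inner ℝ (axis L 0) y, inner ℝ (axis L 1) y)) (by fun_prop)) fun z hz => ?_
    by_contra hne
    refine hz ⟨chart L z, subset_tsupport _ hne, ?_⟩
    simp [chart, inner_add_right, inner_smul_right, inner_axis]
  have hA := contDiff_rayOp (L := L) hw0 hw.continuous hwc hGs hGc
  have key := lintegral_rayAverage_deriv_sq_le (w := w) (f := fun z => F (chart L z))
    (g := fun z => G (chart L z)) hw hwc (hF.comp hcc) (hch hFc)
    (hGs.continuous.comp hcc.continuous) (hch hGc)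
    (fun x y => by
      have h1 : HasDerivAt (fun x : ℝ => chart L (x, y)) (axis L 0) x := by
        simpa [chart] using ((hasDerivAt_id x).smul_const (axis L 0)).add_const (y • axis L 1)
      exact ((hF.differentiable (by simp)) _).hasFDerivAt.comp_hasDerivAt x h1)
    (fun y => by
      simp_rw [← rayOp_chart]
      exact hA.comp (hcc.comp (contDiff_id.prodMk contDiff_const)))
    (fun y => by
      simp_rw [← rayOp_chart]
      refine HasCompactSupport.intro (K := (fun q : ℝ × Plane => inner ℝ (axis L 0) q.2 +
        (y - inner ℝ (axis L 1) q.2) * q.1) '' (tsupport w ×ˢ tsupport G))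
        ((hwc.isCompact.prod hGc.isCompact).image (by fun_prop)) fun x hx => ?_
      by_contra hne
      obtain ⟨s, t, -, h1, h2⟩ := exists_of_rayOp_ne_zero hne
      refine hx ⟨(t, chart L (x, y) - s • rayDir L t),
        ⟨subset_tsupport _ h1, subset_tsupport _ h2⟩, ?_⟩
      simp [chart, rayDir, inner_sub_right, inner_add_right, inner_smul_right, inner_axis])
  -- The derivative passes under the average, so the quantity to bound is the ray average of the
  -- x-derivative G, to which the Fourier estimate applies.
  have e1 : ∀ x, fderiv ℝ (rayOp L w F) x (axis L 0) = rayOp L w G x := fun x =>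
    fderiv_rayOp_apply hw0 hw.continuous hwc hF hFc x _
  simp_rw [e1]
  have sq (H : Plane → ℝ) (hH : Continuous H) :
      eLpNorm H 2 volume ^ 2 = ∫⁻ y, ∫⁻ x, ‖H (chart L (x, y))‖ₑ ^ 2 := by
    have h1 := eLpNorm_nnreal_pow_eq_lintegral (f := H) (μ := volume) (p := 2) (by norm_num)
    have h2 : eLpNorm H 2 volume ^ 2 = ∫⁻ x, ‖H x‖ₑ ^ 2 := by
      simpa using h1
    rw [h2, ← lintegral_chart (L := L)]
    have hm : Measurable fun z => ‖H (chart L z)‖ₑ ^ 2 :=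
      ((hH.comp hcc.continuous).measurable.enorm).pow_const 2
    exact lintegral_prod_symm _ hm.aemeasurable
  refine (ENNReal.pow_le_pow_left_iff (n := 2) (by norm_num)).1 ?_
  rw [mul_pow, sq _ hA.continuous, sq _ hF.continuous]
  simp_rw [rayOp_chart]
  exact key

end RayOp

/-! ### A local right inverse of the divergence, up to smoothing -/

/-- `f` is a smooth function with compact support in `U`. -/
structure IsTest (U : Set Plane) (f : Plane → ℝ) : Prop where
  contDiff : ContDiff ℝ ∞ f
  hasCompactSupport : HasCompactSupport f
  tsupport_subset : tsupport f ⊆ U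

namespace IsTest

variable {U : Set Plane} {f g : Plane → ℝ}

theorem mono {V : Set Plane} (h : IsTest U f) (hUV : U ⊆ V) : IsTest V f :=
  ⟨h.1, h.2, h.3.trans hUV⟩

theorem add (hf : IsTest U f) (hg : IsTest U g) : IsTest U (fun x => f x + g x) :=
  ⟨hf.1.add hg.1, hf.2.add hg.2, (tsupport_add f g).trans (union_subset hf.3 hg.3)⟩

theorem const_mul (hf : IsTest U f) (c : ℝ) : IsTest U (fun x => c * f x) :=
  ⟨contDiff_const.mul hf.1, hf.2.mul_left, (tsupport_mul_subset_right (f := fun _ => c)).trans hf.3⟩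

theorem partialDeriv (hf : IsTest U f) (j : Fin 2) : IsTest U (partialDeriv j f) :=
  ⟨contDiff_fderiv_apply hf.1 _, hasCompactSupport_fderiv_apply hf.2 _,
    (tsupport_fderiv_apply_subset ℝ _).trans hf.3⟩

end IsTest

section Local

variable {L : Plane ≃ₗᵢ[ℝ] Plane} {w : ℝ → ℝ}

theorem contDiff_id_mul (hw : ContDiff ℝ ∞ w) : ContDiff ℝ ∞ fun t => t * w t :=
  contDiff_id.mul hw

/-- The ray average is bounded on `L²` of a ball. -/
theorem exists_eLpNorm_rayOp_le (L : Plane ≃ₗᵢ[ℝ] Plane) (hw0 : ∀ t, 0 ≤ w t) (hw : Continuous w)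
    (hwc : HasCompactSupport w) (x₀ : Plane) (r : ℝ) :
    ∃ C : ℝ≥0, ∀ F : Plane → ℝ, Continuous F → tsupport F ⊆ Metric.closedBall x₀ r →
      eLpNorm ((Metric.closedBall x₀ r).indicator (rayOp L w F)) 2 volume ≤
        C * eLpNorm F 2 volume := by
  -- If x and the support of F lie in the ball, s is at most the diameter 2r. Cutting the weight off
  -- there makes it integrable, and Young's inequality applies.
  set k : ℝ × ℝ → ENNReal := fun z => (Icc 0 (2 * r)).indicator 1 z.1 * ENNReal.ofReal (w z.2)
    with hk
  have hkm : Measurable k :=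
    ((measurable_one.indicator measurableSet_Icc).comp measurable_fst).mul
      (hw.measurable.ennreal_ofReal.comp measurable_snd)
  have hkint : ∫⁻ z, k z < ⊤ := by
    have : ∫⁻ z, k z = (∫⁻ s, (Icc 0 (2 * r)).indicator 1 s) * ∫⁻ t, ENNReal.ofReal (w t) :=
      lintegral_prod_mul (f := (Icc 0 (2 * r)).indicator 1) (g := fun t => ENNReal.ofReal (w t))
        (measurable_one.indicator measurableSet_Icc).aemeasurable
        hw.measurable.ennreal_ofReal.aemeasurable
    rw [this, lintegral_indicator_one measurableSet_Icc]
    refine ENNReal.mul_lt_top measure_Icc_lt_top ?_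
    refine lt_of_le_of_lt (lintegral_mono fun t => ?_)
      (hw.integrable_of_hasCompactSupport hwc).2
    exact Real.ofReal_le_enorm _
  refine ⟨(∫⁻ z, k z).toNNReal, fun F hF hFs => ?_⟩
  rw [ENNReal.coe_toNNReal hkint.ne]
  have hd := (continuous_rayDir L).measurable
  have hFm := hF.measurable
  have hpt (x : Plane) : ‖(Metric.closedBall x₀ r).indicator (rayOp L w F) x‖ₑ ≤
      ∫⁻ z, k z * ‖F (x - z.1 • rayDir L z.2)‖ₑ := by
    by_cases hx : x ∈ Metric.closedBall x₀ r
    swap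
    · simp [indicator_of_notMem hx]
    rw [indicator_of_mem hx, rayOp]
    refine (enorm_integral_le_lintegral_enorm _).trans ?_
    have e : rayParam = (volume : Measure (ℝ × ℝ)).restrict (Ioi (0 : ℝ) ×ˢ univ) := by
      rw [rayParam, Measure.volume_eq_prod, ← Measure.prod_restrict, Measure.restrict_univ]
    rw [e, ← lintegral_indicator (measurableSet_Ioi.prod MeasurableSet.univ)]
    refine lintegral_mono fun z => ?_
    by_cases hz : z ∈ Ioi (0 : ℝ) ×ˢ (univ : Set ℝ)
    swap
    · simp [indicator_of_notMem hz]
    rw [indicator_of_mem hz]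
    by_cases hFz : F (x - z.1 • rayDir L z.2) = 0
    · simp [hFz]
    · have h1 := hFs (subset_tsupport _ hFz)
      have h2 : z.1 ≤ 2 * r := by
        have h3 : dist x (x - z.1 • rayDir L z.2) ≤ 2 * r := by
          refine (dist_triangle_right _ _ x₀).trans ?_
          rw [Metric.mem_closedBall] at h1 hx
          linarith
        rw [dist_eq_norm, sub_sub_cancel] at h3
        calc z.1 = inner ℝ (axis L 1) (z.1 • rayDir L z.2) := (inner_smul_rayDir L _ _).symm
          _ ≤ ‖axis L 1‖ * ‖z.1 • rayDir L z.2‖ := real_inner_le_norm _ _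
          _ ≤ _ := by rwa [norm_axis, one_mul]
      have h4 : z.1 ∈ Icc 0 (2 * r) := ⟨le_of_lt hz.1, h2⟩
      rw [hk]
      simp only [indicator_of_mem h4, Pi.one_apply, one_mul, enorm_mul]
      rw [Real.enorm_of_nonneg (hw0 _)]
  have sq (H : Plane → ℝ) : eLpNorm H 2 volume ^ 2 = ∫⁻ x, ‖H x‖ₑ ^ 2 := by
    simpa using eLpNorm_nnreal_pow_eq_lintegral (f := H) (μ := volume) (p := 2) (by norm_num)
  refine (ENNReal.pow_le_pow_left_iff (n := 2) (by norm_num)).1 ?_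
  rw [mul_pow, sq, sq]
  have hm : Measurable fun q : Plane × (ℝ × ℝ) => k q.2 * ‖F (q.1 - q.2.1 • rayDir L q.2.2)‖ₑ ^ 2 := by
    fun_prop
  calc _ ≤ ∫⁻ x, (∫⁻ z, k z * ‖F (x - z.1 • rayDir L z.2)‖ₑ) ^ 2 :=
        lintegral_mono fun x => pow_le_pow_left' (hpt x) 2
    _ ≤ ∫⁻ x, (∫⁻ z, k z) * ∫⁻ z, k z * ‖F (x - z.1 • rayDir L z.2)‖ₑ ^ 2 :=
        lintegral_mono fun x => lintegral_mul_sq_le volume hkm (by fun_prop)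
    _ = (∫⁻ z, k z) * ∫⁻ x, ∫⁻ z, k z * ‖F (x - z.1 • rayDir L z.2)‖ₑ ^ 2 :=
        lintegral_const_mul _ hm.lintegral_prod_right'
    _ = (∫⁻ z, k z) * ∫⁻ z, ∫⁻ x, k z * ‖F (x - z.1 • rayDir L z.2)‖ₑ ^ 2 := by
        rw [lintegral_lintegral_swap hm.aemeasurable]
    _ = _ := by
        have (z : ℝ × ℝ) : ∫⁻ x, k z * ‖F (x - z.1 • rayDir L z.2)‖ₑ ^ 2 =
            k z * ∫⁻ x, ‖F x‖ₑ ^ 2 := by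
          rw [lintegral_const_mul _ (by fun_prop),
            lintegral_sub_right_eq_self (fun x => ‖F x‖ₑ ^ 2)]
        simp_rw [this]
        rw [lintegral_mul_const _ hkm]
        ring

theorem sum_inner_axis (v : Plane) :
    inner ℝ (axis L 0) v • axis L 0 + inner ℝ (axis L 1) v • axis L 1 = v := by
  refine L.symm.injective ?_
  have h (k : Fin 2) : inner ℝ (axis L k) v = (L.symm v) k := by
    have h1 := L.inner_map_map (EuclideanSpace.single k 1) (L.symm v)
    rw [L.apply_symm_apply] at h1
    rw [axis, h1]
    simp [EuclideanSpace.inner_single_left]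
  rw [h, h]
  ext i
  fin_cases i <;> simp [axis]

/-- All derivatives of the ray average are bounded on `L²`. -/
theorem exists_eLpNorm_fderiv_rayOp_le (L : Plane ≃ₗᵢ[ℝ] Plane) (hw0 : ∀ t, 0 ≤ w t)
    (hwt0 : ∀ t, 0 ≤ t * w t) (hw : ContDiff ℝ ∞ w) (hwc : HasCompactSupport w) (v : Plane) :
    ∃ C : ℝ≥0, ∀ F : Plane → ℝ, ContDiff ℝ ∞ F → HasCompactSupport F →
      eLpNorm (fun x => fderiv ℝ (rayOp L w F) x v) 2 volume ≤ C * eLpNorm F 2 volume := by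
  obtain ⟨C₀, hC₀⟩ := exists_lintegral_rayOp_le L hw0 hw hwc
  have hw1 := contDiff_id_mul hw
  have hwc1 : HasCompactSupport fun t => t * w t := hwc.mul_left
  obtain ⟨C₁, hC₁⟩ := exists_lintegral_rayOp_le L hwt0 hw1 hwc1
  set a : ℝ := inner ℝ (axis L 0) v
  set b : ℝ := inner ℝ (axis L 1) v
  refine ⟨‖a‖₊ * C₀ + ‖b‖₊ * (‖∫ t, w t‖₊ + C₁), fun F hF hFc => ?_⟩
  have c0 := contDiff_rayOp (L := L) hw0 hw.continuous hwc hF hFc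
  have c1 := contDiff_rayOp (L := L) hwt0 hw1.continuous hwc1 hF hFc
  -- The Fourier estimate treats only the first axis. The derivative along the second axis is (∫ w)
  -- F minus the first-axis derivative of the average with weight t w(t), by `rayOp_fderiv_add`.
  have e : (fun x => fderiv ℝ (rayOp L w F) x v) =
      a • (fun x => fderiv ℝ (rayOp L w F) x (axis L 0)) +
      b • ((∫ t, w t) • F - fun x => fderiv ℝ (rayOp L (fun t => t * w t) F) x (axis L 0)) := by
    ext x
    have h1 := rayOp_fderiv_add (L := L) hw.continuous hwc hF hFc x
    rw [← fderiv_rayOp_apply hw0 hw.continuous hwc hF hFc,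
      ← fderiv_rayOp_apply hwt0 hw1.continuous hwc1 hF hFc] at h1
    conv_lhs => rw [← sum_inner_axis (L := L) v]
    simp only [map_add, map_smul, Pi.add_apply, Pi.smul_apply, Pi.sub_apply, smul_eq_mul]
    rw [← h1]
    ring
  have m0 := (contDiff_fderiv_apply c0 (axis L 0)).continuous.aestronglyMeasurable (μ := volume)
  have m1 := (contDiff_fderiv_apply c1 (axis L 0)).continuous.aestronglyMeasurable (μ := volume)
  have mF := hF.continuous.aestronglyMeasurable (μ := volume)
  rw [e]
  refine (eLpNorm_add_le (m0.const_smul _) (((mF.const_smul _).sub m1).const_smul _)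
    (by norm_num)).trans ?_
  rw [eLpNorm_const_smul, eLpNorm_const_smul]
  push_cast
  rw [add_mul, mul_assoc, mul_assoc, add_mul]
  refine add_le_add (mul_le_mul_right (hC₀ F hF hFc) _) (mul_le_mul_right ?_ _)
  refine (eLpNorm_sub_le (mF.const_smul _) m1 (by norm_num)).trans ?_
  rw [eLpNorm_const_smul]
  exact add_le_add le_rfl (hC₁ F hF hFc)

/-- `Ω` is stable under small translations along a cone, inside the ball. -/
def HasCone (Ω : Set Plane) (x₀ : Plane) (r τ : ℝ) (L : Plane ≃ₗᵢ[ℝ] Plane) : Prop :=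
  ∀ y ∈ Ω ∩ Metric.closedBall x₀ r, ∀ s t : ℝ, 0 ≤ s → t ∈ Icc 0 τ →
    y + s • rayDir L t ∈ Metric.closedBall x₀ r → y + s • rayDir L t ∈ Ω

/-- Where the product is nonzero, x lies in the ball and x = y + s(t, 1) with y in the support of F,
s ≤ 2r and t ∈ [0, τ]. Such points form a compact set, and the cone property puts its part in the
ball inside Ω. -/
theorem isTest_mul_rayOp {Ω : Set Plane} {x₀ : Plane} {r τ : ℝ} (hcone : HasCone Ω x₀ r τ L)
    (hw0 : ∀ t, 0 ≤ w t) (hw : Continuous w) (hwc : HasCompactSupport w)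
    (hwτ : ∀ t, w t ≠ 0 → t ∈ Icc 0 τ) {χ F : Plane → ℝ}
    (hχ : IsTest (Metric.closedBall x₀ r) χ) (hF : IsTest (Ω ∩ Metric.closedBall x₀ r) F) :
    IsTest Ω fun x => χ x * rayOp L w F x := by
  refine ⟨hχ.1.mul (contDiff_rayOp hw0 hw hwc hF.1 hF.2), hχ.2.mul_right, ?_⟩
  have hS : IsCompact ((fun q : Plane × (ℝ × ℝ) => q.1 + q.2.1 • rayDir L q.2.2) ''
      (tsupport F ×ˢ (Icc 0 (2 * r) ×ˢ Icc 0 τ))) := by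
    refine (hF.2.isCompact.prod (isCompact_Icc.prod isCompact_Icc)).image ?_
    have := continuous_rayDir L
    fun_prop
  have hsub : tsupport (fun x => χ x * rayOp L w F x) ⊆
      (fun q : Plane × (ℝ × ℝ) => q.1 + q.2.1 • rayDir L q.2.2) ''
      (tsupport F ×ˢ (Icc 0 (2 * r) ×ˢ Icc 0 τ)) ∩ Metric.closedBall x₀ r := by
    refine closure_minimal ?_ (hS.isClosed.inter Metric.isClosed_closedBall)
    intro x hx
    have hxB : x ∈ Metric.closedBall x₀ r :=
      hχ.3 (subset_tsupport _ (left_ne_zero_of_mul hx))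
    obtain ⟨s, t, hs, ht, hy⟩ := exists_of_rayOp_ne_zero (right_ne_zero_of_mul hx)
    have hyF := subset_tsupport F hy
    have hyB := (hF.3 hyF).2
    refine ⟨⟨(x - s • rayDir L t, (s, t)), ⟨hyF, ⟨hs.le, ?_⟩, hwτ t ht⟩, by simp⟩, hxB⟩
    have h3 : dist x (x - s • rayDir L t) ≤ 2 * r := by
      refine (dist_triangle_right _ _ x₀).trans ?_
      rw [Metric.mem_closedBall] at hyB hxB
      linarith
    rw [dist_eq_norm, sub_sub_cancel] at h3
    calc s = inner ℝ (axis L 1) (s • rayDir L t) := (inner_smul_rayDir L _ _).symm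
      _ ≤ ‖axis L 1‖ * ‖s • rayDir L t‖ := real_inner_le_norm _ _
      _ ≤ _ := by rwa [norm_axis, one_mul]
  refine hsub.trans ?_
  rintro _ ⟨⟨⟨y, s, t⟩, ⟨hy, hs, ht⟩, rfl⟩, hB⟩
  exact hcone y (hF.3 hy) s t hs.1 ht hB

/-- Product rule. Where the cutoff is differentiated, the bound for the average itself is needed,
and it is available because the derivative of the cutoff vanishes off the ball. -/
theorem exists_eLpNorm_mul_rayOp_le (L : Plane ≃ₗᵢ[ℝ] Plane) (hw0 : ∀ t, 0 ≤ w t)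
    (hwt0 : ∀ t, 0 ≤ t * w t) (hw : ContDiff ℝ ∞ w) (hwc : HasCompactSupport w)
    {x₀ : Plane} {r : ℝ} {χ : Plane → ℝ} (hχ : IsTest (Metric.closedBall x₀ r) χ) (v : Plane) :
    ∃ C : ℝ≥0, ∀ F : Plane → ℝ, IsTest (Metric.closedBall x₀ r) F →
      eLpNorm (fun x => fderiv ℝ (fun x => χ x * rayOp L w F x) x v) 2 volume ≤
        C * eLpNorm F 2 volume := by
  obtain ⟨C₀, hC₀⟩ := exists_eLpNorm_rayOp_le L hw0 hw.continuous hwc x₀ r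
  obtain ⟨C₁, hC₁⟩ := exists_eLpNorm_fderiv_rayOp_le L hw0 hwt0 hw hwc v
  obtain ⟨M₀, hM₀⟩ := (hasCompactSupport_fderiv_apply hχ.2 v).exists_bound_of_continuous
    (contDiff_fderiv_apply hχ.1 v).continuous
  obtain ⟨M₁, hM₁⟩ := hχ.2.exists_bound_of_continuous hχ.1.continuous
  refine ⟨M₀.toNNReal * C₀ + M₁.toNNReal * C₁, fun F hF => ?_⟩
  have c0 := contDiff_rayOp (L := L) hw0 hw.continuous hwc hF.1 hF.2
  have e : (fun x => fderiv ℝ (fun x => χ x * rayOp L w F x) x v) =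
      (fun x => fderiv ℝ χ x v * (Metric.closedBall x₀ r).indicator (rayOp L w F) x) +
      fun x => χ x * fderiv ℝ (rayOp L w F) x v := by
    ext x
    rw [fderiv_fun_mul (hχ.1.differentiable (by simp) x) (c0.differentiable (by simp) x)]
    have : fderiv ℝ χ x v * (Metric.closedBall x₀ r).indicator (rayOp L w F) x =
        fderiv ℝ χ x v * rayOp L w F x := by
      by_cases hx : x ∈ Metric.closedBall x₀ r
      · rw [indicator_of_mem hx]
      · have : fderiv ℝ χ x v = 0 := by
          by_contra hne
          exact hx (hχ.3 (tsupport_fderiv_apply_subset ℝ v (subset_tsupport _ hne)))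
        simp [this]
    simp only [Pi.add_apply, this, add_apply, smul_apply, smul_eq_mul]
    ring
  rw [e]
  have m0 : AEStronglyMeasurable ((Metric.closedBall x₀ r).indicator (rayOp L w F)) volume :=
    c0.continuous.aestronglyMeasurable.indicator measurableSet_closedBall
  have m1 := (contDiff_fderiv_apply hχ.1 v).continuous.aestronglyMeasurable (μ := volume)
  have m2 := (contDiff_fderiv_apply c0 v).continuous.aestronglyMeasurable (μ := volume)
  refine (eLpNorm_add_le (m1.mul m0) (hχ.1.continuous.aestronglyMeasurable.mul m2)
    (by norm_num)).trans ?_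
  push_cast
  rw [add_mul, mul_assoc, mul_assoc]
  refine add_le_add ?_ ?_
  · refine le_trans ?_ (mul_le_mul_right (hC₀ F hF.1.continuous hF.3) _)
    refine eLpNorm_le_nnreal_smul_eLpNorm_of_ae_le_mul (c := M₀.toNNReal)
      (Eventually.of_forall fun x => ?_) 2
    rw [Pi.mul_apply, nnnorm_mul]
    refine mul_le_mul_left ?_ _
    exact NNReal.le_toNNReal_of_coe_le (hM₀ x)
  · refine le_trans ?_ (mul_le_mul_right (hC₁ F hF.1 hF.2) _)
    refine eLpNorm_le_nnreal_smul_eLpNorm_of_ae_le_mul (c := M₁.toNNReal)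
      (Eventually.of_forall fun x => ?_) 2
    rw [Pi.mul_apply, nnnorm_mul]
    refine mul_le_mul_left ?_ _
    exact NNReal.le_toNNReal_of_coe_le (hM₁ x)

/-- A weight for the ray average, of integral one and with support in `(0, τ)`. -/
theorem exists_weight {τ : ℝ} (hτ : 0 < τ) : ∃ w : ℝ → ℝ, (∀ t, 0 ≤ w t) ∧ ContDiff ℝ ∞ w ∧
    HasCompactSupport w ∧ (∀ t, w t ≠ 0 → t ∈ Icc 0 τ) ∧ ∫ t, w t = 1 := by
  let b : ContDiffBump (τ / 2) := ⟨τ / 8, τ / 4, by positivity, by linarith⟩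
  refine ⟨b.normed volume, fun t => b.nonneg_normed t, b.contDiff_normed,
    b.hasCompactSupport_normed, fun t ht => ?_, b.integral_normed⟩
  have h : t ∈ Metric.ball (τ / 2) (τ / 4) := by
    have : t ∈ Function.support (b.normed volume) := ht
    rwa [b.support_normed_eq] at this
  rw [Metric.mem_ball, Real.dist_eq, abs_lt] at h
  constructor <;> linarith

/-- A Lipschitz domain has the cone property near every point of its closure. -/
theorem exists_hasCone {Ω : Set Plane} (hΩ : IsBoundedLipschitzDomain Ω) {x₀ : Plane}
    (hx₀ : x₀ ∈ closure Ω) : ∃ r τ : ℝ, 0 < r ∧ 0 < τ ∧ ∃ L, HasCone Ω x₀ r τ L := by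
  by_cases hx : x₀ ∈ Ω
  · obtain ⟨r, hr, hrΩ⟩ := Metric.nhds_basis_closedBall.mem_iff.1 (hΩ.isOpen.mem_nhds hx)
    exact ⟨r, 1, hr, one_pos, LinearIsometryEquiv.refl ℝ Plane,
      fun y _ s t _ _ h => hrΩ h⟩
  · have hfr : x₀ ∈ frontier Ω := by rw [hΩ.isOpen.frontier_eq]; exact ⟨hx₀, hx⟩
    obtain ⟨e, γ, K, hγ, U, hU, hUΩ⟩ := hΩ.lipschitz_boundary x₀ hfr
    obtain ⟨r, hr, hrU⟩ := Metric.nhds_basis_closedBall.mem_iff.1 hU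
    -- Moving by s(t, 1) raises the point by s, while the graph rises by at most K s t ≤ s when t ≤
    -- 1/(K + 1).
    refine ⟨r, 1 / (K + 1), hr, by positivity, e.linearIsometryEquiv.symm, ?_⟩
    rintro y ⟨hyΩ, hyB⟩ s t hs ht hz
    rw [hUΩ _ (hrU hz)]
    have hy := (hUΩ y (hrU hyB)).1 hyΩ
    have he : e (y + s • rayDir e.linearIsometryEquiv.symm t) =
        e y + s • (t • EuclideanSpace.single 0 1 + EuclideanSpace.single 1 1) := by
      have h1 := e.map_vadd y (s • rayDir e.linearIsometryEquiv.symm t)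
      rw [vadd_eq_add, vadd_eq_add, add_comm, add_comm _ (e y)] at h1
      rw [h1]
      simp [rayDir, axis]
    have h0 : e (y + s • rayDir e.linearIsometryEquiv.symm t) 0 = e y 0 + s * t := by
      rw [he]; simp
    have h1 : e (y + s • rayDir e.linearIsometryEquiv.symm t) 1 = e y 1 + s := by
      rw [he]; simp
    rw [h0, h1]
    have hlip := hγ.dist_le_mul (e y 0 + s * t) (e y 0)
    rw [Real.dist_eq, Real.dist_eq, add_sub_cancel_left,
      abs_of_nonneg (mul_nonneg hs ht.1)] at hlip
    have hK : (K : ℝ) * (s * t) ≤ s := by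
      have h2 : (K : ℝ) * t ≤ 1 := by
        calc (K : ℝ) * t ≤ (K + 1) * t := by nlinarith [ht.1]
          _ ≤ (K + 1) * (1 / (K + 1)) := by gcongr; exact ht.2
          _ = 1 := by field_simp
      nlinarith
    linarith [le_abs_self (γ (e y 0 + s * t) - γ (e y 0))]

theorem sum_coord_smul_single (v : Plane) : ∑ i, v i • EuclideanSpace.single i (1 : ℝ) = v := by
  ext j
  fin_cases j <;> simp

theorem eLpNorm_coord_combination_le {d₀ d₁ : ℝ} (h₀ : |d₀| ≤ 1) (h₁ : |d₁| ≤ 1)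
    {f g : Plane → ℝ} (hf : Continuous f) (hg : Continuous g) :
    eLpNorm (fun x => d₀ * f x + d₁ * g x) 2 volume ≤
      eLpNorm f 2 volume + eLpNorm g 2 volume := by
  have hc {d : ℝ} (h : |d| ≤ 1) (k : Plane → ℝ) :
      eLpNorm (fun x => d * k x) 2 volume ≤ eLpNorm k 2 volume := by
    refine eLpNorm_mono fun x => ?_
    rw [norm_mul]
    exact mul_le_of_le_one_left (norm_nonneg _) h
  refine (eLpNorm_add_le (f := fun x => d₀ * f x) (g := fun x => d₁ * g x)
    (by fun_prop) (by fun_prop) (by norm_num)).trans ?_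
  exact add_le_add (hc h₀ f) (hc h₁ g)

/-- Near every point of the closure of a Lipschitz domain the divergence has a right inverse up to
an operator that gains a derivative. -/
theorem exists_local_solver {Ω : Set Plane} (hΩ : IsBoundedLipschitzDomain Ω) {x₀ : Plane}
    (hx₀ : x₀ ∈ closure Ω) : ∃ (r : ℝ) (C : ℝ≥0), 0 < r ∧
      ∀ F, IsTest (Ω ∩ Metric.ball x₀ r) F → ∃ (v : Fin 2 → Plane → ℝ) (R : Plane → ℝ),
        (∀ i, IsTest Ω (v i)) ∧ IsTest Ω R ∧
        (∀ x, ∑ i, partialDeriv i (v i) x = F x + R x) ∧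
        (∀ i j, eLpNorm (partialDeriv j (v i)) 2 volume ≤ C * eLpNorm F 2 volume) ∧
        ∀ j, eLpNorm (partialDeriv j R) 2 volume ≤ C * eLpNorm F 2 volume := by
  obtain ⟨r, τ, hr, hτ, L, hcone⟩ := exists_hasCone hΩ hx₀
  obtain ⟨w, hw0, hw, hwc, hwτ, hw1⟩ := exists_weight hτ
  have hpos (t : ℝ) : 0 ≤ t * w t := by
    by_cases h : w t = 0
    · simp [h]
    · exact mul_nonneg (hwτ t h).1 (hw0 t)
  have hpos' (t : ℝ) : 0 ≤ t * (t * w t) := by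
    rw [← mul_assoc]; exact mul_nonneg (mul_self_nonneg t) (hw0 t)
  have hwt := contDiff_id_mul hw
  have hwtc : HasCompactSupport fun t => t * w t := hwc.mul_left
  have hwtτ (t : ℝ) (h : t * w t ≠ 0) : t ∈ Icc 0 τ := hwτ t (right_ne_zero_of_mul h)
  let b : ContDiffBump x₀ := ⟨r / 2, r, by positivity, by linarith⟩
  have hφ : IsTest (Metric.closedBall x₀ r) b :=
    ⟨b.contDiff, b.hasCompactSupport, b.tsupport_eq.subset⟩
  have hφd (k : Fin 2) : IsTest (Metric.closedBall x₀ r) fun x => fderiv ℝ b x (axis L k) :=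
    ⟨contDiff_fderiv_apply hφ.1 _, hasCompactSupport_fderiv_apply hφ.2 _,
      (tsupport_fderiv_apply_subset ℝ _).trans hφ.3⟩
  choose C₁ hC₁ using fun j : Fin 2 => exists_eLpNorm_mul_rayOp_le L hpos hpos' hwt hwtc hφ
    (EuclideanSpace.single j 1)
  choose C₀ hC₀ using fun j : Fin 2 => exists_eLpNorm_mul_rayOp_le L hw0 hpos hw hwc hφ
    (EuclideanSpace.single j 1)
  choose D₁ hD₁ using fun j : Fin 2 => exists_eLpNorm_mul_rayOp_le L hpos hpos' hwt hwtc (hφd 0)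
    (EuclideanSpace.single j 1)
  choose D₀ hD₀ using fun j : Fin 2 => exists_eLpNorm_mul_rayOp_le L hw0 hpos hw hwc (hφd 1)
    (EuclideanSpace.single j 1)
  -- F is supported in the ball of radius r/2, where the cutoff b equals one, so that b F = F.
  refine ⟨r / 2, ∑ j, (C₁ j + C₀ j) + ∑ j, (D₁ j + D₀ j), by positivity, fun F hF => ?_⟩
  have hF' : IsTest (Ω ∩ Metric.closedBall x₀ r) F :=
    hF.mono (inter_subset_inter_right _ (Metric.ball_subset_closedBall.trans
      (Metric.closedBall_subset_closedBall (by linarith))))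
  have hFB : IsTest (Metric.closedBall x₀ r) F := hF'.mono inter_subset_right
  set g₁ : Plane → ℝ := fun x => b x * rayOp L (fun t => t * w t) F x with hg₁
  set g₀ : Plane → ℝ := fun x => b x * rayOp L w F x with hg₀
  set q₁ : Plane → ℝ := fun x => fderiv ℝ b x (axis L 0) * rayOp L (fun t => t * w t) F x with hq₁
  set q₀ : Plane → ℝ := fun x => fderiv ℝ b x (axis L 1) * rayOp L w F x with hq₀
  have tg₁ : IsTest Ω g₁ := isTest_mul_rayOp hcone hpos hwt.continuous hwtc hwtτ hφ hF'
  have tg₀ : IsTest Ω g₀ := isTest_mul_rayOp hcone hw0 hw.continuous hwc hwτ hφ hF'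
  have tq₁ : IsTest Ω q₁ := isTest_mul_rayOp hcone hpos hwt.continuous hwtc hwtτ (hφd 0) hF'
  have tq₀ : IsTest Ω q₀ := isTest_mul_rayOp hcone hw0 hw.continuous hwc hwτ (hφd 1) hF'
  have hlin {f g : Plane → ℝ} (hf : IsTest Ω f) (hg : IsTest Ω g) (c d : ℝ) (j : Fin 2)
      (x : Plane) : partialDeriv j (fun x => c * f x + d * g x) x =
        c * partialDeriv j f x + d * partialDeriv j g x := by
    have h1 := hf.1.differentiable (by simp) x
    have h2 := hg.1.differentiable (by simp) x
    rw [partialDeriv, fderiv_fun_add (h1.const_mul c) (h2.const_mul d),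
      fderiv_const_mul h1, fderiv_const_mul h2]
    rfl
  have habs (k i : Fin 2) : |axis L k i| ≤ 1 := by
    have := PiLp.norm_apply_le (axis L k) i
    rwa [norm_axis] at this
  have hle {A B : Fin 2 → ℝ≥0} (j : Fin 2) : A j + B j ≤ ∑ j, (A j + B j) :=
    Finset.single_le_sum (f := fun j => A j + B j) (fun _ _ => zero_le) (Finset.mem_univ j)
  -- The field has rotated components b times the averages with weights t w(t) and w(t). Its
  -- divergence is b F plus the terms where b is differentiated, and these form R. No derivative
  -- falls on the averages in R, so ∇R is bounded by F.
  refine ⟨fun i x => axis L 0 i * g₁ x + axis L 1 i * g₀ x, fun x => q₁ x + q₀ x,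
    fun i => (tg₁.const_mul _).add (tg₀.const_mul _), tq₁.add tq₀, fun x => ?_, fun i j => ?_,
    fun j => ?_⟩
  · have hdir (f : Plane → ℝ) (k : Fin 2) :
        ∑ i, axis L k i * partialDeriv i f x = fderiv ℝ f x (axis L k) := by
      conv_rhs => rw [← sum_coord_smul_single (axis L k), map_sum]
      simp only [map_smul, smul_eq_mul, partialDeriv]
    simp_rw [hlin tg₁ tg₀, Finset.sum_add_distrib, hdir]
    have c1 := contDiff_rayOp (L := L) hpos hwt.continuous hwtc hF.1 hF.2
    have c0 := contDiff_rayOp (L := L) hw0 hw.continuous hwc hF.1 hF.2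
    have hb : DifferentiableAt ℝ b x := hφ.1.differentiable (by simp) x
    rw [hg₁, hg₀, fderiv_fun_mul hb (c1.differentiable (by simp) x),
      fderiv_fun_mul hb (c0.differentiable (by simp) x)]
    simp only [add_apply, smul_apply, smul_eq_mul]
    rw [fderiv_rayOp_apply hpos hwt.continuous hwtc hF.1 hF.2,
      fderiv_rayOp_apply hw0 hw.continuous hwc hF.1 hF.2]
    have hid := rayOp_fderiv_add (L := L) hw.continuous hwc hF.1 hF.2 x
    rw [hw1, one_mul] at hid
    have hbF : b x * F x = F x := by
      by_cases hx : F x = 0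
      · simp [hx]
      · have : x ∈ Metric.closedBall x₀ b.rIn :=
          Metric.ball_subset_closedBall (hF.3 (subset_tsupport _ hx)).2
        rw [b.one_of_mem_closedBall this, one_mul]
    calc _ = b x * (rayOp L (fun t => t * w t) (fun y => fderiv ℝ F y (axis L 0)) x +
          rayOp L w (fun y => fderiv ℝ F y (axis L 1)) x) + (q₁ x + q₀ x) := by
          rw [hq₁, hq₀]; ring
      _ = _ := by rw [hid, hbF]
  · have e : partialDeriv j (fun x => axis L 0 i * g₁ x + axis L 1 i * g₀ x) =
        fun x => axis L 0 i * partialDeriv j g₁ x + axis L 1 i * partialDeriv j g₀ x :=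
      funext fun x => hlin tg₁ tg₀ _ _ j x
    rw [e]
    refine (eLpNorm_coord_combination_le (habs 0 i) (habs 1 i)
      (tg₁.partialDeriv j).1.continuous (tg₀.partialDeriv j).1.continuous).trans ?_
    refine (add_le_add (hC₁ j F hFB) (hC₀ j F hFB)).trans ?_
    rw [← add_mul]
    refine mul_le_mul_left ?_ _
    exact_mod_cast (hle j).trans le_self_add
  · have e : partialDeriv j (fun x => q₁ x + q₀ x) =
        fun x => 1 * partialDeriv j q₁ x + 1 * partialDeriv j q₀ x := by
      funext x
      rw [← hlin tq₁ tq₀]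
      simp
    rw [e]
    refine (eLpNorm_coord_combination_le (by simp) (by simp)
      (tq₁.partialDeriv j).1.continuous (tq₀.partialDeriv j).1.continuous).trans ?_
    refine (add_le_add (hD₁ j F hFB) (hD₀ j F hFB)).trans ?_
    rw [← add_mul]
    refine mul_le_mul_left ?_ _
    exact_mod_cast (hle j).trans le_add_self

end Local

/-! ### Approximation by averages over the cells of a grid -/

section Grid

open scoped ENNReal

/-- The cell of the grid of mesh size `h` on the line that contains `x`. -/
def gridCell (h x : ℝ) : Set ℝ := {s | ⌊s / h⌋ = ⌊x / h⌋}

theorem gridCell_eq_Ico {h : ℝ} (hh : 0 < h) (x : ℝ) :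
    gridCell h x = Ico (⌊x / h⌋ * h) ((⌊x / h⌋ + 1) * h) := by
  ext s
  rw [gridCell, mem_ofPred_eq, Int.floor_eq_iff, le_div_iff₀ hh, div_lt_iff₀ hh, mem_Ico]

theorem volume_gridCell {h : ℝ} (hh : 0 < h) (x : ℝ) :
    volume (gridCell h x) = ENNReal.ofReal h := by
  rw [gridCell_eq_Ico hh, Real.volume_Ico]
  congr 1
  ring

/-- Averaging over cells, integrated. -/
theorem lintegral_lintegral_cell {α ι : Type*} [MeasurableSpace α] [MeasurableSpace ι]
    [DiscreteMeasurableSpace ι] [Countable ι] (μ : Measure α) [SFinite μ] {k : α → ι}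
    (hk : Measurable k) {V : ℝ≥0∞} (hV : ∀ x, μ {s | k s = k x} = V) {φ : α → ℝ≥0∞}
    (hφ : Measurable φ) : ∫⁻ x, ∫⁻ s in {s | k s = k x}, φ s ∂μ ∂μ = V * ∫⁻ s, φ s ∂μ := by
  have hm : MeasurableSet {q : α × α | k q.2 = k q.1} :=
    measurableSet_eq_fun (hk.comp measurable_snd) (hk.comp measurable_fst)
  have hS (x : α) : MeasurableSet {s | k s = k x} := hk (measurableSet_singleton _)
  have h1 (x : α) : ∫⁻ s in {s | k s = k x}, φ s ∂μ =
      ∫⁻ s, {q : α × α | k q.2 = k q.1}.indicator (fun q => φ q.2) (x, s) ∂μ := by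
    rw [← lintegral_indicator (hS x)]
    rfl
  simp_rw [h1]
  rw [lintegral_lintegral_swap (f := fun x s =>
    {q : α × α | k q.2 = k q.1}.indicator (fun q => φ q.2) (x, s))
    ((hφ.comp measurable_snd).indicator hm).aemeasurable, ← lintegral_const_mul _ hφ]
  refine lintegral_congr fun s => ?_
  -- Lying in the same cell is a symmetric relation, so after Fubini the inner integral is φ(s)
  -- times the measure V of the cell of s.
  have h2 (x : α) : {q : α × α | k q.2 = k q.1}.indicator (fun q => φ q.2) (x, s) =
      {x | k x = k s}.indicator (fun _ => φ s) x := by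
    by_cases hx : k s = k x
    · rw [indicator_of_mem (show (x, s) ∈ {q : α × α | k q.2 = k q.1} from hx),
        indicator_of_mem (show x ∈ {x | k x = k s} from hx.symm)]
    · rw [indicator_of_notMem (show (x, s) ∉ {q : α × α | k q.2 = k q.1} from hx),
        indicator_of_notMem (show x ∉ {x | k x = k s} from fun h => hx h.symm)]
  simp_rw [h2]
  rw [lintegral_indicator_const (hS s), hV, mul_comm]

theorem setLIntegral_sq_le {α : Type*} [MeasurableSpace α] (μ : Measure α) (S : Set α)
    {φ : α → ℝ≥0∞} (hφ : Measurable φ) :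
    (∫⁻ s in S, φ s ∂μ) ^ 2 ≤ μ S * ∫⁻ s in S, φ s ^ 2 ∂μ := by
  have := lintegral_mul_sq_le (μ.restrict S) (k := fun _ => 1) measurable_const hφ
  simpa using this

theorem enorm_sub_le_of_gridCell {h : ℝ} (hh : 0 < h) {ρ ρ' : ℝ → ℝ}
    (hd : ∀ x, HasDerivAt ρ (ρ' x) x) (hc : Continuous ρ') {x x' y : ℝ} (hx : x ∈ gridCell h y)
    (hx' : x' ∈ gridCell h y) : ‖ρ x - ρ x'‖ₑ ≤ ∫⁻ s in gridCell h y, ‖ρ' s‖ₑ := by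
  have h1 : ∫ s in x'..x, ρ' s = ρ x - ρ x' :=
    intervalIntegral.integral_eq_sub_of_hasDerivAt (fun s _ => hd s) (hc.intervalIntegrable _ _)
  have hsub : uIoc x' x ⊆ gridCell h y := by
    rw [gridCell_eq_Ico hh] at hx hx' ⊢
    exact uIoc_subset_uIcc.trans (ordConnected_Ico.uIcc_subset hx' hx)
  rw [← h1, ← ofReal_norm, intervalIntegral.norm_intervalIntegral_eq, ofReal_norm]
  exact (enorm_integral_le_lintegral_enorm _).trans (lintegral_mono_set hsub)

/-- The cell of the grid of mesh size `h` in the plane that contains `z`. -/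
def gridIndex (h : ℝ) (z : ℝ × ℝ) : ℤ × ℤ := (⌊z.1 / h⌋, ⌊z.2 / h⌋)

theorem measurable_gridIndex (h : ℝ) : Measurable (gridIndex h) := by
  unfold gridIndex; fun_prop

theorem gridIndex_eq_prod (h : ℝ) (z : ℝ × ℝ) :
    {q | gridIndex h q = gridIndex h z} = gridCell h z.1 ×ˢ gridCell h z.2 := by
  ext q
  simp [gridIndex, gridCell, Prod.ext_iff]

theorem volume_gridIndex {h : ℝ} (hh : 0 < h) (z : ℝ × ℝ) :
    volume {q | gridIndex h q = gridIndex h z} = ENNReal.ofReal h ^ 2 := by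
  rw [gridIndex_eq_prod, Measure.volume_eq_prod, Measure.prod_prod, volume_gridCell hh,
    volume_gridCell hh, sq]

/-- The average of `f` over a cell of the grid. -/
def gridAverage (h : ℝ) (f : ℝ × ℝ → ℝ) (m : ℤ × ℤ) : ℝ :=
  (h ^ 2)⁻¹ * ∫ q in {q | gridIndex h q = m}, f q

/-- A point q of the cell is reached from z along a horizontal segment at the height of z, then a
vertical one at the abscissa of q. Averaging over q leaves the first bound as it is and turns the
second into h⁻¹ times an integral over the cell. -/
theorem enorm_sub_gridAverage_le {h : ℝ} (hh : 0 < h) {f g₁ g₂ : ℝ × ℝ → ℝ}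
    (hf : Continuous f) (hfc : HasCompactSupport f) (hg₁ : Continuous g₁) (hg₂ : Continuous g₂)
    (hd₁ : ∀ x y, HasDerivAt (fun x => f (x, y)) (g₁ (x, y)) x)
    (hd₂ : ∀ x y, HasDerivAt (fun y => f (x, y)) (g₂ (x, y)) y) (z : ℝ × ℝ) :
    ‖f z - gridAverage h f (gridIndex h z)‖ₑ ≤ (∫⁻ s in gridCell h z.1, ‖g₁ (s, z.2)‖ₑ) +
      (ENNReal.ofReal h)⁻¹ * ∫⁻ q in {q | gridIndex h q = gridIndex h z}, ‖g₂ q‖ₑ := by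
  set Q := {q | gridIndex h q = gridIndex h z} with hQ
  have hQm : MeasurableSet Q := measurable_gridIndex h (measurableSet_singleton _)
  set H := ENNReal.ofReal h with hH
  have hH0 : H ≠ 0 := by simpa [hH] using hh
  have hHt : H ≠ ⊤ := ENNReal.ofReal_ne_top
  have hvol : volume Q = H ^ 2 := volume_gridIndex hh z
  have : IsFiniteMeasure (volume.restrict Q) :=
    ⟨by rw [Measure.restrict_apply_univ, hvol]; exact (ENNReal.pow_ne_top hHt).lt_top⟩
  have hreal : volume.real Q = h ^ 2 := by
    rw [Measure.real, hvol, hH, ENNReal.toReal_pow, ENNReal.toReal_ofReal hh.le]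
  have hInt : IntegrableOn f Q := (hf.integrable_of_hasCompactSupport hfc).integrableOn
  have e : f z - gridAverage h f (gridIndex h z) = (h ^ 2)⁻¹ * ∫ q in Q, (f z - f q) := by
    rw [integral_sub (integrable_const _) hInt, integral_const, measureReal_restrict_apply_univ, hreal,
      gridAverage, smul_eq_mul, ← hQ]
    field_simp
  have hinv : ‖(h ^ 2)⁻¹‖ₑ = (H ^ 2)⁻¹ := by
    rw [Real.enorm_of_nonneg (by positivity), ENNReal.ofReal_inv_of_pos (by positivity),
      ENNReal.ofReal_pow hh.le]
  rw [e, enorm_mul, hinv]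
  have hpt : ∀ q ∈ Q, ‖f z - f q‖ₑ ≤ (∫⁻ s in gridCell h z.1, ‖g₁ (s, z.2)‖ₑ) +
      ∫⁻ s in gridCell h z.2, ‖g₂ (q.1, s)‖ₑ := by
    intro q hq
    rw [hQ, gridIndex_eq_prod] at hq
    have h1 := enorm_sub_le_of_gridCell hh (fun x => hd₁ x z.2) (by fun_prop)
      (show z.1 ∈ gridCell h z.1 from rfl) hq.1
    have h2 := enorm_sub_le_of_gridCell hh (fun y => hd₂ q.1 y) (by fun_prop)
      (show z.2 ∈ gridCell h z.2 from rfl) hq.2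
    calc ‖f z - f q‖ₑ = ‖(f (z.1, z.2) - f (q.1, z.2)) + (f (q.1, z.2) - f (q.1, q.2))‖ₑ := by
          simp
      _ ≤ _ := (enorm_add_le _ _).trans (add_le_add h1 h2)
  have hm2 : Measurable fun x : ℝ => ∫⁻ s in gridCell h z.2, ‖g₂ (x, s)‖ₑ :=
    Measurable.lintegral_prod_right' (f := fun q : ℝ × ℝ => ‖g₂ q‖ₑ) hg₂.measurable.enorm
  have hfub : ∫⁻ q in Q, ∫⁻ s in gridCell h z.2, ‖g₂ (q.1, s)‖ₑ = H * ∫⁻ q in Q, ‖g₂ q‖ₑ := by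
    rw [hQ, gridIndex_eq_prod, Measure.volume_eq_prod, ← Measure.prod_restrict,
      lintegral_prod (fun q : ℝ × ℝ => ∫⁻ s in gridCell h z.2, ‖g₂ (q.1, s)‖ₑ)
        (hm2.comp measurable_fst).aemeasurable,
      lintegral_prod _ hg₂.measurable.enorm.aemeasurable]
    simp only [lintegral_const, Measure.restrict_apply_univ, volume_gridCell hh]
    rw [lintegral_mul_const _ hm2, mul_comm]
  calc (H ^ 2)⁻¹ * ‖∫ q in Q, (f z - f q)‖ₑ
      ≤ (H ^ 2)⁻¹ * ∫⁻ q in Q, ((∫⁻ s in gridCell h z.1, ‖g₁ (s, z.2)‖ₑ) +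
          ∫⁻ s in gridCell h z.2, ‖g₂ (q.1, s)‖ₑ) :=
        mul_le_mul_right ((enorm_integral_le_lintegral_enorm _).trans
          (setLIntegral_mono' hQm hpt)) _
    _ = (H ^ 2)⁻¹ * ((∫⁻ s in gridCell h z.1, ‖g₁ (s, z.2)‖ₑ) * H ^ 2 +
          H * ∫⁻ q in Q, ‖g₂ q‖ₑ) := by
        rw [lintegral_add_left measurable_const, hfub, lintegral_const,
          Measure.restrict_apply_univ, hvol]
    _ = _ := by
        rw [mul_add, mul_comm _ (H ^ 2), ← mul_assoc, ← mul_assoc,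
          ENNReal.inv_mul_cancel (by positivity) (ENNReal.pow_ne_top hHt), one_mul]
        congr 2
        rw [sq, ENNReal.mul_inv (Or.inl hH0) (Or.inl hHt), mul_assoc,
          ENNReal.inv_mul_cancel hH0 hHt, mul_one]

/-- Poincaré's inequality on the cells of a grid. -/
theorem lintegral_sub_gridAverage_sq_le {h : ℝ} (hh : 0 < h) {f g₁ g₂ : ℝ × ℝ → ℝ}
    (hf : Continuous f) (hfc : HasCompactSupport f) (hg₁ : Continuous g₁) (hg₂ : Continuous g₂)
    (hd₁ : ∀ x y, HasDerivAt (fun x => f (x, y)) (g₁ (x, y)) x)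
    (hd₂ : ∀ x y, HasDerivAt (fun y => f (x, y)) (g₂ (x, y)) y) :
    ∫⁻ z, ‖f z - gridAverage h f (gridIndex h z)‖ₑ ^ 2 ≤
      4 * ENNReal.ofReal h ^ 2 * ((∫⁻ z, ‖g₁ z‖ₑ ^ 2) + ∫⁻ z, ‖g₂ z‖ₑ ^ 2) := by
  set H := ENNReal.ofReal h with hH
  have hH0 : H ≠ 0 := by simpa [hH] using hh
  have hHt : H ≠ ⊤ := ENNReal.ofReal_ne_top
  have hg₁m := hg₁.measurable
  have m1 := hg₁m.enorm
  have m2 := hg₂.measurable.enorm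
  have hpt (z : ℝ × ℝ) : ‖f z - gridAverage h f (gridIndex h z)‖ₑ ^ 2 ≤
      4 * (H * ∫⁻ s in gridCell h z.1, ‖g₁ (s, z.2)‖ₑ ^ 2) +
      4 * ∫⁻ q in {q | gridIndex h q = gridIndex h z}, ‖g₂ q‖ₑ ^ 2 := by
    set A := ∫⁻ s in gridCell h z.1, ‖g₁ (s, z.2)‖ₑ
    set B := H⁻¹ * ∫⁻ q in {q | gridIndex h q = gridIndex h z}, ‖g₂ q‖ₑ
    have hA : A ^ 2 ≤ H * ∫⁻ s in gridCell h z.1, ‖g₁ (s, z.2)‖ₑ ^ 2 := by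
      have := setLIntegral_sq_le volume (gridCell h z.1) (φ := fun s => ‖g₁ (s, z.2)‖ₑ) (by fun_prop)
      rwa [volume_gridCell hh] at this
    have hB : B ^ 2 ≤ ∫⁻ q in {q | gridIndex h q = gridIndex h z}, ‖g₂ q‖ₑ ^ 2 := by
      have := setLIntegral_sq_le volume {q | gridIndex h q = gridIndex h z} m2
      rw [volume_gridIndex hh] at this
      calc B ^ 2 ≤ (H⁻¹) ^ 2 * (H ^ 2 * _) := by
            rw [mul_pow]; exact mul_le_mul_right this _
        _ = _ := by
            rw [← mul_assoc, ← mul_pow, ENNReal.inv_mul_cancel hH0 hHt, one_pow, one_mul]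
    calc _ ≤ (A + B) ^ 2 := pow_le_pow_left'
            (enorm_sub_gridAverage_le hh hf hfc hg₁ hg₂ hd₁ hd₂ z) 2
      _ ≤ 4 * A ^ 2 + 4 * B ^ 2 := by
            rcases le_total A B with hAB | hAB
            · calc (A + B) ^ 2 ≤ (B + B) ^ 2 := by gcongr
                _ = 4 * B ^ 2 := by ring
                _ ≤ _ := le_add_self
            · calc (A + B) ^ 2 ≤ (A + A) ^ 2 := by gcongr
                _ = 4 * A ^ 2 := by ring
                _ ≤ _ := le_self_add
      _ ≤ _ := by gcongr
  -- Integrating the cell integrals over all z counts each point with the measure of its cell: h²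
  -- for the planar cells here, h for the horizontal slices in the next step. Both terms end up with
  -- the factor h².
  have e2 := lintegral_lintegral_cell (volume : Measure (ℝ × ℝ)) (measurable_gridIndex h)
    (volume_gridIndex hh) (m2.pow_const 2)
  have e1 : ∫⁻ z : ℝ × ℝ, ∫⁻ s in gridCell h z.1, ‖g₁ (s, z.2)‖ₑ ^ 2 =
      H * ∫⁻ z, ‖g₁ z‖ₑ ^ 2 := by
    have hS : MeasurableSet {q : (ℝ × ℝ) × ℝ | ⌊q.2 / h⌋ = ⌊q.1.1 / h⌋} :=
      measurableSet_eq_fun (by fun_prop) (by fun_prop)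
    have hm : Measurable fun z : ℝ × ℝ => ∫⁻ s in gridCell h z.1, ‖g₁ (s, z.2)‖ₑ ^ 2 := by
      have h1 : Measurable fun z : ℝ × ℝ => ∫⁻ s,
          {q : (ℝ × ℝ) × ℝ | ⌊q.2 / h⌋ = ⌊q.1.1 / h⌋}.indicator
            (fun q => ‖g₁ (q.2, q.1.2)‖ₑ ^ 2) (z, s) :=
        Measurable.lintegral_prod_right' (Measurable.indicator (by fun_prop) hS)
      convert h1 using 2 with z
      rw [← lintegral_indicator]
      · rfl
      · rw [gridCell_eq_Ico hh]; exact measurableSet_Ico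
    rw [Measure.volume_eq_prod, lintegral_prod_symm _ hm.aemeasurable,
      lintegral_prod_symm _ (m1.pow_const 2).aemeasurable, ← lintegral_const_mul]
    · refine lintegral_congr fun y => ?_
      exact lintegral_lintegral_cell (volume : Measure ℝ) (k := fun x => ⌊x / h⌋) (by fun_prop)
        (volume_gridCell hh) (φ := fun s => ‖g₁ (s, y)‖ₑ ^ 2) (by fun_prop)
    · exact Measurable.lintegral_prod_left' (f := fun z : ℝ × ℝ => ‖g₁ z‖ₑ ^ 2) (m1.pow_const 2)
  calc _ ≤ ∫⁻ z : ℝ × ℝ, (4 * (H * ∫⁻ s in gridCell h z.1, ‖g₁ (s, z.2)‖ₑ ^ 2) +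
        4 * ∫⁻ q in {q | gridIndex h q = gridIndex h z}, ‖g₂ q‖ₑ ^ 2) := lintegral_mono hpt
    _ ≤ 4 * (H * (H * ∫⁻ z, ‖g₁ z‖ₑ ^ 2)) + 4 * (H ^ 2 * ∫⁻ z, ‖g₂ z‖ₑ ^ 2) := by
        have hmq : Measurable fun z : ℝ × ℝ =>
            ∫⁻ q in {q | gridIndex h q = gridIndex h z}, ‖g₂ q‖ₑ ^ 2 := by
          exact (Measurable.of_discrete (f := fun m : ℤ × ℤ =>
            ∫⁻ q in {q | gridIndex h q = m}, ‖g₂ q‖ₑ ^ 2)).comp (measurable_gridIndex h)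
        rw [lintegral_add_right _ (hmq.const_mul 4), lintegral_const_mul _ hmq, e2]
        refine add_le_add ?_ le_rfl
        rw [lintegral_const_mul' _ _ (by norm_num), lintegral_const_mul' _ _ hHt, e1]
    _ = _ := by ring

end Grid

/-! ### Test functions in `L²` and `H¹₀` -/

section Test

variable {U Ω : Set Plane} {f : Plane → ℝ}

/-- The `L²` norm of a function on the plane. -/
def l2norm (f : Plane → ℝ) : ℝ := (eLpNorm f 2 volume).toReal

theorem l2norm_nonneg (f : Plane → ℝ) : 0 ≤ l2norm f := ENNReal.toReal_nonneg

theorem eLpNorm_two_sq {α : Type*} [MeasurableSpace α] {μ : Measure α} (f : α → ℝ) :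
    eLpNorm f 2 μ ^ 2 = ∫⁻ x, ‖f x‖ₑ ^ 2 ∂μ := by
  simpa using eLpNorm_nnreal_pow_eq_lintegral (f := f) (μ := μ) (p := 2) (by norm_num)

theorem IsTest.memLp (hf : IsTest U f) (μ : Measure Plane) [IsFiniteMeasureOnCompacts μ] :
    MemLp f 2 μ := hf.1.continuous.memLp_of_hasCompactSupport hf.2

theorem IsTest.eLpNorm_ne_top (hf : IsTest U f) : eLpNorm f 2 volume ≠ ⊤ :=
  (hf.memLp volume).2.ne

theorem IsTest.ofReal_l2norm (hf : IsTest U f) :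
    ENNReal.ofReal (l2norm f) = eLpNorm f 2 volume :=
  ENNReal.ofReal_toReal hf.eLpNorm_ne_top

theorem l2norm_le_of_eLpNorm_le {g : Plane → ℝ} {C : ℝ≥0} (hg : IsTest U g)
    (h : eLpNorm f 2 volume ≤ C * eLpNorm g 2 volume) : l2norm f ≤ C * l2norm g := by
  have := ENNReal.toReal_mono (ENNReal.mul_ne_top ENNReal.coe_ne_top hg.eLpNorm_ne_top) h
  rwa [ENNReal.toReal_mul] at this

variable (Ω) in
/-- A test function as an element of `L²(Ω)`. -/
def IsTest.toL2 (hf : IsTest U f) : L2 Ω := (hf.memLp (volume.restrict Ω)).toLp f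

theorem IsTest.coeFn_toL2 (hf : IsTest U f) : hf.toL2 Ω =ᵐ[volume.restrict Ω] f :=
  MemLp.coeFn_toLp _

theorem IsTest.norm_toL2_le (hf : IsTest U f) : ‖hf.toL2 Ω‖ ≤ l2norm f := by
  rw [IsTest.toL2, Lp.norm_toLp]
  exact ENNReal.toReal_mono hf.eLpNorm_ne_top (eLpNorm_mono_measure _ Measure.restrict_le_self)

theorem IsTest.l2norm_eq (hf : IsTest Ω f) : l2norm f = ‖hf.toL2 Ω‖ := by
  rw [IsTest.toL2, Lp.norm_toLp, eLpNorm_restrict_eq_of_support_subset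
    ((subset_tsupport f).trans hf.3), l2norm]

theorem IsTest.inner_toL2 (hf : IsTest U f) (p : L2 Ω) :
    inner ℝ (hf.toL2 Ω) p = ∫ x in Ω, p x * f x := by
  rw [inner_eq_integral]
  refine integral_congr_ae ?_
  filter_upwards [hf.coeFn_toL2 (Ω := Ω)] with x hx
  rw [hx, mul_comm]

theorem IsTest.toL2_mem_testJets (hf : IsTest Ω f) :
    (hf.toL2 Ω, fun j => (hf.partialDeriv j).toL2 Ω) ∈ testJets Ω :=
  ⟨f, hf.1, hf.2, hf.3, hf.coeFn_toL2, fun j => (hf.partialDeriv j).coeFn_toL2⟩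

/-- A velocity field with smooth components of compact support. -/
def testVelocity {v : Fin 2 → Plane → ℝ} (hv : ∀ i, IsTest Ω (v i)) : Velocity Ω :=
  fun i => ⟨((hv i).toL2 Ω, fun j => ((hv i).partialDeriv j).toL2 Ω),
    (testJets Ω).le_topologicalClosure (hv i).toL2_mem_testJets⟩

theorem bForm_testVelocity {v : Fin 2 → Plane → ℝ} (hv : ∀ i, IsTest Ω (v i)) (p : L2 Ω) :
    bForm (testVelocity hv) p = ∫ x in Ω, p x * ∑ i, partialDeriv i (v i) x := by
  have h1 : bForm (testVelocity hv) p =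
      ∑ i, inner ℝ (((hv i).partialDeriv i).toL2 Ω) p := bForm_eq _ _
  rw [h1]
  simp_rw [IsTest.inner_toL2, Finset.mul_sum]
  rw [integral_finsetSum]
  exact fun i _ => (Lp.memLp p).integrable_mul (((hv i).partialDeriv i).memLp _)

/-- Test functions are dense in `L²(U)`, in dual form. -/
theorem norm_le_of_integral_test_le (hU : IsOpen U) (p : L2 U) {A : ℝ} (hA : 0 ≤ A)
    (h : ∀ f, IsTest U f → ∫ x in U, p x * f x ≤ A * l2norm f) : ‖p‖ ≤ A := by
  let S : Submodule ℝ (L2 U) :=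
    { carrier := {q | ∃ f, IsTest U f ∧ q =ᵐ[volume.restrict U] f}
      zero_mem' := ⟨fun _ => 0, ⟨contDiff_const, HasCompactSupport.zero, by simp [tsupport]⟩,
        Lp.coeFn_zero _ _ _⟩
      add_mem' := by
        rintro a b ⟨f, hf, haf⟩ ⟨g, hg, hbg⟩
        exact ⟨_, hf.add hg, (Lp.coeFn_add a b).trans (haf.add hbg)⟩
      smul_mem' := by
        rintro c a ⟨f, hf, haf⟩
        exact ⟨_, hf.const_mul c, (Lp.coeFn_smul c a).trans (haf.const_smul c)⟩ }
  have hdense : S.topologicalClosure = ⊤ := by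
    rw [Submodule.topologicalClosure_eq_top_iff, Submodule.eq_bot_iff]
    intro q hq
    -- The fundamental lemma of the calculus of variations: an L² function orthogonal to all test
    -- functions vanishes, so the test functions are dense.
    have h0 : ∀ᵐ x ∂volume, x ∈ U → q x = 0 := by
      refine hU.ae_eq_zero_of_integral_contDiff_smul_eq_zero ?_ fun g hg hgc hgs => ?_
      · exact locallyIntegrableOn_of_locallyIntegrable_restrict
          ((Lp.memLp q).locallyIntegrable (by norm_num))
      · have hgt : IsTest U g := ⟨hg, hgc, hgs⟩
        have h1 := hq _ (show hgt.toL2 U ∈ S from ⟨g, hgt, hgt.coeFn_toL2⟩)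
        rw [hgt.inner_toL2] at h1
        rw [← h1, ← integral_indicator hU.measurableSet]
        refine integral_congr_ae (Eventually.of_forall fun x => ?_)
        by_cases hx : x ∈ U
        · simp [indicator_of_mem hx, mul_comm]
        · have : g x = 0 := by
            by_contra hne
            exact hx (hgs (subset_tsupport _ hne))
          simp [this, indicator_of_notMem hx]
    refine (Lp.eq_zero_iff_ae_eq_zero).2 ?_
    exact (ae_restrict_iff' hU.measurableSet).2 h0
  have hall (q : L2 U) : inner ℝ q p ≤ A * ‖q‖ := by
    have hq : q ∈ S.topologicalClosure := by rw [hdense]; trivial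
    have hcl : IsClosed {q : L2 U | inner ℝ q p ≤ A * ‖q‖} :=
      isClosed_le (by fun_prop) (by fun_prop)
    refine closure_minimal (s := (S : Set (L2 U))) ?_ hcl hq
    rintro a ⟨f, hf, haf⟩
    have e : a = hf.toL2 U := Lp.ext (haf.trans hf.coeFn_toL2.symm)
    rw [mem_ofPred_eq, e, hf.inner_toL2, ← hf.l2norm_eq]
    exact h f hf
  have h1 := hall p
  rw [real_inner_self_eq_norm_sq] at h1
  rcases eq_or_lt_of_le (norm_nonneg p) with h0 | h0
  · rw [← h0]; exact hA
  · nlinarith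

end Test

/-! ### Poincaré's inequality -/

theorem norm_clm_le (A : Plane →L[ℝ] ℝ) :
    ‖A‖ ≤ ∑ j : Fin 2, ‖A (EuclideanSpace.single j 1)‖ := by
  refine A.opNorm_le_bound (by positivity) fun v => ?_
  conv_lhs => rw [← sum_coord_smul_single v, map_sum]
  refine (norm_sum_le _ _).trans ?_
  rw [Finset.sum_mul]
  refine Finset.sum_le_sum fun j _ => ?_
  rw [map_smul, norm_smul, mul_comm]
  exact mul_le_mul_of_nonneg_left (PiLp.norm_apply_le v j) (norm_nonneg _)

/-- The Gagliardo–Nirenberg–Sobolev inequality in dimension two bounds the L² norm by the L¹ norm of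
the gradient; Hölder on the bounded set Ω gives the L² norm at the price of |Ω|^{1/2}. -/
theorem exists_poincare_test {Ω : Set Plane} (hΩ : Bornology.IsBounded Ω) :
    ∃ C : ℝ≥0, ∀ f, IsTest Ω f → l2norm f ≤ C * ∑ j, l2norm (partialDeriv j f) := by
  have hfr : Module.finrank ℝ Plane = 2 := by simp
  set K := eLpNormLESNormFDerivOneConst (volume : Measure Plane) 2
  have hV : volume Ω ^ (1 / 2 : ℝ) ≠ ⊤ :=
    ENNReal.rpow_ne_top_of_nonneg (by norm_num) hΩ.measure_lt_top.ne
  refine ⟨K * (volume Ω ^ (1 / 2 : ℝ)).toNNReal, fun f hf => ?_⟩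
  have h1 : eLpNorm f 2 volume ≤ K * eLpNorm (fderiv ℝ f) 1 volume := by
    have := eLpNorm_le_eLpNorm_fderiv_one (volume : Measure Plane) (hf.1.of_le (by simp)) hf.2
      (p := 2) (by rw [hfr]; exact_mod_cast NNReal.HolderConjugate.two_two)
    simpa using this
  have h2 : eLpNorm (fderiv ℝ f) 1 volume ≤
      eLpNorm (fun x => ∑ j, ‖partialDeriv j f x‖) 2 volume * volume Ω ^ (1 / 2 : ℝ) := by
    have hs : Function.support (fun x => ‖fderiv ℝ f x‖) ⊆ Ω := fun x hx =>
      hf.3 (support_fderiv_subset ℝ (norm_ne_zero_iff.1 hx))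
    rw [← eLpNorm_norm, ← eLpNorm_restrict_eq_of_support_subset (p := 1) hs]
    have h3 := eLpNorm_le_eLpNorm_mul_rpow_measure_univ (p := 1) (q := 2) (μ := volume.restrict Ω)
      (by norm_num) ((hf.1.continuous_fderiv (by simp)).norm.aestronglyMeasurable)
    refine h3.trans ?_
    rw [Measure.restrict_apply_univ]
    have e : 1 / (1 : ENNReal).toReal - 1 / (2 : ENNReal).toReal = (1 / 2 : ℝ) := by norm_num
    rw [e]
    refine mul_le_mul_left ?_ _
    refine (eLpNorm_mono_real fun x => ?_).trans (eLpNorm_mono_measure _ Measure.restrict_le_self)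
    rw [norm_norm]
    exact norm_clm_le _
  have h4 : eLpNorm (fun x => ∑ j, ‖partialDeriv j f x‖) 2 volume ≤
      ∑ j, eLpNorm (partialDeriv j f) 2 volume := by
    have := eLpNorm_sum_le (s := Finset.univ) (f := fun j x => ‖partialDeriv j f x‖) (p := 2)
      (μ := (volume : Measure Plane))
      (fun j _ => (hf.partialDeriv j).1.continuous.norm.aestronglyMeasurable) (by norm_num)
    refine (le_of_eq ?_).trans (this.trans (Finset.sum_le_sum fun j _ => (eLpNorm_norm _).le))
    congr 1
  have h5 : eLpNorm f 2 volume ≤ K * (volume Ω ^ (1 / 2 : ℝ)).toNNReal *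
      ∑ j, eLpNorm (partialDeriv j f) 2 volume := by
    rw [ENNReal.coe_toNNReal hV, mul_assoc]
    refine h1.trans (mul_le_mul_right (h2.trans ?_) _)
    rw [mul_comm]
    exact mul_le_mul_right h4 _
  have hsum : ∑ j, eLpNorm (partialDeriv j f) 2 volume ≠ ⊤ :=
    (ENNReal.sum_lt_top.2 fun j _ => (hf.partialDeriv j).eLpNorm_ne_top.lt_top).ne
  have h6 := ENNReal.toReal_mono (ENNReal.mul_ne_top
    (ENNReal.mul_ne_top ENNReal.coe_ne_top ENNReal.coe_ne_top) hsum) h5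
  rw [ENNReal.toReal_mul, ENNReal.toReal_sum fun j _ => (hf.partialDeriv j).eLpNorm_ne_top] at h6
  simpa [l2norm] using h6

theorem exists_poincareBound {Ω : Set Plane} (hΩ : Bornology.IsBounded Ω) :
    ∃ P : ℝ, 0 < P ∧ PoincareBound Ω P := by
  obtain ⟨C, hC⟩ := exists_poincare_test hΩ
  have hH (J : L2 Ω × (Fin 2 → L2 Ω)) (hJ : J ∈ H10 Ω) : ‖J.1‖ ≤ C * ∑ j, ‖J.2 j‖ := by
    have hcl : IsClosed {J : L2 Ω × (Fin 2 → L2 Ω) | ‖J.1‖ ≤ C * ∑ j, ‖J.2 j‖} :=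
      isClosed_le (by fun_prop) (by fun_prop)
    refine closure_minimal (s := (testJets Ω : Set (L2 Ω × (Fin 2 → L2 Ω)))) ?_ hcl hJ
    rintro ⟨a, b⟩ ⟨φ, hφ, hφc, hφs, h1, h2⟩
    have ht : IsTest Ω φ := ⟨hφ, hφc, hφs⟩
    have ea : a = ht.toL2 Ω := Lp.ext (h1.trans ht.coeFn_toL2.symm)
    have eb (j : Fin 2) : b j = (ht.partialDeriv j).toL2 Ω :=
      Lp.ext ((h2 j).trans (ht.partialDeriv j).coeFn_toL2.symm)
    simp only [mem_ofPred_eq, ea, eb, ← IsTest.l2norm_eq]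
    exact hC φ ht
  -- The inequality passes from test functions to their closure. The 2 comes from squaring a sum of
  -- two partial derivatives, the 1 from the term a(v,v) inside ‖v‖₁².
  refine ⟨2 * (C : ℝ) ^ 2 + 1, by positivity, fun v => ?_⟩
  rw [norm1_sq, add_mul, one_mul]
  refine add_le_add ?_ le_rfl
  rw [rForm_self_eq, aForm_self_eq, Finset.mul_sum]
  refine Finset.sum_le_sum fun i _ => ?_
  have h1 : ‖v.comp i‖ ≤ C * ∑ j, ‖v.grad i j‖ := hH _ (v i).2
  calc ‖v.comp i‖ ^ 2 ≤ (C * ∑ j, ‖v.grad i j‖) ^ 2 := by gcongr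
    _ = (C : ℝ) ^ 2 * (∑ j, ‖v.grad i j‖) ^ 2 := by ring
    _ ≤ (C : ℝ) ^ 2 * (2 * ∑ j, ‖v.grad i j‖ ^ 2) := by
        gcongr
        have := sq_sum_le_card_mul_sum_sq (s := Finset.univ) (f := fun j => ‖v.grad i j‖)
        simpa using this
    _ = _ := by ring

/-! ### Compactness of the embedding of `H¹₀(Ω)` into `L²(Ω)`, in dual form -/

/-- The cell of the grid of mesh size `h` that contains a point of the Euclidean plane. -/
def planeIndex (h : ℝ) (x : Plane) : ℤ × ℤ := gridIndex h (x 0, x 1)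

theorem measurable_planeIndex (h : ℝ) : Measurable (planeIndex h) :=
  (measurable_gridIndex h).comp (by fun_prop)

theorem measurableSet_planeIndex (h : ℝ) (m : ℤ × ℤ) : MeasurableSet {x | planeIndex h x = m} :=
  measurable_planeIndex h (measurableSet_singleton m)

theorem abs_integral_mul_le {Ω : Set Plane} (p : L2 Ω) {g : Plane → ℝ}
    (hg : MemLp g 2 (volume.restrict Ω)) :
    |∫ x in Ω, p x * g x| ≤ ‖p‖ * (eLpNorm g 2 (volume.restrict Ω)).toReal := by
  have h := abs_real_inner_le_norm p (hg.toLp g)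
  rw [inner_eq_integral, Lp.norm_toLp] at h
  refine le_trans (le_of_eq ?_) h
  congr 1
  refine integral_congr_ae ?_
  filter_upwards [hg.coeFn_toLp] with x hx
  rw [hx]

theorem exists_finset_planeIndex {Ω : Set Plane} (hΩ : Bornology.IsBounded Ω) {h : ℝ}
    (hh : 0 < h) : ∃ T : Finset (ℤ × ℤ), ∀ x ∈ Ω, planeIndex h x ∈ T := by
  obtain ⟨M, hM⟩ := hΩ.subset_closedBall 0
  refine ⟨Finset.Icc ⌊-M / h⌋ ⌊M / h⌋ ×ˢ Finset.Icc ⌊-M / h⌋ ⌊M / h⌋, fun x hx => ?_⟩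
  have hx' : ‖x‖ ≤ M := by simpa using hM hx
  have hi (i : Fin 2) : ⌊x i / h⌋ ∈ Finset.Icc ⌊-M / h⌋ ⌊M / h⌋ := by
    have h1 : |x i| ≤ M := (PiLp.norm_apply_le x i).trans hx'
    rw [abs_le] at h1
    rw [Finset.mem_Icc]
    exact ⟨Int.floor_le_floor (by gcongr; exact h1.1), Int.floor_le_floor (by gcongr; exact h1.2)⟩
  exact Finset.mem_product.2 ⟨hi 0, hi 1⟩

theorem chart_refl_apply (z : ℝ × ℝ) (i : Fin 2) :
    chart (LinearIsometryEquiv.refl ℝ Plane) z i = ![z.1, z.2] i := by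
  rw [chart_eq]
  rfl

section GridPlane

variable {U : Set Plane} {R : Plane → ℝ} {h : ℝ}

/-- The grid Poincaré inequality in Euclidean coordinates, with the square root taken through 4h²(A²
+ B²) ≤ (2h(A + B))². -/
theorem eLpNorm_sub_gridAverage_le (hh : 0 < h) (hR : IsTest U R) :
    eLpNorm (fun x => R x - gridAverage h (fun z => R (chart (LinearIsometryEquiv.refl ℝ Plane) z))
      (planeIndex h x)) 2 volume ≤
      ENNReal.ofReal (2 * h) * ∑ j, eLpNorm (partialDeriv j R) 2 volume := by
  set Φ := chart (LinearIsometryEquiv.refl ℝ Plane) with hΦ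
  have hax (j : Fin 2) : axis (LinearIsometryEquiv.refl ℝ Plane) j = EuclideanSpace.single j 1 :=
    rfl
  have hΦc : Continuous Φ := by rw [hΦ]; unfold chart; fun_prop
  have hΦR : HasCompactSupport fun z => R (Φ z) := by
    refine HasCompactSupport.intro (hR.2.isCompact.image
      (f := fun y : Plane => (y 0, y 1)) (by fun_prop)) fun z hz => ?_
    by_contra hne
    refine hz ⟨Φ z, subset_tsupport _ hne, ?_⟩
    simp [hΦ, chart_refl_apply]
  have hdiff := hR.1.differentiable (by simp)
  have key := lintegral_sub_gridAverage_sq_le hh (f := fun z => R (Φ z))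
    (g₁ := fun z => partialDeriv 0 R (Φ z)) (g₂ := fun z => partialDeriv 1 R (Φ z))
    (hR.1.continuous.comp hΦc) hΦR ((hR.partialDeriv 0).1.continuous.comp hΦc)
    ((hR.partialDeriv 1).1.continuous.comp hΦc)
    (fun x y => by
      have h1 : HasDerivAt (fun x : ℝ => Φ (x, y)) (EuclideanSpace.single 0 1) x := by
        simpa [hΦ, chart, hax] using ((hasDerivAt_id x).smul_const
          (EuclideanSpace.single (0 : Fin 2) (1 : ℝ))).add_const
            (y • EuclideanSpace.single (1 : Fin 2) (1 : ℝ))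
      exact (hdiff _).hasFDerivAt.comp_hasDerivAt x h1)
    (fun x y => by
      have h1 : HasDerivAt (fun y : ℝ => Φ (x, y)) (EuclideanSpace.single 1 1) y := by
        simpa [hΦ, chart, hax] using ((hasDerivAt_id y).smul_const
          (EuclideanSpace.single (1 : Fin 2) (1 : ℝ))).const_add
            (x • EuclideanSpace.single (0 : Fin 2) (1 : ℝ))
      exact (hdiff _).hasFDerivAt.comp_hasDerivAt y h1)
  refine (ENNReal.pow_le_pow_left_iff (n := 2) (by norm_num)).1 ?_
  rw [mul_pow, eLpNorm_two_sq, ← lintegral_chart (L := LinearIsometryEquiv.refl ℝ Plane), ← hΦ]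
  have e (z : ℝ × ℝ) : planeIndex h (Φ z) = gridIndex h z := by
    simp [planeIndex, hΦ, chart_refl_apply]
  simp_rw [e]
  refine key.trans ?_
  rw [lintegral_chart (L := LinearIsometryEquiv.refl ℝ Plane)
      (fun x => ‖partialDeriv 0 R x‖ₑ ^ 2),
    lintegral_chart (L := LinearIsometryEquiv.refl ℝ Plane) (fun x => ‖partialDeriv 1 R x‖ₑ ^ 2),
    ← eLpNorm_two_sq, ← eLpNorm_two_sq, Fin.sum_univ_two,
    ENNReal.ofReal_mul (by norm_num : (0 : ℝ) ≤ 2)]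
  refine mul_le_mul' (le_of_eq ?_) ?_
  · rw [mul_pow]
    norm_num
  · rw [add_sq]
    calc _ ≤ _ := add_le_add_left (le_self_add (b := 2 * eLpNorm (partialDeriv 0 R) 2 volume *
          eLpNorm (partialDeriv 1 R) 2 volume)) _
      _ = _ := rfl

/-- Cauchy–Schwarz on a cell of area h²: the integral is at most h‖R‖, and dividing by h² leaves
h⁻¹. -/
theorem abs_gridAverage_le (hh : 0 < h) (hR : IsTest U R) (x : Plane) :
    |gridAverage h (fun z => R (chart (LinearIsometryEquiv.refl ℝ Plane) z)) (planeIndex h x)| ≤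
      h⁻¹ * l2norm R := by
  set Φ := chart (LinearIsometryEquiv.refl ℝ Plane) with hΦ
  set S := {q | gridIndex h q = planeIndex h x} with hS
  have hΦc : Continuous Φ := by rw [hΦ]; unfold chart; fun_prop
  have hm : Measurable fun z => ‖R (Φ z)‖ₑ := (hR.1.continuous.comp hΦc).measurable.enorm
  have h1 : ‖∫ q in S, R (Φ q)‖ₑ ≤ ENNReal.ofReal (h * l2norm R) := by
    refine (ENNReal.pow_le_pow_left_iff (n := 2) (by norm_num)).1 ?_
    calc _ ≤ (∫⁻ q in S, ‖R (Φ q)‖ₑ) ^ 2 :=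
          pow_le_pow_left' (enorm_integral_le_lintegral_enorm _) 2
      _ ≤ volume S * ∫⁻ q in S, ‖R (Φ q)‖ₑ ^ 2 := setLIntegral_sq_le _ _ hm
      _ ≤ ENNReal.ofReal h ^ 2 * ∫⁻ q, ‖R (Φ q)‖ₑ ^ 2 := by
          refine mul_le_mul' (le_of_eq ?_) (setLIntegral_le_lintegral _ _)
          exact volume_gridIndex hh (x 0, x 1)
      _ = _ := by
          rw [lintegral_chart (L := LinearIsometryEquiv.refl ℝ Plane) (fun x => ‖R x‖ₑ ^ 2),
            ← eLpNorm_two_sq, ENNReal.ofReal_mul hh.le, mul_pow, hR.ofReal_l2norm]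
  have h2 : |∫ q in S, R (Φ q)| ≤ h * l2norm R := by
    rw [← ofReal_norm] at h1
    exact (ENNReal.ofReal_le_ofReal_iff (mul_nonneg hh.le (l2norm_nonneg R))).1 h1
  rw [gridAverage, abs_mul, abs_of_pos (by positivity : 0 < (h ^ 2)⁻¹)]
  calc _ ≤ (h ^ 2)⁻¹ * (h * l2norm R) := by gcongr
    _ = _ := by field_simp

end GridPlane

/-- Up to a small multiple of the `H¹` norm, the pairing with test functions is controlled by
finitely many integrals. -/
theorem exists_finite_control {Ω : Set Plane} (hΩo : IsOpen Ω) (hΩ : Bornology.IsBounded Ω)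
    {ε : ℝ} (hε : 0 < ε) : ∃ (h : ℝ) (T : Finset (ℤ × ℤ)) (K : ℝ), 0 < K ∧
      ∀ (p : L2 Ω) (R : Plane → ℝ), IsTest Ω R →
        |∫ x in Ω, p x * R x| ≤ ε * ‖p‖ * ∑ j, l2norm (partialDeriv j R) +
          K * l2norm R * ∑ m ∈ T, |∫ x in Ω ∩ {x | planeIndex h x = m}, p x| := by
  set h := ε / 2 with hhdef
  have hh : 0 < h := by positivity
  obtain ⟨T, hT⟩ := exists_finset_planeIndex hΩ hh
  refine ⟨h, T, h⁻¹, by positivity, fun p R hR => ?_⟩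
  have hfin : IsFiniteMeasure (volume.restrict Ω) := ⟨by simpa using hΩ.measure_lt_top⟩
  set a := gridAverage h (fun z => R (chart (LinearIsometryEquiv.refl ℝ Plane) z)) with ha
  have ham : Measurable fun x => a (planeIndex h x) :=
    (Measurable.of_discrete (f := a)).comp (measurable_planeIndex h)
  have hD := eLpNorm_sub_gridAverage_le hh hR
  rw [← ha] at hD
  have hsum : ∑ j, eLpNorm (partialDeriv j R) 2 volume ≠ ⊤ :=
    (ENNReal.sum_lt_top.2 fun j _ => (hR.partialDeriv j).eLpNorm_ne_top.lt_top).ne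
  have htop := ENNReal.mul_ne_top (ENNReal.ofReal_ne_top (r := 2 * h)) hsum
  have hDΩ : eLpNorm (fun x => R x - a (planeIndex h x)) 2 (volume.restrict Ω) ≤
      ENNReal.ofReal (2 * h) * ∑ j, eLpNorm (partialDeriv j R) 2 volume :=
    (eLpNorm_mono_measure _ Measure.restrict_le_self).trans hD
  have hDm : MemLp (fun x => R x - a (planeIndex h x)) 2 (volume.restrict Ω) :=
    ⟨(hR.1.continuous.measurable.sub ham).aestronglyMeasurable, hDΩ.trans_lt htop.lt_top⟩
  have hDreal : (eLpNorm (fun x => R x - a (planeIndex h x)) 2 (volume.restrict Ω)).toReal ≤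
      ε * ∑ j, l2norm (partialDeriv j R) := by
    have := ENNReal.toReal_mono htop hDΩ
    rw [ENNReal.toReal_mul, ENNReal.toReal_ofReal (by positivity),
      ENNReal.toReal_sum fun j _ => (hR.partialDeriv j).eLpNorm_ne_top] at this
    have e : 2 * h = ε := by rw [hhdef]; ring
    rwa [e] at this
  have hmR := hR.memLp (volume.restrict Ω)
  have ham2 : MemLp (fun x => a (planeIndex h x)) 2 (volume.restrict Ω) := by
    have := hmR.sub hDm
    refine this.ae_eq (Eventually.of_forall fun x => ?_)
    simp
  have i1 := (Lp.memLp p).integrable_mul hDm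
  have i2 := (Lp.memLp p).integrable_mul ham2
  -- The oscillation of R on the cells is small in L², since 2h = ε. The cellwise constant part sees
  -- p only through its integrals over the finitely many cells that meet Ω.
  have hsplit : ∫ x in Ω, p x * R x =
      (∫ x in Ω, p x * (R x - a (planeIndex h x))) + ∫ x in Ω, p x * a (planeIndex h x) := by
    have := integral_add i1 i2
    rw [show (∫ x in Ω, p x * (R x - a (planeIndex h x))) =
      ∫ x in Ω, ((p : Plane → ℝ) * fun x => R x - a (planeIndex h x)) x from rfl,
      show (∫ x in Ω, p x * a (planeIndex h x)) =
      ∫ x in Ω, ((p : Plane → ℝ) * fun x => a (planeIndex h x)) x from rfl, ← this]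
    refine integral_congr_ae (Eventually.of_forall fun x => ?_)
    simp only [Pi.mul_apply]
    ring
  have hcells : ∫ x in Ω, p x * a (planeIndex h x) =
      ∑ m ∈ T, a m * ∫ x in Ω ∩ {x | planeIndex h x = m}, p x := by
    have hU : Ω = ⋃ m ∈ T, Ω ∩ {x | planeIndex h x = m} := by
      ext x
      simp only [mem_iUnion, mem_inter_iff, exists_prop]
      exact ⟨fun hx => ⟨_, hT x hx, hx, rfl⟩, fun ⟨m, _, hx, _⟩ => hx⟩
    have hInt (g : Plane → ℝ) : ∫ x in Ω, g x =
        ∫ x in ⋃ m ∈ T, Ω ∩ {x | planeIndex h x = m}, g x := by rw [← hU]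
    rw [hInt fun x => p x * a (planeIndex h x), integral_biUnion_finset]
    · refine Finset.sum_congr rfl fun m _ => ?_
      rw [← integral_const_mul]
      refine setIntegral_congr_fun (hΩo.measurableSet.inter (measurableSet_planeIndex h m)) ?_
      rintro x ⟨_, hx⟩
      have hx' : planeIndex h x = m := hx
      simp only [hx', mul_comm]
    · exact fun m _ => hΩo.measurableSet.inter (measurableSet_planeIndex h m)
    · intro m _ m' _ hne
      refine disjoint_left.2 ?_
      rintro x ⟨_, h1⟩ ⟨_, h2⟩
      exact hne (Eq.trans (Eq.symm h1) h2)
    · intro m _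
      exact IntegrableOn.mono_set (t := Ω) i2 inter_subset_left
  rw [hsplit]
  refine (abs_add_le _ _).trans (add_le_add ?_ ?_)
  · refine (abs_integral_mul_le p hDm).trans ?_
    calc _ ≤ ‖p‖ * (ε * ∑ j, l2norm (partialDeriv j R)) := by gcongr
      _ = _ := by ring
  · rw [hcells, Finset.mul_sum]
    refine (Finset.abs_sum_le_sum_abs _ _).trans (Finset.sum_le_sum fun m _ => ?_)
    rw [abs_mul]
    rcases eq_empty_or_nonempty {x : Plane | planeIndex h x = m} with hemp | ⟨x, hx⟩
    · simp [hemp]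
    · refine mul_le_mul_of_nonneg_right ?_ (abs_nonneg _)
      have hx' : planeIndex h x = m := hx
      rw [← hx']
      exact abs_gridAverage_le hh hR x

/-! ### Functions with vanishing weak gradient -/

section WeakGradient

variable {Ω : Set Plane} {q : Plane → ℝ}

/-- The derivative of the mollification at x pairs q with a derivative of y ↦ η(x - y), which is a
test function in Ω as long as the mollification ball around x stays inside Ω. -/
theorem fderiv_bump_convolution_eq_zero (hq : LocallyIntegrable q volume)
    (hw : ∀ f, IsTest Ω f → ∀ j, ∫ x, q x * partialDeriv j f x = 0)
    (φ : ContDiffBump (0 : Plane)) {x : Plane} (hx : Metric.closedBall x φ.rOut ⊆ Ω) :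
    fderiv ℝ (convolution (φ.normed volume) q (ContinuousLinearMap.lsmul ℝ ℝ) volume) x = 0 := by
  set η := φ.normed volume with hη
  have hηs : ContDiff ℝ ∞ η := φ.contDiff_normed
  have hηc : HasCompactSupport η := φ.hasCompactSupport_normed
  have h1 := (hηc.hasFDerivAt_convolution_left (ContinuousLinearMap.lsmul ℝ ℝ)
    (hηs.of_le (by simp)) hq x).fderiv
  have ht : IsTest Ω fun y => η (x - y) := by
    refine ⟨hηs.comp (contDiff_const.sub contDiff_id),
      hηc.comp_homeomorph (Homeomorph.subLeft x), ?_⟩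
    refine (closure_minimal ?_ Metric.isClosed_closedBall).trans hx
    intro y hy
    have : x - y ∈ Function.support η := hy
    rw [hη, φ.support_normed_eq] at this
    rw [Metric.mem_closedBall, dist_comm, dist_eq_norm]
    simpa using (mem_ball_zero_iff.1 this).le
  have hzero (j : Fin 2) : fderiv ℝ (convolution η q (ContinuousLinearMap.lsmul ℝ ℝ) volume) x
      (EuclideanSpace.single j 1) = 0 := by
    have hex : ConvolutionExistsAt (fderiv ℝ η) q x
        ((ContinuousLinearMap.lsmul ℝ ℝ).precompL Plane) volume :=
      (hηc.fderiv ℝ).convolutionExists_left _ (hηs.continuous_fderiv (by simp)) hq x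
    rw [h1, convolution_def, ContinuousLinearMap.integral_apply hex,
      ← integral_sub_left_eq_self _ volume x]
    have h2 := hw _ ht j
    rw [← neg_eq_zero, ← integral_neg, ← h2]
    refine integral_congr_ae (Eventually.of_forall fun y => ?_)
    have h3 : partialDeriv j (fun y => η (x - y)) y =
        -(fderiv ℝ η (x - y) (EuclideanSpace.single j 1)) := by
      have h4 : HasFDerivAt (fun y => x - y) (-(ContinuousLinearMap.id ℝ Plane)) y :=
        (hasFDerivAt_id y).const_sub x
      have h5 := (hηs.differentiable (by simp) (x - y)).hasFDerivAt.comp y h4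
      rw [partialDeriv, show (fun y => η (x - y)) = η ∘ fun y => x - y from rfl, h5.fderiv]
      simp
    simp only [h3, sub_sub_cancel]
    simp [ContinuousLinearMap.precompL_apply, mul_comm]
  ext v
  conv_lhs => rw [← sum_coord_smul_single v, map_sum]
  simp only [map_smul, hzero, smul_zero, Finset.sum_const_zero, zero_apply]

/-- A locally integrable function with vanishing weak gradient is locally constant. -/
theorem exists_ae_eq_const_ball (hq : LocallyIntegrable q volume)
    (hw : ∀ f, IsTest Ω f → ∀ j, ∫ x, q x * partialDeriv j f x = 0) {x₀ : Plane} {ρ : ℝ}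
    (hρ : 0 < ρ) (hB : Metric.ball x₀ (2 * ρ) ⊆ Ω) :
    ∃ c : ℝ, ∀ᵐ x, x ∈ Metric.ball x₀ ρ → q x = c := by
  -- Outer radii below ρ keep the mollification of points of the ball of radius ρ inside the ball of
  -- radius 2ρ. The fixed ratio 2 of outer to inner radius gives almost everywhere convergence.
  let φ : ℕ → ContDiffBump (0 : Plane) := fun n =>
    ⟨ρ / (2 * (n + 2)), ρ / (n + 2), by positivity, by
      apply div_lt_div_of_pos_left hρ (by positivity)
      linarith [(Nat.cast_nonneg n : (0 : ℝ) ≤ n)]⟩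
  have hφ : Tendsto (fun n => (φ n).rOut) atTop (𝓝 0) := by
    have : Tendsto (fun n : ℕ => (n : ℝ) + 2) atTop atTop :=
      tendsto_atTop_add_const_right _ _ tendsto_natCast_atTop_atTop
    exact this.const_div_atTop ρ
  have hφK : ∀ᶠ n in atTop, (φ n).rOut ≤ 2 * (φ n).rIn := Eventually.of_forall fun n => by
    change ρ / (n + 2) ≤ 2 * (ρ / (2 * (n + 2)))
    exact le_of_eq (by field_simp)
  have hae := ContDiffBump.ae_convolution_tendsto_right_of_locallyIntegrable hφ hφK hq
  have hconst (n : ℕ) : ∀ x ∈ Metric.ball x₀ ρ,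
      convolution ((φ n).normed volume) q (ContinuousLinearMap.lsmul ℝ ℝ) volume x =
      convolution ((φ n).normed volume) q (ContinuousLinearMap.lsmul ℝ ℝ) volume x₀ := by
    intro x hx
    have hd : DifferentiableOn ℝ (convolution ((φ n).normed volume) q
        (ContinuousLinearMap.lsmul ℝ ℝ) volume) (Metric.ball x₀ ρ) := fun y _ =>
      (((φ n).hasCompactSupport_normed.hasFDerivAt_convolution_left _
        (φ n).contDiff_normed hq y).differentiableAt).differentiableWithinAt
    refine Metric.isOpen_ball.is_const_of_fderiv_eq_zero
      (convex_ball x₀ ρ).isPreconnected hd (fun y hy => ?_) hx (Metric.mem_ball_self hρ)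
    refine fderiv_bump_convolution_eq_zero hq hw (φ n) (fun z hz => hB ?_)
    have h1 : (φ n).rOut < ρ := by
      change ρ / (n + 2) < ρ
      rw [div_lt_iff₀ (by positivity)]
      nlinarith [(Nat.cast_nonneg n : (0 : ℝ) ≤ n)]
    rw [Metric.mem_ball] at hy ⊢
    rw [Metric.mem_closedBall] at hz
    linarith [dist_triangle z y x₀]
  obtain ⟨x₁, hx₁B, hx₁⟩ : ∃ x₁ ∈ Metric.ball x₀ ρ, Tendsto (fun n => convolution
      ((φ n).normed volume) q (ContinuousLinearMap.lsmul ℝ ℝ) volume x₁) atTop (𝓝 (q x₁)) := by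
    by_contra! hc
    have h0 : volume (Metric.ball x₀ ρ) = 0 :=
      measure_mono_null (fun x hx => hc x hx) (ae_iff.1 hae)
    exact (Metric.measure_ball_pos volume x₀ hρ).ne' h0
  refine ⟨q x₁, ?_⟩
  filter_upwards [hae] with x hx hxB
  refine tendsto_nhds_unique hx ?_
  simpa only [hconst _ x hxB, hconst _ x₁ hx₁B] using hx₁

/-- A locally integrable function on a connected open set with vanishing weak gradient is
constant. -/
theorem exists_ae_eq_const (hΩo : IsOpen Ω) (hΩc : IsConnected Ω) (hq : LocallyIntegrable q volume)
    (hw : ∀ f, IsTest Ω f → ∀ j, ∫ x, q x * partialDeriv j f x = 0) :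
    ∃ c : ℝ, ∀ᵐ x, x ∈ Ω → q x = c := by
  have hloc (x : Ω) : ∃ (c ρ : ℝ), 0 < ρ ∧ ∀ᵐ y, y ∈ Metric.ball (x : Plane) ρ → q y = c := by
    obtain ⟨r, hr, hrΩ⟩ := Metric.isOpen_iff.1 hΩo x x.2
    obtain ⟨c, hc⟩ := exists_ae_eq_const_ball hq hw (x₀ := x) (ρ := r / 2) (by positivity)
      (by rwa [mul_div_cancel₀ _ (by norm_num)])
    exact ⟨c, r / 2, by positivity, hc⟩
  choose c ρ hρ hc using hloc
  -- If y lies in the ball of x, the balls of x and y overlap in a nonempty open set, which has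
  -- positive measure, so the two constants agree.
  have hlc : IsLocallyConstant c := by
    rw [IsLocallyConstant.iff_eventually_eq]
    intro x
    have : ∀ᶠ y : Ω in 𝓝 x, (y : Plane) ∈ Metric.ball (x : Plane) (ρ x) :=
      continuous_subtype_val.continuousAt.eventually (Metric.ball_mem_nhds _ (hρ x))
    filter_upwards [this] with y hy
    by_contra hne
    have hopen : IsOpen (Metric.ball (x : Plane) (ρ x) ∩ Metric.ball (y : Plane) (ρ y)) :=
      Metric.isOpen_ball.inter Metric.isOpen_ball
    have hpos := hopen.measure_pos volume ⟨y, hy, Metric.mem_ball_self (hρ y)⟩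
    refine hpos.ne' ?_
    have hall : ∀ᵐ z, ¬ (z ∈ Metric.ball (x : Plane) (ρ x) ∩ Metric.ball (y : Plane) (ρ y)) := by
      filter_upwards [hc x, hc y] with z h1 h2 hz
      exact hne ((h2 hz.2).symm.trans (h1 hz.1))
    exact measure_eq_zero_iff_ae_notMem.2 hall
  have : PreconnectedSpace Ω := isPreconnected_iff_preconnectedSpace.1 hΩc.isPreconnected
  obtain ⟨x₀, hx₀⟩ := hΩc.nonempty
  refine ⟨c ⟨x₀, hx₀⟩, ?_⟩
  rw [ae_iff]
  refine measure_null_of_locally_null _ fun x hx => ?_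
  have hxΩ : x ∈ Ω := by
    by_contra h
    exact hx fun h' => absurd h' h
  refine ⟨_, inter_mem_nhdsWithin _ (Metric.ball_mem_nhds x (hρ ⟨x, hxΩ⟩)), ?_⟩
  refine measure_mono_null ?_ (ae_iff.1 (hc ⟨x, hxΩ⟩))
  rintro y ⟨hy, hyB⟩ hcy
  refine hy fun _ => ?_
  rw [hcy hyB]
  exact hlc.apply_eq_of_preconnectedSpace _ _

end WeakGradient

/-! ### The inf-sup condition -/

/-- The pressure pairs with all velocities with norm at most `M`: `‖∇p‖₋₁ ≤ M`. -/
def GradBound {Ω : Set Plane} (p : L2 Ω) (M : ℝ) : Prop :=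
  ∀ v : Velocity Ω, bForm v p ≤ M * norm1 v

/-- There are four first derivatives, so a(v,v) ≤ 4B²; the factor 2(P + 1) is a bound for 2√P that
avoids the root. -/
theorem norm1_testVelocity_le {Ω : Set Plane} {P B : ℝ} (hP0 : 0 < P) (hP : PoincareBound Ω P)
    {v : Fin 2 → Plane → ℝ} (hv : ∀ i, IsTest Ω (v i)) (hB0 : 0 ≤ B)
    (hB : ∀ i j, l2norm (partialDeriv j (v i)) ≤ B) :
    norm1 (testVelocity hv) ≤ 2 * (P + 1) * B := by
  refine (abs_le_of_sq_le_sq' ?_ (by positivity)).2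
  have h1 (i j : Fin 2) : ‖(testVelocity hv).grad i j‖ ^ 2 ≤ B ^ 2 := by
    have : ‖(testVelocity hv).grad i j‖ ≤ B :=
      ((hv i).partialDeriv j).norm_toL2_le.trans (hB i j)
    gcongr
  have h2 : aForm (testVelocity hv) (testVelocity hv) ≤ 4 * B ^ 2 := by
    rw [aForm_self_eq]
    simp only [Fin.sum_univ_two]
    linarith [h1 0 0, h1 0 1, h1 1 0, h1 1 1]
  calc _ ≤ P * aForm (testVelocity hv) (testVelocity hv) := hP _
    _ ≤ P * (4 * B ^ 2) := by gcongr
    _ ≤ (2 * (P + 1) * B) ^ 2 := by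
        nlinarith [sq_nonneg B, mul_nonneg hP0.le (sq_nonneg B),
          mul_nonneg (sq_nonneg P) (sq_nonneg B)]

/-- Duality localized to U: a test function in U vanishes on the rest of Ω, so the pairing over Ω
equals the pairing over U. -/
theorem eLpNorm_toReal_le_of_integral_test_le {Ω U : Set Plane} (hΩ : IsOpen Ω)
    (hU : IsOpen U) (hUΩ : U ⊆ Ω) (p : L2 Ω) {A : ℝ} (hA : 0 ≤ A)
    (h : ∀ f, IsTest U f → ∫ x in Ω, p x * f x ≤ A * l2norm f) :
    (eLpNorm p 2 (volume.restrict U)).toReal ≤ A := by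
  have hm : MemLp p 2 (volume.restrict U) :=
    (Lp.memLp p).mono_measure (Measure.restrict_mono_set volume hUΩ)
  rw [← Lp.norm_toLp _ hm]
  refine norm_le_of_integral_test_le hU _ hA fun f hf => ?_
  refine le_trans (le_of_eq ?_) (h f hf)
  have e1 : ∫ x in U, hm.toLp p x * f x = ∫ x in U, p x * f x := by
    refine integral_congr_ae ?_
    filter_upwards [hm.coeFn_toLp] with x hx
    rw [hx]
  rw [e1]
  refine (setIntegral_eq_of_subset_of_forall_sdiff_eq_zero hΩ.measurableSet hUΩ
    fun x hx => ?_).symm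
  rw [image_eq_zero_of_notMem_tsupport fun hxs => hx.2 (hf.tsupport_subset hxs), mul_zero]

/-- Pointwise on Ω, |p| is at most the sum of its restrictions to the covering sets, so the triangle
inequality suffices without a partition of unity. -/
theorem norm_le_sum_eLpNorm {Ω : Set Plane} (hΩo : IsOpen Ω) (p : L2 Ω) {ι : Type*} (t : Finset ι)
    (B : ι → Set Plane) (hBo : ∀ i, IsOpen (B i)) (hB : Ω ⊆ ⋃ i ∈ t, B i) :
    ‖p‖ ≤ ∑ i ∈ t, (eLpNorm p 2 (volume.restrict (Ω ∩ B i))).toReal := by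
  have hms (i : ι) : MeasurableSet (Ω ∩ B i) := (hΩo.inter (hBo i)).measurableSet
  have hfin (i : ι) : eLpNorm p 2 (volume.restrict (Ω ∩ B i)) ≠ ⊤ :=
    ((Lp.memLp p).mono_measure (Measure.restrict_mono_set volume inter_subset_left)).2.ne
  rw [Lp.norm_def, ← ENNReal.toReal_sum fun i _ => hfin i]
  refine ENNReal.toReal_mono (ENNReal.sum_lt_top.2 fun i _ => (hfin i).lt_top).ne ?_
  have hind (i : ι) : eLpNorm ((B i).indicator fun x => ‖p x‖) 2 (volume.restrict Ω) =
      eLpNorm p 2 (volume.restrict (Ω ∩ B i)) := by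
    rw [eLpNorm_indicator_eq_eLpNorm_restrict (hBo i).measurableSet,
      Measure.restrict_restrict (hBo i).measurableSet, inter_comm]
    exact eLpNorm_norm _
  calc eLpNorm p 2 (volume.restrict Ω)
      ≤ eLpNorm (∑ i ∈ t, (B i).indicator fun x => ‖p x‖) 2 (volume.restrict Ω) := by
        refine eLpNorm_mono_ae ?_
        filter_upwards [ae_restrict_mem hΩo.measurableSet] with x hx
        obtain ⟨i, hi, hxi⟩ := mem_iUnion₂.1 (hB hx)
        rw [Finset.sum_apply]
        refine le_trans ?_ (le_abs_self _)
        refine le_trans (le_of_eq ?_) (Finset.single_le_sum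
          (f := fun i => (B i).indicator (fun x => ‖p x‖) x)
          (fun j _ => indicator_nonneg (fun _ _ => norm_nonneg _) _) hi)
        simp only [indicator_of_mem hxi]
    _ ≤ ∑ i ∈ t, eLpNorm ((B i).indicator fun x => ‖p x‖) 2 (volume.restrict Ω) :=
        eLpNorm_sum_le (fun i _ => (Lp.memLp p).1.norm.indicator (hBo i).measurableSet)
          (by norm_num)
    _ = _ := Finset.sum_congr rfl fun i _ => hind i

/-- On a Lipschitz domain the norm of a pressure is controlled by that of its gradient in `H⁻¹` and
finitely many integrals. -/
theorem exists_necas {Ω : Set Plane} (hΩ : IsBoundedLipschitzDomain Ω) :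
    ∃ (h : ℝ) (T : Finset (ℤ × ℤ)) (K : ℝ), 0 < K ∧ ∀ (p : L2 Ω) (M : ℝ), 0 ≤ M → GradBound p M →
      ‖p‖ ≤ K * (M + ∑ m ∈ T, |∫ x in Ω ∩ {x | planeIndex h x = m}, p x|) := by
  obtain ⟨P, hP0, hP⟩ := exists_poincareBound hΩ.isBounded
  obtain ⟨Q, hQ⟩ := exists_poincare_test hΩ.isBounded
  choose r C hr hsol using fun x : closure Ω => exists_local_solver hΩ x.2
  obtain ⟨t, ht⟩ := hΩ.isBounded.isCompact_closure.elim_nhds_subcover'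
    (fun x hx => Metric.ball x (r ⟨x, hx⟩)) (fun x hx => Metric.ball_mem_nhds x (hr ⟨x, hx⟩))
  set D : ℝ := ∑ x ∈ t, (C x : ℝ) with hD
  have hD0 : 0 ≤ D := Finset.sum_nonneg fun x _ => (C x).2
  -- The grid is chosen after the cover. With ε = 1/(4(D + 1)), the sum of all local contributions
  -- 2ε‖p‖ is at most ‖p‖/2 and can be absorbed.
  obtain ⟨h, T, K, hK0, hK⟩ := exists_finite_control hΩ.isOpen hΩ.isBounded
    (by positivity : 0 < 1 / (4 * (D + 1)))
  set ε := 1 / (4 * (D + 1)) with hε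
  have hε0 : 0 < ε := by positivity
  refine ⟨h, T, 2 * (D + 1) * (2 * (P + 1) + 2 * K * Q), by positivity, fun p M hM hp => ?_⟩
  set S := ∑ m ∈ T, |∫ x in Ω ∩ {x | planeIndex h x = m}, p x| with hS
  have hS0 : 0 ≤ S := Finset.sum_nonneg fun m _ => abs_nonneg _
  have hlocal (x : closure Ω) :
      (eLpNorm p 2 (volume.restrict (Ω ∩ Metric.ball (x : Plane) (r x)))).toReal ≤
        C x * (2 * (P + 1) * M + 2 * ε * ‖p‖ + 2 * K * Q * S) := by
    refine eLpNorm_toReal_le_of_integral_test_le hΩ.isOpen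
      (hΩ.isOpen.inter Metric.isOpen_ball) inter_subset_left p (by positivity) fun F hF => ?_
    obtain ⟨v, R, hv, hR, hdiv, hvC, hRC⟩ := hsol x F hF
    have hF0 := l2norm_nonneg F
    have hv1 : norm1 (testVelocity hv) ≤ 2 * (P + 1) * (C x * l2norm F) :=
      norm1_testVelocity_le hP0 hP hv (by positivity)
        fun i j => l2norm_le_of_eLpNorm_le hF (hvC i j)
    have hRs : ∑ j, l2norm (partialDeriv j R) ≤ 2 * (C x * l2norm F) := by
      rw [Fin.sum_univ_two]
      linarith [l2norm_le_of_eLpNorm_le hF (hRC 0), l2norm_le_of_eLpNorm_le hF (hRC 1)]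
    have hRn : l2norm R ≤ Q * (2 * (C x * l2norm F)) :=
      (hQ R hR).trans (by gcongr)
    have hmF := hF.memLp (volume.restrict Ω)
    have hmR := hR.memLp (volume.restrict Ω)
    -- F is the divergence of v minus R: the first part is controlled by the gradient of p, the
    -- second by the finite control.
    have e : ∫ x in Ω, p x * F x = bForm (testVelocity hv) p - ∫ x in Ω, p x * R x := by
      rw [bForm_testVelocity, eq_sub_iff_add_eq]
      have := integral_add ((Lp.memLp p).integrable_mul hmF) ((Lp.memLp p).integrable_mul hmR)
      simp only [Pi.mul_apply] at this
      rw [← this]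
      refine integral_congr_ae (Eventually.of_forall fun x => ?_)
      simp only [hdiv]
      ring
    rw [e]
    calc _ ≤ M * norm1 (testVelocity hv) + |∫ x in Ω, p x * R x| := by
          linarith [hp (testVelocity hv), neg_abs_le (∫ x in Ω, p x * R x)]
      _ ≤ M * (2 * (P + 1) * (C x * l2norm F)) + (ε * ‖p‖ * (2 * (C x * l2norm F)) +
            K * (Q * (2 * (C x * l2norm F))) * S) := by
          refine add_le_add (by gcongr) ((hK p R hR).trans ?_)
          gcongr
      _ = _ := by ring
  have hsum := norm_le_sum_eLpNorm hΩ.isOpen p t (fun x : closure Ω => Metric.ball (x : Plane) (r x))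
    (fun _ => Metric.isOpen_ball) (subset_closure.trans ht)
  have h1 : ‖p‖ ≤ D * (2 * (P + 1) * M + 2 * ε * ‖p‖ + 2 * K * Q * S) := by
    refine hsum.trans ((Finset.sum_le_sum fun x _ => hlocal x).trans (le_of_eq ?_))
    rw [hD, Finset.sum_mul]
  have h2 : D * (2 * ε * ‖p‖) ≤ ‖p‖ / 2 := by
    have : D * ε ≤ 1 / 4 := by
      rw [hε, mul_one_div, div_le_div_iff₀ (by positivity) (by norm_num)]
      linarith
    nlinarith [norm_nonneg p]
  have hQ0 : (0 : ℝ) ≤ Q := Q.2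
  have h3 : ‖p‖ ≤ 2 * D * (2 * (P + 1) * M + 2 * K * Q * S) := by linarith
  calc ‖p‖ ≤ 2 * D * (2 * (P + 1) * M + 2 * K * Q * S) := h3
    _ ≤ 2 * (D + 1) * ((2 * (P + 1) + 2 * K * Q) * (M + S)) := by
        refine mul_le_mul (by linarith) ?_ (by positivity) (by positivity)
        have h4 : 0 ≤ 2 * (P + 1) * S := by positivity
        have h5 : 0 ≤ 2 * K * Q * M := by positivity
        linarith
    _ = _ := by ring

theorem GradBound.sub {Ω : Set Plane} {p q : L2 Ω} {M N : ℝ} (hp : GradBound p M)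
    (hq : GradBound q N) : GradBound (p - q) (M + N) := by
  intro v
  have h1 := hp v
  have h2 := hq ((-1 : ℝ) • v)
  rw [bForm_smul_left, norm1_smul] at h2
  rw [bForm_sub_right]
  norm_num at h2
  linarith

theorem GradBound.smul {Ω : Set Plane} {p : L2 Ω} {M : ℝ} (hp : GradBound p M) {c : ℝ}
    (hc : 0 ≤ c) : GradBound (c • p) (c * M) := by
  intro v
  have e : bForm v (c • p : L2 Ω) = c * bForm v p := by
    rw [bForm_eq, bForm_eq, Finset.mul_sum]
    exact Finset.sum_congr rfl fun i _ => real_inner_smul_right _ _ _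
  rw [e, mul_assoc]
  exact mul_le_mul_of_nonneg_left (hp v) hc

/-- A pressure of mean zero with vanishing weak gradient is zero. -/
theorem eq_zero_of_gradBound_zero {Ω : Set Plane} (hΩ : IsBoundedLipschitzDomain Ω) {p : L2 Ω}
    (hp : IsMeanZero p) (h : GradBound p 0) : p = 0 := by
  have hfin : IsFiniteMeasure (volume.restrict Ω) := ⟨by simpa using hΩ.isBounded.measure_lt_top⟩
  have hms := hΩ.isOpen.measurableSet
  have hb (v : Velocity Ω) : bForm v p = 0 := by
    have h1 := h v
    have h2 := h ((-1 : ℝ) • v)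
    rw [bForm_smul_left] at h2
    linarith
  have hInt : Integrable p (volume.restrict Ω) := (Lp.memLp p).integrable (by norm_num)
  have hq : LocallyIntegrable (Ω.indicator p) volume :=
    ((integrable_indicator_iff hms).2 hInt).locallyIntegrable
  obtain ⟨c, hc⟩ := exists_ae_eq_const hΩ.isOpen hΩ.isConnected hq fun f hf j => by
    have hz : IsTest Ω fun _ : Plane => (0 : ℝ) :=
      ⟨contDiff_const, HasCompactSupport.zero, by simp [tsupport]⟩
    -- The field with f in component j and zero in the other has divergence ∂f/∂x_j, so the
    -- vanishing of `bForm` says that the weak derivatives of p vanish.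
    have hv : ∀ i, IsTest Ω ((fun i => if i = j then f else fun _ => 0) i) := fun i => by
      by_cases hij : i = j
      · simpa [hij] using hf
      · simpa [hij] using hz
    have h1 := bForm_testVelocity hv p
    rw [hb] at h1
    have e1 (x : Plane) : ∑ i, partialDeriv i (if i = j then f else fun _ => 0) x =
        partialDeriv j f x := by
      rw [Finset.sum_eq_single j]
      · simp
      · intro i _ hij
        simp [hij, partialDeriv]
      · simp
    simp_rw [e1] at h1
    rw [h1, ← integral_indicator hms]
    refine integral_congr_ae (Eventually.of_forall fun x => ?_)
    by_cases hx : x ∈ Ω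
    · simp [indicator_of_mem hx]
    · simp [indicator_of_notMem hx]
  have hpc : p =ᵐ[volume.restrict Ω] fun _ => c := by
    refine (ae_restrict_iff' hms).2 ?_
    filter_upwards [hc] with x hx hxΩ
    rw [← hx hxΩ, indicator_of_mem hxΩ]
  have hc0 : c = 0 := by
    rw [IsMeanZero, integral_congr_ae hpc, integral_const, smul_eq_mul, mul_eq_zero] at hp
    refine hp.resolve_left fun h0 => ?_
    rw [measureReal_restrict_apply_univ, Measure.real, ENNReal.toReal_eq_zero_iff] at h0
    rcases h0 with h0 | h0
    · exact (hΩ.isOpen.measure_pos volume hΩ.isConnected.nonempty).ne' h0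
    · exact hΩ.isBounded.measure_lt_top.ne h0
  refine Lp.eq_zero_iff_ae_eq_zero.2 ?_
  rw [hc0] at hpc
  exact hpc

/-- Integrals over measurable sets are continuous functionals on `L²(Ω)`. -/
theorem exists_inner_eq_setIntegral {Ω : Set Plane} (hΩ : Bornology.IsBounded Ω) {s : Set Plane}
    (hs : MeasurableSet s) : ∃ e : L2 Ω, ∀ p : L2 Ω, ∫ x in Ω ∩ s, p x = inner ℝ e p := by
  have hfin : IsFiniteMeasure (volume.restrict Ω) := ⟨by simpa using hΩ.measure_lt_top⟩
  refine ⟨indicatorConstLp 2 hs (measure_ne_top _ _) (1 : ℝ), fun p => ?_⟩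
  rw [L2.inner_indicatorConstLp_one, Measure.restrict_restrict hs, inter_comm]

/-- The inf-sup condition holds on bounded Lipschitz domains. -/
theorem exists_infSupBound {Ω : Set Plane} (hΩ : IsBoundedLipschitzDomain Ω) :
    ∃ β : ℝ, 0 < β ∧ InfSupBound Ω β := by
  obtain ⟨h, T, K, hK0, hK⟩ := exists_necas hΩ
  choose e he using fun m : ℤ × ℤ =>
    exists_inner_eq_setIntegral hΩ.isBounded (measurableSet_planeIndex h m)
  obtain ⟨e₀, he₀⟩ := exists_inner_eq_setIntegral hΩ.isBounded MeasurableSet.univ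
  simp only [inter_univ] at he₀
  simp_rw [he] at hK
  by_contra! hcon
  -- Failure of the inf-sup bound with β = n + 1 gives p with (n + 1)M < ‖p‖; after normalization
  -- its gradient bound M/‖p‖ is at most 1/(n + 1).
  have hseq (n : ℕ) : ∃ q : L2 Ω, ‖q‖ = 1 ∧ IsMeanZero q ∧ GradBound q (1 / ((n : ℝ) + 1)) := by
    have h1 := hcon (n + 1) (by positivity)
    simp only [InfSupBound, not_forall, not_le] at h1
    obtain ⟨p, M, hp, hM, hb, hlt⟩ := h1
    have hpos : 0 < ‖p‖ := lt_of_le_of_lt (by positivity) hlt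
    refine ⟨‖p‖⁻¹ • p, ?_, ?_, ?_⟩
    · rw [norm_smul, norm_inv, norm_norm, inv_mul_cancel₀ hpos.ne']
    · rw [IsMeanZero, he₀, real_inner_smul_right, ← he₀, hp, mul_zero]
    · intro v
      refine (GradBound.smul hb (inv_nonneg.2 hpos.le) v).trans
        (mul_le_mul_of_nonneg_right ?_ (norm1_nonneg v))
      rw [inv_mul_le_iff₀ hpos, mul_one_div, le_div_iff₀ (by positivity)]
      linarith
  choose q hq1 hq0 hqb using hseq
  have hbdd (n : ℕ) : (fun m : T => inner ℝ (e m) (q n)) ∈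
      Metric.closedBall (0 : T → ℝ) (∑ m : T, ‖e m‖) := by
    rw [mem_closedBall_zero_iff, pi_norm_le_iff_of_nonneg (by positivity)]
    intro m
    refine (norm_inner_le_norm _ _).trans ?_
    rw [hq1, mul_one]
    exact Finset.single_le_sum (f := fun m : T => ‖e m‖) (fun _ _ => norm_nonneg _)
      (Finset.mem_univ m)
  obtain ⟨y, -, φ, hφ, hy⟩ := tendsto_subseq_of_bounded Metric.isBounded_closedBall hbdd
  have hu : Tendsto (fun k => 1 / ((φ k : ℝ) + 1)) atTop (𝓝 0) :=
    tendsto_one_div_add_atTop_nhds_zero_nat.comp hφ.tendsto_atTop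
  -- The estimate of `exists_necas` is applied to differences. Both gradient bounds tend to zero and
  -- the finitely many cell integrals converge along the subsequence, so the subsequence is Cauchy
  -- in L².
  have hdist (k l : ℕ) : dist (q (φ k)) (q (φ l)) ≤
      K * (1 / ((φ k : ℝ) + 1) + 1 / ((φ l : ℝ) + 1) +
        ∑ m : T, dist (inner ℝ (e m) (q (φ k))) (inner ℝ (e m) (q (φ l)))) := by
    rw [dist_eq_norm]
    refine (hK _ _ (by positivity) ((hqb (φ k)).sub (hqb (φ l)))).trans (le_of_eq ?_)
    congr 2
    rw [← Finset.sum_coe_sort]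
    exact Finset.sum_congr rfl fun m _ => by rw [inner_sub_right, Real.dist_eq]
  have hcau : CauchySeq fun k => q (φ k) := by
    rw [cauchySeq_iff_tendsto_dist_atTop_0]
    have h1 : Tendsto (fun n : ℕ × ℕ => 1 / ((φ n.1 : ℝ) + 1)) atTop (𝓝 0) := by
      rw [← prod_atTop_atTop_eq]; exact hu.comp tendsto_fst
    have h2 : Tendsto (fun n : ℕ × ℕ => 1 / ((φ n.2 : ℝ) + 1)) atTop (𝓝 0) := by
      rw [← prod_atTop_atTop_eq]; exact hu.comp tendsto_snd
    have h3 : Tendsto (fun n : ℕ × ℕ => ∑ m : T,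
        dist (inner ℝ (e m) (q (φ n.1))) (inner ℝ (e m) (q (φ n.2)))) atTop (𝓝 0) := by
      rw [← Finset.sum_const_zero (s := (Finset.univ : Finset T))]
      refine tendsto_finsetSum _ fun m _ => ?_
      exact cauchySeq_iff_tendsto_dist_atTop_0.1 ((tendsto_pi_nhds.1 hy m).cauchySeq)
    have h4 := (((h1.add h2).add h3).const_mul K)
    simp only [add_zero, mul_zero] at h4
    exact squeeze_zero (fun _ => dist_nonneg) (fun n => hdist n.1 n.2) h4
  obtain ⟨p, hp⟩ := cauchySeq_tendsto_of_complete hcau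
  have hp1 : ‖p‖ = 1 := by
    refine tendsto_nhds_unique hp.norm ?_
    simp [hq1]
  have hp0 : IsMeanZero p := by
    rw [IsMeanZero, he₀]
    have h1 : Tendsto (fun k => inner ℝ e₀ (q (φ k))) atTop (𝓝 (inner ℝ e₀ p)) :=
      tendsto_const_nhds.inner hp
    refine tendsto_nhds_unique h1 ?_
    have h2 (k : ℕ) : inner ℝ e₀ (q (φ k)) = 0 := by rw [← he₀]; exact hq0 _
    simp [h2]
  have hpb : GradBound p 0 := by
    intro v
    have h1 : Tendsto (fun k => bForm v (q (φ k))) atTop (𝓝 (bForm v p)) := by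
      simp_rw [bForm_eq]
      exact tendsto_finsetSum _ fun i _ => tendsto_const_nhds.inner hp
    exact le_of_tendsto_of_tendsto' h1 (hu.mul_const (norm1 v)) fun k => hqb (φ k) v
  have hz := eq_zero_of_gradBound_zero hΩ hp0 hpb
  rw [hz, norm_zero] at hp1
  exact zero_ne_one hp1

end StokesLPS

end

/-! ### The theorem: Poincaré and inf-sup inserted into the error estimates -/

open StokesLPS in
theorem theorem4p2 (Ω : Set Plane) (hΩ : IsBoundedLipschitzDomain Ω) (lam : ℝ) :
    (∃ C δ : ℝ, 0 < C ∧ 0 < δ ∧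
      ∀ (u : Velocity Ω) (p : L2 Ω), IsStokesEigen u p lam →
      ∀ (D : Discretization Ω) (uh : Velocity Ω) (ph : D.Vh) (lamh : ℝ), D.IsEigen uh ph lamh →
      ∀ (ut : Velocity Ω) (pt : L2 Ω), IsStokesSource lamh uh ut pt →
        norm1 (u - ut) + ‖p - pt‖ ≤ C * (normNeg1 (u - uh) + |lam - lamh|) ∧
        (normNeg1 (u - uh) + |lam - lamh| ≤ δ →
          ut ≠ 0 ∧
          |rayleigh ut - lam| ≤ C * (normNeg1 (u - uh) ^ 2 + |lam - lamh| ^ 2))) ∧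
    (∀ (u : Velocity Ω) (p : L2 Ω), IsStokesEigen u p lam →
      ∀ (D : ℕ → Discretization Ω) (uh : ℕ → Velocity Ω) (ph : ∀ n, (D n).Vh) (lamh : ℕ → ℝ),
        (∀ n, (D n).IsEigen (uh n) (ph n) (lamh n)) →
        Tendsto (fun n => normNeg1 (u - uh n)) atTop (𝓝 0) →
        Tendsto lamh atTop (𝓝 lam) →
      ∀ (ut : ℕ → Velocity Ω) (pt : ℕ → L2 Ω),
        (∀ n, IsStokesSource (lamh n) (uh n) (ut n) (pt n)) →
        ∃ C : ℝ, 0 < C ∧ ∀ n,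
          norm1 (u - ut n) + ‖p - pt n‖ ≤ C * (normNeg1 (u - uh n) + |lam - lamh n|) ∧
          (ut n ≠ 0 →
            |rayleigh (ut n) - lam| ≤
              C * (normNeg1 (u - uh n) ^ 2 + |lam - lamh n| ^ 2))) := by
  obtain ⟨P, hP0, hP⟩ := exists_poincareBound hΩ.isBounded
  obtain ⟨β, hβ0, hβ⟩ := exists_infSupBound hΩ
  exact error_estimates hΩ.isBounded hP0 hβ0 hP hβ lam
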